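/- Let $m\ge 2$ and $N\ge 1$ be coprime integers, $G=\mathrm{SL}(m,\mathbb R)$, $\mathfrak g=\mathfrak{sl}(m,\mathbb R)$, and let $H\subset G$ be the subgroup of all $h$ with $he_1\in\mathbb R e_1$. Indices are taken modulo $N$. Let $H^N$ act on $G^N$ by the discrete gauge action $L_n\mapsto h_{n+1}L_nh_n^{-1}$, and give $G^N/H^N$ the quotient topology; a function on an open subset of $G^N/H^N$ is called smooth if its pull-back to $G^N$ is smooth. For smooth $\mathcal F$ on (an open subset of) $G^N$ let $\nabla\mathcal F,\nabla'\mathcal F$ be its left and right gradients with respect to $\langle\xi,\eta\rangle=\sum_n\mathrm{tr}(\xi_n\eta_n)$, that is, $\frac{d}{d\epsilon}|_{0}\mathcal F(\exp(\epsilon\xi)L)=\langle\nabla\mathcal F(L),\xi\rangle$ and $\frac{d}{d\epsilon}|_{0}\mathcal F(L\exp(\epsilon\xi))=\langle\nabla'\mathcal F(L),\xi\rangle$. Write $\xi_\pm$ for the strictly upper/lower triangular parts of $\xi\in\mathfrak g$, and put $r(\xi\wedge\eta)=\frac12\mathrm{tr}(\xi(\eta_+-\eta_-))$, $r(\xi\otimes\eta)=\mathrm{tr}(\xi_-\eta_+)$.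 The twisted bracket is $$\{\mathcal F,\mathcal H\}(L)=\sum_{s}r(\nabla_s\mathcal F\wedge\nabla_s\mathcal H)+\sum_{s}r(\nabla'_s\mathcal F\wedge\nabla'_s\mathcal H)-\sum_{s}r(\nabla'_{s+1}\mathcal F\otimes\nabla_s\mathcal H)+\sum_{s}r(\nabla'_{s+1}\mathcal H\otimes\nabla_s\mathcal F),$$ and the reduced bracket of functions $f,h$ on $G^N/H^N$ is $\{f,h\}_R([L])=\{\mathcal F,\mathcal H\}(L)$, where $\mathcal F,\mathcal H$ are the pull-backs of $f,h$ to $G^N$. To $L\in G^N$ one associates the twisted projective polygon with vertices $[g_ne_1]\in\mathbb{RP}^{m-1}$, where $g_0=1$ and $g_{n+1}=g_nL_n^{-1}$ (here the index of $g_n$ is not taken modulo $N$). It satisfies $g_{n+N}=Tg_n$ with the monodromy $T=L_0^{-1}L_1^{-1}\cdots L_{N-1}^{-1}$, and the conjugacy class of $T$ in $G$ depends only on $[L]\in G^N/H^N$. Let $M\subset G^N/H^N$ be the set of classes whose polygon is nondegenerate, i.e. $\det(g_ne_1,\dots,g_{n+m-1}e_1)\neq0$ for all $n$. For an open set $W\subseteq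 G^N/H^N$ with $W\subseteq M$ and $p\in W$, the symplectic leaf of $\{\ ,\ \}_R$ in $W$ through $p$ is the set of all points that can be joined to $p$ inside $W$ by finitely many pieces of trajectories of locally defined Hamiltonian vector fields. Proposition. (a) On open subsets of $G^N/H^N$ contained in $M$, the reduced bracket of smooth functions is well defined: $\{\mathcal F,\mathcal H\}(L)$ depends only on $[L]$. (b) The symplectic leaves are locally classified by the conjugacy class of the monodromy. Precisely, for every open $W\subseteq G^N/H^N$ with $W\subseteq M$ and every $p\in W$, the symplectic leaf of $\{\ ,\ \}_R$ in $W$ through $p$ is the path component containing $p$ of $$\{x\in W:\ \text{the monodromy of } x \text{ is conjugate in } G \text{ to the monodromy of } p\},$$ and $p$ has an open neighbourhood $U\subseteq W$ such that a point $q\in U$ lies on this leaf if and only if the monodromies of $q$ and $p$ are conjugate in $G$. -/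

import Mathlib

namespace TwistedGon

open Matrix Topology
open scoped ContDiff

/-! ### The group `G = SL(m, ℝ)`, its Lie algebra and the exponential map -/

/-- `G = SL(m, ℝ)`. -/
abbrev G (m : ℕ) : Type := SpecialLinearGroup (Fin m) ℝ

/-- The Lie algebra `𝔤 = sl(m, ℝ)` of traceless matrices. -/
abbrev 𝔤 (m : ℕ) : Type := LieAlgebra.SpecialLinear.sl (Fin m) ℝ

/-- `G^N`; the indices live in `ℤ/N`, that is, sequences are periodic of period `N`. -/
abbrev GN (m N : ℕ) : Type := ZMod N → G m

open scoped Matrix.Norms.Operator in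
theorem det_exp_of_trace_eq_zero {m : ℕ} (X : Matrix (Fin m) (Fin m) ℝ) (hX : X.trace = 0) :
    (NormedSpace.exp X).det = 1 := by
  have hdet : DifferentiableAt ℝ (fun M : Matrix (Fin m) (Fin m) ℝ => M.det) 1 := by
    have hent : ∀ i j : Fin m,
        DifferentiableAt ℝ (fun M : Matrix (Fin m) (Fin m) ℝ => M i j) 1 := fun i j =>
      (LinearMap.toContinuousLinearMap
        (Matrix.entryLinearMap ℝ ℝ i j : Matrix (Fin m) (Fin m) ℝ →ₗ[ℝ] ℝ)).differentiableAt
    simp only [Matrix.det_apply]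
    refine DifferentiableAt.fun_sum fun σ _ => ?_
    refine DifferentiableAt.const_smul ?_ _
    exact (HasFDerivAt.finsetProd (u := Finset.univ)
      (g := fun i (M : Matrix (Fin m) (Fin m) ℝ) => M (σ i) i)
      fun i _ => (hent (σ i) i).hasFDerivAt).differentiableAt
  obtain ⟨D, hD⟩ := hdet
  have h1 : HasDerivAt (fun t : ℝ => (NormedSpace.exp (t • X)).det) (D X) 0 := by
    have hc : HasDerivAt (fun t : ℝ => NormedSpace.exp (t • X)) X 0 := by
      have h0 := hasDerivAt_exp_smul_const (𝕂 := ℝ) X (0 : ℝ)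
      rw [zero_smul, NormedSpace.exp_zero, one_mul] at h0
      exact h0
    have hD' : HasFDerivAt (fun M : Matrix (Fin m) (Fin m) ℝ => M.det) D
        (NormedSpace.exp ((0 : ℝ) • X)) := by simpa using hD
    exact hD'.comp_hasDerivAt (0 : ℝ) hc
  have h2 : HasDerivAt (fun t : ℝ => (1 + t • X).det) (D X) 0 := by
    have hc : HasDerivAt (fun t : ℝ => 1 + t • X) X 0 := by
      have h0 := ((hasDerivAt_id (0 : ℝ)).smul_const X).const_add 1
      rw [one_smul] at h0
      exact h0
    have hD' : HasFDerivAt (fun M : Matrix (Fin m) (Fin m) ℝ => M.det) D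
        (1 + (0 : ℝ) • X) := by simpa using hD
    exact hD'.comp_hasDerivAt (0 : ℝ) hc
  have h3 : D X = 0 := by
    let p : Polynomial ℝ :=
      (det (1 + (Polynomial.X : Polynomial ℝ) • X.map Polynomial.C)).divX.divX
    have h4 : HasDerivAt (fun t : ℝ => (1 + t • X).det) 0 0 := by
      have he : (fun t : ℝ => (1 + t • X).det) = fun t : ℝ => 1 + p.eval t * t ^ 2 := by
        funext t
        rw [Matrix.det_one_add_smul, hX]
        simp [p]
      rw [he]
      have := ((p.hasDerivAt 0).mul (hasDerivAt_pow 2 (0 : ℝ))).const_add 1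
      simpa using this
    exact h2.unique h4
  have h5 : ∀ t : ℝ, HasDerivAt (fun t : ℝ => (NormedSpace.exp (t • X)).det) 0 t := by
    intro t
    have he : (fun s : ℝ => (NormedSpace.exp (s • X)).det) =
        fun s : ℝ => (NormedSpace.exp (t • X)).det * (NormedSpace.exp ((s - t) • X)).det := by
      funext s
      rw [← Matrix.det_mul, ← Matrix.exp_add_of_commute, ← add_smul]
      · simp
      · exact ((Commute.refl X).smul_left _).smul_right _
    rw [he]
    have h6 : HasDerivAt (fun s : ℝ => (NormedSpace.exp ((s - t) • X)).det) (D X) t := by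
      have hs : HasDerivAt (fun s : ℝ => s - t) 1 t := (hasDerivAt_id t).sub_const t
      have h1' : HasDerivAt (fun t : ℝ => (NormedSpace.exp (t • X)).det) (D X) (t - t) := by
        simpa using h1
      have h8 := HasDerivAt.comp (h := fun s : ℝ => s - t) t h1' hs
      rw [mul_one] at h8
      exact h8
    simpa [h3] using h6.const_mul (NormedSpace.exp (t • X)).det
  have h7 := is_const_of_deriv_eq_zero (fun t => (h5 t).differentiableAt)
    (fun t => (h5 t).deriv) 1 0
  simpa using h7

/-- The exponential map `sl(m, ℝ) → SL(m, ℝ)`. -/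
noncomputable def expG {m : ℕ} (ξ : 𝔤 m) : G m :=
  ⟨NormedSpace.exp (ξ : Matrix (Fin m) (Fin m) ℝ),
    det_exp_of_trace_eq_zero _ (LinearMap.mem_ker.1 ξ.2)⟩

/-! ### Smooth functions on `G^N`, gradients and the twisted bracket -/

open scoped Matrix.Norms.Elementwise in
/-- `F : G^N → ℝ` is smooth at `L`: near `L` it is the restriction of a smooth function on the
ambient space of `N`-tuples of matrices (`G^N` being an embedded submanifold of that space). -/
def SmoothAt {m N : ℕ} [NeZero N] (F : GN m N → ℝ) (L : GN m N) : Prop :=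
  ∃ F' : (ZMod N → Matrix (Fin m) (Fin m) ℝ) → ℝ,
    ContDiffAt ℝ ∞ F' (fun n => (L n : Matrix (Fin m) (Fin m) ℝ)) ∧
      ∀ᶠ L' in 𝓝 L, F L' = F' (fun n => (L' n : Matrix (Fin m) (Fin m) ℝ))

/-- The inner product `⟨ξ, η⟩ = ∑ₙ tr (ξₙ ηₙ)` on `𝔤^N`. -/
noncomputable def pairing {m N : ℕ} [NeZero N] (ξ η : ZMod N → 𝔤 m) : ℝ :=
  ∑ n, ((ξ n : Matrix (Fin m) (Fin m) ℝ) * (η n : Matrix (Fin m) (Fin m) ℝ)).trace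

/-- `A ∈ 𝔤^N` is a left gradient of `F` at `L`. -/
def IsLeftGrad {m N : ℕ} [NeZero N] (F : GN m N → ℝ) (L : GN m N) (A : ZMod N → 𝔤 m) : Prop :=
  ∀ ξ : ZMod N → 𝔤 m,
    HasDerivAt (fun ε : ℝ => F (fun n => expG (ε • ξ n) * L n)) (pairing A ξ) 0

/-- `A ∈ 𝔤^N` is a right gradient of `F` at `L`. -/
def IsRightGrad {m N : ℕ} [NeZero N] (F : GN m N → ℝ) (L : GN m N) (A : ZMod N → 𝔤 m) : Prop :=
  ∀ ξ : ZMod N → 𝔤 m,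
    HasDerivAt (fun ε : ℝ => F (fun n => L n * expG (ε • ξ n))) (pairing A ξ) 0

open Classical in
/-- The left gradient `∇F(L)` (it exists and is unique when `F` is smooth at `L`). -/
noncomputable def leftGrad {m N : ℕ} [NeZero N] (F : GN m N → ℝ) (L : GN m N) : ZMod N → 𝔤 m :=
  if h : ∃ A, IsLeftGrad F L A then h.choose else 0

open Classical in
/-- The right gradient `∇'F(L)` (it exists and is unique when `F` is smooth at `L`). -/
noncomputable def rightGrad {m N : ℕ} [NeZero N] (F : GN m N → ℝ) (L : GN m N) : ZMod N → 𝔤 m :=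
  if h : ∃ A, IsRightGrad F L A then h.choose else 0

/-- The strictly upper triangular part `ξ₊`. -/
def upper {m : ℕ} (ξ : 𝔤 m) : Matrix (Fin m) (Fin m) ℝ :=
  Matrix.of fun i j => if i < j then (ξ : Matrix (Fin m) (Fin m) ℝ) i j else 0

/-- The strictly lower triangular part `ξ₋`. -/
def lower {m : ℕ} (ξ : 𝔤 m) : Matrix (Fin m) (Fin m) ℝ :=
  Matrix.of fun i j => if j < i then (ξ : Matrix (Fin m) (Fin m) ℝ) i j else 0

/-- The classical `R`-matrix `R(ξ) = (ξ₊ - ξ₋) / 2`. -/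
noncomputable def Rmat {m : ℕ} (ξ : 𝔤 m) : Matrix (Fin m) (Fin m) ℝ :=
  (1 / 2 : ℝ) • (upper ξ - lower ξ)

/-- `r(ξ ∧ η) = ⟨ξ, R(η)⟩`. -/
noncomputable def rWedge {m : ℕ} (ξ η : 𝔤 m) : ℝ :=
  ((ξ : Matrix (Fin m) (Fin m) ℝ) * Rmat η).trace

/-- `r(ξ ⊗ η) = ⟨ξ₋, η₊⟩`. -/
noncomputable def rTensor {m : ℕ} (ξ η : 𝔤 m) : ℝ := (lower ξ * upper η).trace

/-- The twisted bracket `{F, H}(L)` on `G^N`. The shift acts as `(𝒯 ∇'F)ₛ = ∇'ₛ₊₁F`. -/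
noncomputable def twistedBracket {m N : ℕ} [NeZero N] (F H : GN m N → ℝ) (L : GN m N) : ℝ :=
  ∑ s, rWedge (leftGrad F L s) (leftGrad H L s)
    + ∑ s, rWedge (rightGrad F L s) (rightGrad H L s)
    - ∑ s, rTensor (rightGrad F L (s + 1)) (leftGrad H L s)
    + ∑ s, rTensor (rightGrad H L (s + 1)) (leftGrad F L s)

/-! ### The subgroup `H`, the discrete gauge action and the quotient `G^N / H^N` -/

/-- The first basis vector `e₁` (index `0`). -/
def e₁ (m : ℕ) [NeZero m] : Fin m → ℝ := Pi.single 0 1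

/-- The subgroup `H` of all `h ∈ SL(m, ℝ)` that fix the line spanned by `e₁`, i.e. whose first
column vanishes below the diagonal; its Lie algebra is `𝔤₀ ⊕ 𝔤₁`. -/
def H (m : ℕ) [NeZero m] : Subgroup (G m) where
  carrier := {h | ∃ a : ℝ, a ≠ 0 ∧ (h : Matrix (Fin m) (Fin m) ℝ) *ᵥ e₁ m = a • e₁ m}
  one_mem' := ⟨1, one_ne_zero, by simp⟩
  mul_mem' := by
    rintro g h ⟨a, ha, hg⟩ ⟨b, hb, hh⟩
    refine ⟨b * a, mul_ne_zero hb ha, ?_⟩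
    change ((g : Matrix (Fin m) (Fin m) ℝ) * (h : Matrix (Fin m) (Fin m) ℝ)) *ᵥ e₁ m = _
    rw [← Matrix.mulVec_mulVec, hh, Matrix.mulVec_smul, hg, smul_smul]
  inv_mem' := by
    rintro h ⟨a, ha, hh⟩
    refine ⟨a⁻¹, inv_ne_zero ha, ?_⟩
    have h1 : ((h⁻¹ : G m) : Matrix (Fin m) (Fin m) ℝ) *ᵥ
        ((h : Matrix (Fin m) (Fin m) ℝ) *ᵥ e₁ m) = e₁ m := by
      have h2 : ((h⁻¹ : G m) : Matrix (Fin m) (Fin m) ℝ) * (h : Matrix (Fin m) (Fin m) ℝ) = 1 :=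
        congrArg Subtype.val (inv_mul_cancel h)
      rw [Matrix.mulVec_mulVec, h2, Matrix.one_mulVec]
    rw [hh, Matrix.mulVec_smul] at h1
    rw [← h1, smul_smul, inv_mul_cancel₀ ha, one_smul, h1]

/-- The discrete gauge action `(hₙ, gₙ) ↦ hₙ₊₁ gₙ hₙ⁻¹`. -/
def gauge {m N : ℕ} (h L : GN m N) : GN m N := fun n => h (n + 1) * L n * (h n)⁻¹

/-- Two elements of `G^N` are equivalent when they lie on one gauge orbit of `H^N`. -/
def gaugeSetoid (m N : ℕ) [NeZero m] : Setoid (GN m N) where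
  r L L' := ∃ h : GN m N, (∀ n, h n ∈ H m) ∧ L' = gauge h L
  iseqv :=
    { refl := fun L => ⟨1, fun _ => (H m).one_mem, by funext n; simp [gauge]⟩
      symm := by
        rintro L L' ⟨h, hh, rfl⟩
        refine ⟨h⁻¹, fun n => (H m).inv_mem (hh n), ?_⟩
        funext n
        simp [gauge, mul_assoc]
      trans := by
        rintro L L' L'' ⟨h, hh, rfl⟩ ⟨k, hk, rfl⟩
        refine ⟨k * h, fun n => (H m).mul_mem (hk n) (hh n), ?_⟩
        funext n
        simp [gauge, mul_assoc] }

/-- The quotient `G^N / H^N` by the discrete gauge action. -/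
def Moduli (m N : ℕ) [NeZero m] : Type := Quotient (gaugeSetoid m N)

/-- The projection `G^N → G^N / H^N`. -/
def proj {m N : ℕ} [NeZero m] (L : GN m N) : Moduli m N := Quotient.mk (gaugeSetoid m N) L

/-- The quotient topology. -/
instance instTopologicalSpaceModuli (m N : ℕ) [NeZero m] : TopologicalSpace (Moduli m N) :=
  TopologicalSpace.coinduced proj inferInstance

/-! ### The associated polygon and its monodromy -/

/-- The frame `gₙ` with `g₀ = 1` and `gₙ₊₁⁻¹ gₙ = Lₙ`. -/
def frame {m N : ℕ} (L : GN m N) : ℕ → G m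
  | 0 => 1
  | n + 1 => frame L n * (L n)⁻¹

/-- The monodromy `T = L₀⁻¹ L₁⁻¹ ⋯ L_{N-1}⁻¹`. -/
def monodromy {m N : ℕ} (L : GN m N) : G m := frame L N

/-- The frame is quasi-periodic with the monodromy as its multiplier: `gₙ₊N = T gₙ`. -/
theorem frame_add {m N : ℕ} (L : GN m N) (n : ℕ) :
    frame L (n + N) = monodromy L * frame L n := by
  induction n with
  | zero => simp [monodromy, frame]
  | succ k ih =>
    rw [Nat.add_right_comm]
    simp [frame, ih, mul_assoc]

theorem frame_gauge {m N : ℕ} (h L : GN m N) (n : ℕ) :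
    frame (gauge h L) n = h 0 * frame L n * (h n)⁻¹ := by
  induction n with
  | zero => simp [frame]
  | succ k ih => simp [frame, ih, gauge, mul_assoc]

theorem monodromy_gauge {m N : ℕ} (h L : GN m N) :
    monodromy (gauge h L) = h 0 * monodromy L * (h 0)⁻¹ := by
  simp [monodromy, frame_gauge]

/-- The conjugacy class in `G` of the monodromy, as a function on `G^N / H^N`. -/
def monodromyClass {m N : ℕ} [NeZero m] (q : Moduli m N) : ConjClasses (G m) :=
  Quotient.lift (s := gaugeSetoid m N) (fun L => ConjClasses.mk (monodromy L))
    (by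
      rintro L L' ⟨h, -, rfl⟩
      rw [monodromy_gauge, ConjClasses.mk_eq_mk_iff_isConj]
      exact isConj_iff.2 ⟨h 0, rfl⟩) q

/-- The vertices `gₙ e₁` of (a lift to `ℝᵐ` of) the associated projective polygon. -/
def vertex {m N : ℕ} [NeZero m] (L : GN m N) (n : ℕ) : Fin m → ℝ :=
  (frame L n : Matrix (Fin m) (Fin m) ℝ) *ᵥ e₁ m

/-- Any `m` consecutive vertices of the associated polygon are linearly independent. By
quasi-periodicity it is enough to look at the vertices with index in `ℕ`. -/
def PolygonNondegenerate {m N : ℕ} [NeZero m] (L : GN m N) : Prop :=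
  ∀ n : ℕ, (Matrix.of fun i j : Fin m => vertex L (n + j) i).det ≠ 0

/-- The part of `G^N / H^N` that consists of the classes of nondegenerate polygons. -/
def nondegenerate (m N : ℕ) [NeZero m] : Set (Moduli m N) :=
  proj '' {L | PolygonNondegenerate L}

/-! ### The reduced bracket and its symplectic leaves -/

/-- `f` is smooth on `U ⊆ G^N / H^N`: its pull-back to `G^N` is smooth over `U`. -/
def SmoothOn {m N : ℕ} [NeZero m] [NeZero N] (f : Moduli m N → ℝ) (U : Set (Moduli m N)) : Prop :=
  ∀ L : GN m N, proj L ∈ U → SmoothAt (fun L' => f (proj L')) L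

/-- The reduced bracket `{f, h}_R(q) = {F, H}(L)`, where `F` and `H` are the gauge invariant
functions on `G^N` given by `f` and `h`, and `L` represents `q`. -/
noncomputable def reducedBracket {m N : ℕ} [NeZero m] [NeZero N]
    (f h : Moduli m N → ℝ) (q : Moduli m N) : ℝ :=
  twistedBracket (fun L => f (proj L)) (fun L => h (proj L))
    (Quotient.out (s := gaugeSetoid m N) q)

/-- `c : [0, 1] → U` is a trajectory of the Hamiltonian vector field of `h` for the reduced
bracket: `(f ∘ c)' = {f, h}_R ∘ c` for every function `f` that is smooth on `U`. -/
structure IsHamiltonianTrajectory {m N : ℕ} [NeZero m] [NeZero N]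
    (U : Set (Moduli m N)) (h : Moduli m N → ℝ) (c : ℝ → Moduli m N) : Prop where
  continuousOn : ContinuousOn c (Set.Icc 0 1)
  mapsTo : ∀ t ∈ Set.Icc (0 : ℝ) 1, c t ∈ U
  hasDeriv : ∀ f : Moduli m N → ℝ, SmoothOn f U → ∀ t ∈ Set.Icc (0 : ℝ) 1,
    HasDerivWithinAt (fun s => f (c s)) (reducedBracket f h (c t)) (Set.Icc 0 1) t

/-- `p` is joined to `q` by one trajectory of a Hamiltonian vector field whose Hamiltonian is
defined on some open subset of `W`. -/
def HamiltonianStep {m N : ℕ} [NeZero m] [NeZero N] (W : Set (Moduli m N))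
    (p q : Moduli m N) : Prop :=
  ∃ (U : Set (Moduli m N)) (h : Moduli m N → ℝ) (c : ℝ → Moduli m N),
    IsOpen U ∧ U ⊆ W ∧ SmoothOn h U ∧ IsHamiltonianTrajectory U h c ∧ c 0 = p ∧ c 1 = q

/-- The symplectic leaf through `p` of the reduced bracket restricted to the open set `W`: all
points that can be joined to `p` inside `W` by finitely many pieces of trajectories of locally
defined Hamiltonian vector fields. -/
def symplecticLeaf {m N : ℕ} [NeZero m] [NeZero N] (W : Set (Moduli m N)) (p : Moduli m N) :
    Set (Moduli m N) :=
  {q | Relation.ReflTransGen (HamiltonianStep W) p q}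

end TwistedGon

/-! The idea is that Hamiltonian vector fields of the reduced bracket are infinitesimal gauge
transformations by the full group `G^N`, taken modulo those of `H^N`. The gauge orbits of `G^N` are
exactly the level sets of the conjugacy class of the monodromy.

Write `a`, `b` for the left gradients of gauge invariant `F`, `E`. Invariance under `H^N` says that
`aₙ₋₁ - Ad(Lₙ)⁻¹ aₙ` is orthogonal to the Lie algebra of `H`
(`IsGaugeInvariant.isNilradical_moment`). Hence the two gradients entering one summand of the
bracket differ only in the first row off the diagonal. The r-matrix terms then collapse: the bracket
is the derivative of `F` along the gauge direction `ξₙ = bₙ₋₁` (`twistedBracket_eq`). Equivariance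
of the gradients gives (a).

For one half of (b), move a Hamiltonian trajectory into a local section of the quotient map. Its
monodromy satisfies a Lax equation, so its conjugacy class is locally constant
(`eventually_monodromyClass_eq`). The section rescales the vertices by products of determinants of
consecutive vertices; coprimality of `m` and `N` yields products that scale like a single vertex.

For the other half, every direction `ξ` in the Lie algebra of `G^N` must be, modulo that of `H^N`,
the shift of an invariant covector (`rigiditySolve_spec`). This is a square linear system, so it
suffices that it has trivial kernel, which is the infinitesimal rigidity of nondegenerate polygons
(`eq_zero_of_parabolic_of_nilradical`). An autonomous Hamiltonian with prescribed gradients along a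
curve is then written down, provided that some linear function increases along the curve in the
section (`LocalSection.hamiltonianStep_of_curve`). Near a point of a `G^N`-orbit, either such curves
through a common auxiliary point reach all neighbours, or the projection of the orbit is locally
constant (`eventually_gauge_mem_leaf`).

Finally, a matrix near `T₀` and conjugate to it is conjugate by an element near the identity
(`eventually_exists_conj`). Therefore nearby polygons with conjugate monodromies differ by a gauge
transformation of `G^N` near the identity, and the leaf contains all of them. A connectedness
argument along paths passes from this local statement to path components. -/

namespace TwistedGon

open Matrix Topology
open scoped ContDiff Matrix.Norms.Elementwise

/-- The space of `m × m` matrices. -/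
abbrev Mat (m : ℕ) : Type := Matrix (Fin m) (Fin m) ℝ

/-- The ambient space of `G^N`. -/
abbrev Amb (m N : ℕ) : Type := ZMod N → Mat m

/-- The inclusion of `G^N` into its ambient space. -/
def amb {m N : ℕ} (L : GN m N) : Amb m N := fun n => (L n : Mat m)

/-! ### Differential calculus of matrix-valued maps. -/

section Calculus

variable {V : Type*} [NormedAddCommGroup V] [NormedSpace ℝ V] {k : WithTop ℕ∞} {m : ℕ}

/-- Matrices carry the elementwise norm, so products, determinants and inverses are all handled
entry by entry. -/
theorem contDiffAt_matrix {f : V → Mat m} {x : V} :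
    ContDiffAt ℝ k f x ↔ ∀ i j, ContDiffAt ℝ k (fun y => f y i j) x := by
  have h : ContDiffAt ℝ k f x ↔ ∀ i, ContDiffAt ℝ k (fun y => f y i) x :=
    contDiffAt_pi (Φ := f)
  rw [h]
  exact forall_congr' fun i => contDiffAt_pi

theorem hasDerivWithinAt_matrix {f : ℝ → Mat m} {f' : Mat m} {s : Set ℝ} {t : ℝ} :
    HasDerivWithinAt f f' s t ↔ ∀ i j, HasDerivWithinAt (fun y => f y i j) (f' i j) s t := by
  have h : HasDerivWithinAt f f' s t ↔ ∀ i, HasDerivWithinAt (fun y => f y i) (f' i) s t :=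
    hasDerivWithinAt_pi (φ := f)
  rw [h]
  exact forall_congr' fun i => hasDerivWithinAt_pi

theorem contDiffAt_matrix_mul {f g : V → Mat m} {x : V} (hf : ContDiffAt ℝ k f x)
    (hg : ContDiffAt ℝ k g x) : ContDiffAt ℝ k (fun y => f y * g y) x := by
  rw [contDiffAt_matrix] at *
  intro i j
  simp only [Matrix.mul_apply]
  exact ContDiffAt.sum fun l _ => (hf i l).mul (hg l j)

theorem contDiffAt_matrix_det {f : V → Mat m} {x : V} (hf : ContDiffAt ℝ k f x) :
    ContDiffAt ℝ k (fun y => (f y).det) x := by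
  rw [contDiffAt_matrix] at hf
  simp only [Matrix.det_apply']
  exact ContDiffAt.sum fun σ _ => contDiffAt_const.mul (contDiffAt_prod fun i _ => hf _ _)

theorem contDiffAt_matrix_adjugate {f : V → Mat m} {x : V} (hf : ContDiffAt ℝ k f x) :
    ContDiffAt ℝ k (fun y => (f y).adjugate) x := by
  rw [contDiffAt_matrix]
  intro i j
  simp only [Matrix.adjugate_apply]
  refine contDiffAt_matrix_det (contDiffAt_matrix.2 fun a b => ?_)
  simp only [Matrix.updateRow_apply]
  split_ifs
  · exact contDiffAt_const
  · exact contDiffAt_matrix.1 hf _ _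

theorem contDiffAt_matrix_inv {f : V → Mat m} {x : V} (hf : ContDiffAt ℝ k f x)
    (hx : (f x).det ≠ 0) : ContDiffAt ℝ k (fun y => (f y)⁻¹) x := by
  simp only [Matrix.inv_def, Ring.inverse_eq_inv']
  exact ((contDiffAt_matrix_det hf).inv hx).smul (contDiffAt_matrix_adjugate hf)

theorem hasDerivWithinAt_matrix_mul {f g : ℝ → Mat m} {f' g' : Mat m} {s : Set ℝ} {t : ℝ}
    (hf : HasDerivWithinAt f f' s t) (hg : HasDerivWithinAt g g' s t) :
    HasDerivWithinAt (fun y => f y * g y) (f' * g t + f t * g') s t := by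
  rw [hasDerivWithinAt_matrix] at *
  intro i j
  simp only [Matrix.mul_apply, Matrix.add_apply, ← Finset.sum_add_distrib]
  exact HasDerivWithinAt.fun_sum fun l _ => (hf i l).mul (hg l j)

/-- Cramer's rule gives differentiability of inversion. The value of its derivative is then forced
by differentiating `A⁻¹ A = 1` along a straight line through `f t`. -/
theorem hasDerivWithinAt_matrix_inv {f : ℝ → Mat m} {f' : Mat m} {s : Set ℝ} {t : ℝ}
    (hf : HasDerivWithinAt f f' s t) (ht : (f t).det ≠ 0) :
    HasDerivWithinAt (fun y => (f y)⁻¹) (-((f t)⁻¹ * f' * (f t)⁻¹)) s t := by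
  have hu : IsUnit (f t).det := isUnit_iff_ne_zero.2 ht
  have h1 : ContDiffAt ℝ 1 (fun A : Mat m => A⁻¹) (f t) := contDiffAt_matrix_inv contDiffAt_id ht
  have h2 : HasDerivWithinAt (fun y => (f y)⁻¹)
      (fderiv ℝ (fun A : Mat m => A⁻¹) (f t) f') s t :=
    (h1.differentiableAt one_ne_zero).hasFDerivAt.comp_hasDerivWithinAt t hf
  set D := fderiv ℝ (fun A : Mat m => A⁻¹) (f t) with hD
  -- along the line through `f t` in the direction `f'`
  have hl : HasDerivWithinAt (fun y : ℝ => f t + y • f') f' Set.univ 0 := by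
    have := ((hasDerivAt_id (0 : ℝ)).smul_const f').const_add (f t)
    rw [one_smul] at this
    exact this.hasDerivWithinAt
  have h3 : HasDerivWithinAt (fun y : ℝ => (f t + y • f')⁻¹) (D f') Set.univ 0 := by
    refine HasFDerivAt.comp_hasDerivWithinAt (f := fun y : ℝ => f t + y • f') 0 ?_ hl
    rw [zero_smul, add_zero]
    exact (h1.differentiableAt one_ne_zero).hasFDerivAt
  have h4 := (hasDerivWithinAt_matrix_mul h3 hl)
  have h5 : HasDerivWithinAt (fun y : ℝ => (f t + y • f')⁻¹ * (f t + y • f')) 0 Set.univ 0 := by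
    refine (hasDerivWithinAt_const (0 : ℝ) Set.univ (1 : Mat m)).congr_of_eventuallyEq ?_ ?_
    · rw [nhdsWithin_univ]
      have hc : ContinuousAt (fun y : ℝ => (f t + y • f').det) 0 := by fun_prop
      have := hc.eventually_ne (y := 0) (by simpa using ht)
      filter_upwards [this] with y hy
      exact Matrix.nonsing_inv_mul _ (isUnit_iff_ne_zero.2 hy)
    · simpa using Matrix.nonsing_inv_mul _ hu
  have h6 : D f' * f t + (f t)⁻¹ * f' = 0 := by
    have := (uniqueDiffWithinAt_univ (𝕜 := ℝ) (x := (0:ℝ))).eq_deriv _ h4 h5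
    simpa using this
  have h7 : D f' = -((f t)⁻¹ * f' * (f t)⁻¹) := by
    have h8 := congrArg (· * (f t)⁻¹) (eq_neg_of_add_eq_zero_left h6)
    simp only [Matrix.mul_assoc, Matrix.mul_nonsing_inv _ hu, Matrix.neg_mul] at h8
    simpa [Matrix.mul_assoc] using h8
  rw [← h7]
  exact h2

/-- Jacobi's formula at the identity. -/
theorem fderiv_det_one (X : Mat m) :
    fderiv ℝ (fun A : Mat m => A.det) 1 X = X.trace := by
  have hdet : DifferentiableAt ℝ (fun A : Mat m => A.det) 1 :=
    (contDiffAt_matrix_det (k := 1) contDiffAt_id).differentiableAt one_ne_zero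
  have h2 : HasDerivAt (fun t : ℝ => (1 + t • X).det)
      (fderiv ℝ (fun A : Mat m => A.det) 1 X) 0 := by
    have hc : HasDerivAt (fun t : ℝ => 1 + t • X) X 0 := by
      have h0 := ((hasDerivAt_id (0 : ℝ)).smul_const X).const_add 1
      rw [one_smul] at h0
      exact h0
    have hD' : HasFDerivAt (fun M : Mat m => M.det) (fderiv ℝ (fun A : Mat m => A.det) 1)
        (1 + (0 : ℝ) • X) := by simpa using hdet.hasFDerivAt
    exact hD'.comp_hasDerivAt (0 : ℝ) hc
  let p : Polynomial ℝ :=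
    (det (1 + (Polynomial.X : Polynomial ℝ) • X.map Polynomial.C)).divX.divX
  have h4 : HasDerivAt (fun t : ℝ => (1 + t • X).det) X.trace 0 := by
    have he : (fun t : ℝ => (1 + t • X).det) =
        fun t : ℝ => (1 + X.trace * t) + p.eval t * t ^ 2 := by
      funext t
      rw [Matrix.det_one_add_smul]
    rw [he]
    have := (((hasDerivAt_id (0 : ℝ)).const_mul X.trace).const_add 1).add
      ((p.hasDerivAt 0).mul (hasDerivAt_pow 2 (0 : ℝ)))
    refine this.congr_deriv ?_
    simp
  exact h2.unique h4

/-- A curve of matrices of determinant one has a traceless logarithmic derivative. -/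
theorem trace_logDeriv_eq_zero {f : ℝ → Mat m} {f' : Mat m} {s : Set ℝ} {t : ℝ}
    (hs : UniqueDiffWithinAt ℝ s t) (hts : t ∈ s)
    (hf : HasDerivWithinAt f f' s t) (hdet : ∀ y ∈ s, (f y).det = 1) :
    (f' * (f t)⁻¹).trace = 0 := by
  have h1 : HasDerivWithinAt (fun y => f y * (f t)⁻¹) (f' * (f t)⁻¹) s t := by
    simpa using hasDerivWithinAt_matrix_mul hf (hasDerivWithinAt_const t s (f t)⁻¹)
  have h0 : f t * (f t)⁻¹ = 1 := Matrix.mul_nonsing_inv _ (by simp [hdet t hts])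
  have hdiff : HasFDerivAt (fun A : Mat m => A.det) (fderiv ℝ (fun A : Mat m => A.det) 1)
      (f t * (f t)⁻¹) := by
    rw [h0]
    exact ((contDiffAt_matrix_det (k := 1) contDiffAt_id).differentiableAt one_ne_zero).hasFDerivAt
  have h2 : HasDerivWithinAt (fun y => (f y * (f t)⁻¹).det) (f' * (f t)⁻¹).trace s t := by
    rw [← fderiv_det_one]
    exact hdiff.comp_hasDerivWithinAt (f := fun y => f y * (f t)⁻¹) t h1
  have h3 : HasDerivWithinAt (fun y => (f y * (f t)⁻¹).det) 0 s t := by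
    refine (hasDerivWithinAt_const t s (1 : ℝ)).congr ?_ ?_
    · intro y hy
      simp [Matrix.det_mul, hdet y hy, Matrix.det_nonsing_inv, hdet t hts]
    · simp [h0]
  exact hs.eq_deriv _ h2 h3

end Calculus

end TwistedGon

/-! ### The trace form, the adjoint action and gradients on `G^N`. -/

namespace TwistedGon

open Matrix Topology
open scoped ContDiff Matrix.Norms.Elementwise

variable {m N : ℕ}

theorem isInducing_amb : IsInducing (amb : GN m N → Amb m N) :=
  IsInducing.piMap fun _ => IsInducing.subtypeVal

theorem continuous_amb : Continuous (amb : GN m N → Amb m N) := isInducing_amb.continuous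

theorem amb_injective : Function.Injective (amb : GN m N → Amb m N) := fun _ _ h =>
  funext fun n => Subtype.ext (congrFun h n)

@[simp] theorem amb_apply (L : GN m N) (n : ZMod N) : amb L n = (L n : Mat m) := rfl

theorem coe_inv_eq (g : G m) : ((g⁻¹ : G m) : Mat m) = (g : Mat m)⁻¹ := by
  refine (Matrix.SpecialLinearGroup.coe_inv g).trans ?_
  rw [Matrix.inv_def]
  simp

theorem coe_mul_eq (g k : G m) : ((g * k : G m) : Mat m) = (g : Mat m) * (k : Mat m) := rfl

theorem coe_mul_inv (g : G m) : (g : Mat m) * (g : Mat m)⁻¹ = 1 :=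
  Matrix.mul_nonsing_inv _ (by simp)

theorem coe_inv_mul (g : G m) : (g : Mat m)⁻¹ * (g : Mat m) = 1 :=
  Matrix.nonsing_inv_mul _ (by simp)

theorem mem_sl_iff {A : Mat m} :
    A ∈ LieAlgebra.SpecialLinear.sl (Fin m) ℝ ↔ A.trace = 0 := LinearMap.mem_ker

theorem trace_coe (ξ : 𝔤 m) : (ξ : Mat m).trace = 0 := mem_sl_iff.1 ξ.2

/-- The adjoint action of `G` on `𝔤`. -/
noncomputable def Ad (g : G m) (ξ : 𝔤 m) : 𝔤 m :=
  ⟨(g : Mat m) * (ξ : Mat m) * (g : Mat m)⁻¹, by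
    rw [mem_sl_iff, Matrix.trace_mul_cycle, coe_inv_mul, Matrix.one_mul, trace_coe]⟩

theorem coe_Ad (g : G m) (ξ : 𝔤 m) :
    (Ad g ξ : Mat m) = (g : Mat m) * (ξ : Mat m) * (g : Mat m)⁻¹ := rfl

theorem coe_Ad_inv (g : G m) (ξ : 𝔤 m) :
    (Ad g⁻¹ ξ : Mat m) = (g : Mat m)⁻¹ * (ξ : Mat m) * (g : Mat m) := by
  rw [coe_Ad, coe_inv_eq, Matrix.nonsing_inv_nonsing_inv _ (by simp)]

theorem Ad_mul (g k : G m) (ξ : 𝔤 m) : Ad (g * k) ξ = Ad g (Ad k ξ) := by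
  apply Subtype.ext
  simp [coe_Ad, Matrix.mul_assoc, Matrix.mul_inv_rev]

@[simp] theorem Ad_one (ξ : 𝔤 m) : Ad 1 ξ = ξ := by
  apply Subtype.ext
  simp [coe_Ad]

theorem Ad_inv_Ad (g : G m) (ξ : 𝔤 m) : Ad g⁻¹ (Ad g ξ) = ξ := by
  rw [← Ad_mul, inv_mul_cancel, Ad_one]

theorem Ad_Ad_inv (g : G m) (ξ : 𝔤 m) : Ad g (Ad g⁻¹ ξ) = ξ := by
  rw [← Ad_mul, mul_inv_cancel, Ad_one]

theorem Ad_add (g : G m) (ξ η : 𝔤 m) : Ad g (ξ + η) = Ad g ξ + Ad g η := by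
  apply Subtype.ext
  simp [coe_Ad, Matrix.mul_add, Matrix.add_mul]

theorem Ad_sub (g : G m) (ξ η : 𝔤 m) : Ad g (ξ - η) = Ad g ξ - Ad g η := by
  apply Subtype.ext
  simp [coe_Ad, Matrix.mul_sub, Matrix.sub_mul]

theorem trace_Ad_mul (g : G m) (ξ η : 𝔤 m) :
    ((Ad g ξ : Mat m) * (η : Mat m)).trace = ((ξ : Mat m) * (Ad g⁻¹ η : Mat m)).trace := by
  rw [coe_Ad, coe_Ad, coe_inv_eq, Matrix.nonsing_inv_nonsing_inv _ (by simp), Matrix.mul_assoc,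
    Matrix.mul_assoc, Matrix.trace_mul_comm]
  simp only [Matrix.mul_assoc]

theorem trace_Ad_mul_Ad (g : G m) (ξ η : 𝔤 m) :
    ((Ad g ξ : Mat m) * (Ad g η : Mat m)).trace = ((ξ : Mat m) * (η : Mat m)).trace := by
  rw [trace_Ad_mul, Ad_inv_Ad]

section Pairing

variable [NeZero N]

/-- The pairing as a bilinear form. -/
noncomputable def pairingForm (m N : ℕ) [NeZero N] : LinearMap.BilinForm ℝ (ZMod N → 𝔤 m) :=
  LinearMap.mk₂ ℝ pairing
    (fun x y z => by simp [pairing, Matrix.add_mul, Finset.sum_add_distrib])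
    (fun c x z => by simp [pairing, Finset.mul_sum])
    (fun x y z => by simp [pairing, Matrix.mul_add, Finset.sum_add_distrib])
    (fun c x z => by simp [pairing, Finset.mul_sum])

theorem pairing_comm (a b : ZMod N → 𝔤 m) : pairing a b = pairing b a :=
  Finset.sum_congr rfl fun _ _ => Matrix.trace_mul_comm _ _

theorem pairing_add (a b c : ZMod N → 𝔤 m) : pairing a (b + c) = pairing a b + pairing a c :=
  (pairingForm m N a).map_add b c

theorem pairing_sub (a b c : ZMod N → 𝔤 m) : pairing a (b - c) = pairing a b - pairing a c :=
  (pairingForm m N a).map_sub b c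

theorem sub_pairing (a b c : ZMod N → 𝔤 m) : pairing (a - b) c = pairing a c - pairing b c := by
  rw [pairing_comm, pairing_sub, pairing_comm, pairing_comm c]

theorem trace_mul_transpose_self_eq_zero {A : Mat m} : (A * Aᵀ).trace = 0 → A = 0 := by
  intro h
  have := Matrix.trace_mul_conjTranspose_self_eq_zero_iff (A := A)
  rw [Matrix.conjTranspose_eq_transpose_of_trivial] at this
  exact this.1 h

/-- The trace form is indefinite, but pairing `a` with its transpose gives a sum of squares. -/
theorem pairing_eq_zero {a : ZMod N → 𝔤 m} (h : ∀ ξ, pairing a ξ = 0) : a = 0 := by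
  let ξ : ZMod N → 𝔤 m := fun n => ⟨(a n : Mat m)ᵀ, by
    rw [mem_sl_iff, Matrix.trace_transpose, trace_coe]⟩
  have h1 := h ξ
  have h2 : ∀ n : ZMod N, 0 ≤ ((a n : Mat m) * (a n : Mat m)ᵀ).trace := fun n => by
    simp only [Matrix.trace, Matrix.diag, Matrix.mul_apply, Matrix.transpose_apply]
    exact Finset.sum_nonneg fun i _ => Finset.sum_nonneg fun j _ => mul_self_nonneg _
  funext n
  apply Subtype.ext
  exact trace_mul_transpose_self_eq_zero
    ((Finset.sum_eq_zero_iff_of_nonneg fun n _ => h2 n).1 h1 n (Finset.mem_univ n))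

theorem pairing_ext {a b : ZMod N → 𝔤 m} (h : ∀ ξ, pairing a ξ = pairing b ξ) : a = b :=
  sub_eq_zero.1 (pairing_eq_zero fun ξ => by rw [sub_pairing, h, sub_self])

theorem exists_pairing_eq (φ : (ZMod N → 𝔤 m) →ₗ[ℝ] ℝ) : ∃ a, ∀ ξ, φ ξ = pairing a ξ := by
  have hnd : (pairingForm m N).Nondegenerate :=
    ⟨fun a h => pairing_eq_zero h, fun a h => pairing_eq_zero fun ξ => by
      rw [pairing_comm]; exact h ξ⟩
  obtain ⟨a, ha⟩ := (LinearMap.BilinForm.toDual (pairingForm m N) hnd).surjective φ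
  exact ⟨a, fun ξ => by rw [← ha]; rfl⟩

end Pairing

/-- The tangent vector of `G^N` at `L` given by `ξ ∈ 𝔤^N` through right translation. -/
def tangent (ξ : ZMod N → 𝔤 m) (L : GN m N) : Amb m N := fun n => (ξ n : Mat m) * (L n : Mat m)

/-- The tangent vector as a linear map. -/
def tangentₗ (L : GN m N) : (ZMod N → 𝔤 m) →ₗ[ℝ] Amb m N where
  toFun ξ := tangent ξ L
  map_add' ξ η := by funext n; simp [tangent, Matrix.add_mul]
  map_smul' c ξ := by funext n; simp [tangent]

theorem hasDerivAt_expG (ξ : 𝔤 m) :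
    HasDerivAt (fun ε : ℝ => ((expG (ε • ξ) : G m) : Mat m)) (ξ : Mat m) 0 := by
  have h : ∀ X : Mat m, HasDerivAt (fun ε : ℝ => NormedSpace.exp (ε • X)) X 0 := by
    intro X
    have h0 := open scoped Matrix.Norms.Operator in
      hasDerivAt_exp_smul_const (𝕂 := ℝ) X (0 : ℝ)
    rw [zero_smul, NormedSpace.exp_zero, one_mul] at h0
    exact h0
  exact h ξ

theorem expG_zero : expG (0 : 𝔤 m) = 1 := by
  apply Subtype.ext
  simp [expG]

theorem hasDerivAt_expG_mul (ξ : ZMod N → 𝔤 m) (L : GN m N) [NeZero N] :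
    HasDerivAt (fun ε : ℝ => amb (fun n => expG (ε • ξ n) * L n)) (tangent ξ L) 0 := by
  refine hasDerivAt_pi.2 fun n => ?_
  have := hasDerivWithinAt_matrix_mul (hasDerivAt_expG (ξ n)).hasDerivWithinAt
    (hasDerivWithinAt_const (0 : ℝ) Set.univ (L n : Mat m))
  refine (this.hasDerivAt Filter.univ_mem).congr_deriv ?_
  simp [tangent, expG_zero]

theorem hasDerivAt_mul_expG (ξ : ZMod N → 𝔤 m) (L : GN m N) [NeZero N] :
    HasDerivAt (fun ε : ℝ => amb (fun n => L n * expG (ε • ξ n)))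
      (tangent (fun n => Ad (L n) (ξ n)) L) 0 := by
  refine hasDerivAt_pi.2 fun n => ?_
  have := hasDerivWithinAt_matrix_mul (hasDerivWithinAt_const (0 : ℝ) Set.univ (L n : Mat m))
    (hasDerivAt_expG (ξ n)).hasDerivWithinAt
  refine (this.hasDerivAt Filter.univ_mem).congr_deriv ?_
  simp [tangent, coe_Ad, expG_zero, Matrix.mul_assoc]

variable [NeZero N]

/-- `F` has near `L` an extension to the ambient space with derivative `D` at `L`. -/
def HasAmbDeriv (F : GN m N → ℝ) (L : GN m N) (D : Amb m N →L[ℝ] ℝ) : Prop :=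
  ∃ F' : Amb m N → ℝ, HasFDerivAt F' D (amb L) ∧ ∀ᶠ L' in 𝓝 L, F L' = F' (amb L')

theorem HasAmbDeriv.comp {F : GN m N → ℝ} {L : GN m N} {D : Amb m N →L[ℝ] ℝ}
    (hF : HasAmbDeriv F L D) {γ : ℝ → GN m N} {s : Set ℝ} {t : ℝ} {X : Amb m N}
    (hL : γ t = L) (hγ : HasDerivWithinAt (fun y => amb (γ y)) X s t) :
    HasDerivWithinAt (fun y => F (γ y)) (D X) s t := by
  obtain ⟨F', hF', he⟩ := hF
  subst hL
  have h1 := hF'.comp_hasDerivWithinAt (f := fun y => amb (γ y)) t hγ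
  refine h1.congr_of_eventuallyEq ?_ he.self_of_nhds
  have hc : ContinuousWithinAt γ s t :=
    isInducing_amb.continuousWithinAt_iff.2 hγ.continuousWithinAt
  exact hc.eventually he

theorem HasAmbDeriv.isLeftGrad {F : GN m N → ℝ} {L : GN m N} {D : Amb m N →L[ℝ] ℝ}
    (hF : HasAmbDeriv F L D) {A : ZMod N → 𝔤 m} (hA : ∀ ξ, D (tangent ξ L) = pairing A ξ) :
    IsLeftGrad F L A := fun ξ => by
  rw [← hA, ← hasDerivWithinAt_univ]
  exact hF.comp (by funext n; simp [expG_zero]) (hasDerivAt_expG_mul ξ L).hasDerivWithinAt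

/-- Existence of a gradient comes from nondegeneracy of the trace form. It rules out the default
value in `leftGrad`, so the chosen gradient really represents the differential. -/
theorem HasAmbDeriv.apply_tangent {F : GN m N → ℝ} {L : GN m N} {D : Amb m N →L[ℝ] ℝ}
    (hF : HasAmbDeriv F L D) (ξ : ZMod N → 𝔤 m) :
    D (tangent ξ L) = pairing (leftGrad F L) ξ := by
  obtain ⟨a, ha⟩ := exists_pairing_eq ((D : Amb m N →ₗ[ℝ] ℝ).comp (tangentₗ L))
  have hex : ∃ A, IsLeftGrad F L A := ⟨a, hF.isLeftGrad ha⟩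
  have h1 : IsLeftGrad F L (leftGrad F L) := by
    rw [leftGrad, dif_pos hex]
    exact hex.choose_spec
  have h2 := hF.isLeftGrad ha ξ
  exact (ha ξ).trans ((h1 ξ).unique h2).symm

/-- Right translation by `ξ` has the same velocity as left translation by `Ad(L) ξ`. Invariance of
the trace form transfers `Ad(L)` to the gradient. -/
theorem HasAmbDeriv.rightGrad_eq {F : GN m N → ℝ} {L : GN m N} {D : Amb m N →L[ℝ] ℝ}
    (hF : HasAmbDeriv F L D) (n : ZMod N) :
    rightGrad F L n = Ad (L n)⁻¹ (leftGrad F L n) := by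
  have h0 : IsRightGrad F L (fun n => Ad (L n)⁻¹ (leftGrad F L n)) := fun ξ => by
    have h1 : pairing (fun n => Ad (L n)⁻¹ (leftGrad F L n)) ξ =
        D (tangent (fun n => Ad (L n) (ξ n)) L) := by
      rw [hF.apply_tangent]
      refine Finset.sum_congr rfl fun n _ => ?_
      rw [trace_Ad_mul, inv_inv]
    rw [h1, ← hasDerivWithinAt_univ]
    exact hF.comp (by funext n; simp [expG_zero]) (hasDerivAt_mul_expG ξ L).hasDerivWithinAt
  have hex : ∃ A, IsRightGrad F L A := ⟨_, h0⟩
  have h1 : IsRightGrad F L (rightGrad F L) := by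
    rw [rightGrad, dif_pos hex]
    exact hex.choose_spec
  exact congrFun (pairing_ext fun ξ => (h1 ξ).unique (h0 ξ)) n

theorem SmoothAt.exists_hasAmbDeriv {F : GN m N → ℝ} {L : GN m N} (hF : SmoothAt F L) :
    ∃ F' : Amb m N → ℝ, ContDiffAt ℝ 1 F' (amb L) ∧
      ∀ᶠ L' in 𝓝 L, HasAmbDeriv F L' (fderiv ℝ F' (amb L')) := by
  obtain ⟨F', hF', he⟩ := hF
  have h1 : ContDiffAt ℝ 1 F' (amb L) := hF'.of_le (by exact_mod_cast le_top)
  refine ⟨F', h1, ?_⟩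
  have h2 : ∀ᶠ X in 𝓝 (amb L), ContDiffAt ℝ 1 F' X := h1.eventually (by simp)
  have h3 : ∀ᶠ L' in 𝓝 L, ContDiffAt ℝ 1 F' (amb L') := continuous_amb.continuousAt.eventually h2
  filter_upwards [h3, he.eventually_nhds] with L' h4 h5
  exact ⟨F', (h4.differentiableAt one_ne_zero).hasFDerivAt, h5⟩

theorem SmoothAt.hasAmbDeriv {F : GN m N → ℝ} {L : GN m N} (hF : SmoothAt F L) :
    ∃ D, HasAmbDeriv F L D := by
  obtain ⟨F', -, h⟩ := hF.exists_hasAmbDeriv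
  exact ⟨_, h.self_of_nhds⟩

/-- The derivative of a smooth function along a curve in `G^N`. -/
theorem SmoothAt.comp {F : GN m N → ℝ} {L : GN m N} (hF : SmoothAt F L)
    {γ : ℝ → GN m N} {s : Set ℝ} {t : ℝ} {ξ : ZMod N → 𝔤 m}
    (hL : γ t = L) (hγ : HasDerivWithinAt (fun y => amb (γ y)) (tangent ξ L) s t) :
    HasDerivWithinAt (fun y => F (γ y)) (pairing (leftGrad F L) ξ) s t := by
  obtain ⟨D, hD⟩ := hF.hasAmbDeriv
  rw [← hD.apply_tangent]
  exact hD.comp hL hγ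

theorem SmoothAt.rightGrad_eq {F : GN m N → ℝ} {L : GN m N} (hF : SmoothAt F L) (n : ZMod N) :
    rightGrad F L n = Ad (L n)⁻¹ (leftGrad F L n) := by
  obtain ⟨D, hD⟩ := hF.hasAmbDeriv
  exact hD.rightGrad_eq n

/-- The traceless matrices dual to the entries of a traceless matrix. -/
noncomputable def entryDual (m : ℕ) (i j : Fin m) : 𝔤 m :=
  -- The trace pairing with `Matrix.single j i 1` extracts the entry `(i, j)`. Subtracting a scalar
  -- matrix makes it traceless and is invisible to traceless matrices.
  ⟨Matrix.single j i 1 - (if i = j then (m : ℝ)⁻¹ else 0) • (1 : Mat m), by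
    rw [mem_sl_iff, Matrix.trace_sub, Matrix.trace_smul, Matrix.trace_one]
    have hm : (m : ℝ) ≠ 0 := by
      have := i.pos
      positivity
    split_ifs with h
    · subst h
      simp [hm]
    · rw [Matrix.trace_single_eq_of_ne _ _ _ (Ne.symm h)]
      simp⟩

theorem trace_mul_entryDual (ξ : 𝔤 m) (i j : Fin m) :
    ((ξ : Mat m) * (entryDual m i j : Mat m)).trace = (ξ : Mat m) i j := by
  have h : ((if i = j then (m : ℝ)⁻¹ else 0) • (ξ : Mat m)).trace = 0 := by
    rw [Matrix.trace_smul, trace_coe, smul_zero]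
  simp only [entryDual, Matrix.mul_sub, Matrix.mul_smul, Matrix.mul_one, Matrix.trace_sub, h,
    Matrix.trace_mul_single, sub_zero]
  simp

open Classical in
theorem pairing_single_entryDual (a : ZMod N → 𝔤 m) (n : ZMod N) (i j : Fin m) :
    pairing a (Pi.single n (entryDual m i j)) = (a n : Mat m) i j := by
  rw [pairing, Finset.sum_eq_single n]
  · rw [Pi.single_eq_same, trace_mul_entryDual]
  · intro k _ hk
    simp [Pi.single_eq_of_ne hk]
  · simp

open Classical in
/-- The left gradient of a smooth function is continuous. -/
theorem SmoothAt.continuousAt_leftGrad {F : GN m N → ℝ} {L : GN m N} (hF : SmoothAt F L)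
    (n : ZMod N) : ContinuousAt (fun L' => (leftGrad F L' n : Mat m)) L := by
  obtain ⟨F', h1, h2⟩ := hF.exists_hasAmbDeriv
  have h3 : ContinuousAt (fun L' : GN m N => fderiv ℝ F' (amb L')) L :=
    ContinuousAt.comp (f := amb) (h1.continuousAt_fderiv one_ne_zero) continuous_amb.continuousAt
  refine continuousAt_pi.2 fun i => continuousAt_pi.2 fun j => ?_
  have h4 : ContinuousAt (fun L' : GN m N => tangent (Pi.single n (entryDual m i j)) L') L := by
    refine continuousAt_pi.2 fun k => ?_
    have : Continuous fun L' : GN m N => amb L' k := (continuous_apply k).comp continuous_amb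
    exact (continuous_const.matrix_mul this).continuousAt
  refine (h3.clm_apply h4).congr ?_
  filter_upwards [h2] with L' h5
  exact (h5.apply_tangent _).trans (pairing_single_entryDual _ _ _ _)

end TwistedGon

/-! ### Gauge invariant functions and the collapse of the bracket. -/

namespace TwistedGon

open Matrix Topology
open scoped ContDiff Matrix.Norms.Elementwise

variable {m N : ℕ}

section Parabolic

variable [NeZero m]

/-- The Lie algebra of `H`, inside the space of all matrices. -/
def IsParabolic (A : Mat m) : Prop := ∀ i, i ≠ 0 → A i 0 = 0

/-- The orthogonal complement of the Lie algebra of `H` in the space of all matrices. -/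
def IsNilradical (A : Mat m) : Prop := ∀ i j, (i ≠ 0 ∨ j = 0) → A i j = 0

theorem mulVec_e₁ (A : Mat m) : A *ᵥ e₁ m = fun i => A i 0 := by
  funext i
  simp [e₁]

theorem mem_H_iff {h : G m} : h ∈ H m ↔ IsParabolic (h : Mat m) := by
  constructor
  · rintro ⟨a, -, ha⟩ i hi
    have := congrFun ha i
    rw [mulVec_e₁] at this
    simpa [e₁, hi] using this
  · intro hh
    have h1 : (h : Mat m) *ᵥ e₁ m = (h : Mat m) 0 0 • e₁ m := by
      rw [mulVec_e₁]
      funext i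
      by_cases hi : i = 0
      · simp [e₁, hi]
      · simp [e₁, hi, hh i hi]
    refine ⟨_, fun h0 => ?_, h1⟩
    have h2 := congrArg ((h : Mat m)⁻¹ *ᵥ ·) h1
    simp only [h0, zero_smul, Matrix.mulVec_mulVec, coe_inv_mul, Matrix.one_mulVec,
      Matrix.mulVec_zero] at h2
    simpa [e₁] using congrFun h2 0

theorem IsParabolic.mul {A B : Mat m} (hA : IsParabolic A) (hB : IsParabolic B) :
    IsParabolic (A * B) := by
  intro i hi
  rw [Matrix.mul_apply]
  refine Finset.sum_eq_zero fun j _ => ?_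
  by_cases hj : j = 0
  · rw [hj, hA i hi, zero_mul]
  · rw [hB j hj, mul_zero]

theorem isParabolic_one : IsParabolic (1 : Mat m) := fun _ hi => Matrix.one_apply_ne hi

theorem IsParabolic.pow {A : Mat m} (hA : IsParabolic A) (n : ℕ) : IsParabolic (A ^ n) := by
  induction n with
  | zero => exact isParabolic_one
  | succ n ih => rw [pow_succ]; exact ih.mul hA

theorem IsParabolic.smul {A : Mat m} (hA : IsParabolic A) (c : ℝ) : IsParabolic (c • A) :=
  fun i hi => by simp [hA i hi]

theorem IsParabolic.add {A B : Mat m} (hA : IsParabolic A) (hB : IsParabolic B) :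
    IsParabolic (A + B) := fun i hi => by simp [hA i hi, hB i hi]

theorem IsNilradical.sub {A B : Mat m} (hA : IsNilradical A) (hB : IsNilradical B) :
    IsNilradical (A - B) := fun i j h => by simp [hA i j h, hB i j h]

theorem IsParabolic.exp {A : Mat m} (hA : IsParabolic A) :
    IsParabolic (NormedSpace.exp A) := by
  intro i hi
  have h1 : HasSum (fun n : ℕ => ((n.factorial : ℝ)⁻¹ • A ^ n)) (NormedSpace.exp A) :=
    open scoped Matrix.Norms.Operator in NormedSpace.exp_series_hasSum_exp' (𝕂 := ℝ) A
  have h2 : HasSum (fun n : ℕ => ((n.factorial : ℝ)⁻¹ • A ^ n) i 0) (NormedSpace.exp A i 0) :=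
    Pi.hasSum.1 (Pi.hasSum.1 h1 i) 0
  refine h2.unique ?_
  have : (fun n : ℕ => ((n.factorial : ℝ)⁻¹ • A ^ n) i 0) = fun _ => 0 :=
    funext fun n => ((hA.pow n).smul _) i hi
  rw [this]
  exact hasSum_zero

theorem expG_mem_H {ξ : 𝔤 m} (hξ : IsParabolic (ξ : Mat m)) (ε : ℝ) : expG (ε • ξ) ∈ H m :=
  mem_H_iff.2 (IsParabolic.exp (hξ.smul ε))

/-- A matrix supported on the first row off the diagonal only meets entries of the first column
below the diagonal, where a parabolic matrix vanishes. -/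
theorem trace_mul_eq_zero {A B : Mat m} (hA : IsNilradical A) (hB : IsParabolic B) :
    (A * B).trace = 0 := by
  refine Finset.sum_eq_zero fun i _ => ?_
  rw [Matrix.diag_apply, Matrix.mul_apply]
  refine Finset.sum_eq_zero fun j _ => ?_
  by_cases h : i ≠ 0 ∨ j = 0
  · rw [hA i j h, zero_mul]
  · push Not at h
    rw [h.1, hB j h.2, mul_zero]

theorem IsNilradical.isParabolic {A : Mat m} (hA : IsNilradical A) : IsParabolic A :=
  fun i _ => hA i 0 (Or.inr rfl)

theorem isParabolic_entryDual {i j : Fin m} (h : i ≠ 0 ∨ j = 0) :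
    IsParabolic (entryDual m i j : Mat m) := by
  intro l hl
  simp only [entryDual, Matrix.sub_apply, Matrix.smul_apply, Matrix.one_apply_ne hl, smul_zero,
    sub_zero]
  rw [Matrix.single_apply]
  rcases h with h | h
  · simp [h]
  · subst h
    simp [Ne.symm hl]

end Parabolic

/-- The infinitesimal gauge action, in right trivialization. -/
noncomputable def gaugeField (ξ : ZMod N → 𝔤 m) (L : GN m N) : ZMod N → 𝔤 m :=
  fun n => ξ (n + 1) - Ad (L n) (ξ n)

/-- The transpose of the infinitesimal gauge action. -/
noncomputable def moment (a : ZMod N → 𝔤 m) (L : GN m N) : ZMod N → 𝔤 m :=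
  fun n => a (n - 1) - Ad (L n)⁻¹ (a n)

theorem coe_moment (a : ZMod N → 𝔤 m) (L : GN m N) (n : ZMod N) :
    (moment a L n : Mat m) = a (n - 1) - (Ad (L n)⁻¹ (a n) : Mat m) := rfl

theorem pairing_gaugeField [NeZero N] (a ξ : ZMod N → 𝔤 m) (L : GN m N) :
    pairing a (gaugeField ξ L) = pairing (moment a L) ξ := by
  have h1 : pairing a (gaugeField ξ L) =
      ∑ n, ((a n : Mat m) * (ξ (n + 1) : Mat m)).trace -
        ∑ n, ((a n : Mat m) * (Ad (L n) (ξ n) : Mat m)).trace := by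
    rw [← Finset.sum_sub_distrib]
    refine Finset.sum_congr rfl fun n _ => ?_
    simp [gaugeField, Matrix.mul_sub]
  have h2 : pairing (moment a L) ξ =
      ∑ n, ((a (n - 1) : Mat m) * (ξ n : Mat m)).trace -
        ∑ n, ((Ad (L n)⁻¹ (a n) : Mat m) * (ξ n : Mat m)).trace := by
    rw [← Finset.sum_sub_distrib]
    refine Finset.sum_congr rfl fun n _ => ?_
    simp [moment, Matrix.sub_mul]
  rw [h1, h2]
  congr 1
  · rw [← Equiv.sum_comp (Equiv.addRight (1 : ZMod N))
      (fun n => ((a (n - 1) : Mat m) * (ξ n : Mat m)).trace)]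
    simp
  · refine Finset.sum_congr rfl fun n _ => ?_
    rw [trace_Ad_mul, inv_inv]

/-- In right trivialization the velocity of a gauge orbit depends on the velocity `ξ` of the
transformation and on the current point only. Curves of gauge transformations therefore need not be
one-parameter groups. -/
theorem hasDerivWithinAt_gauge [NeZero N] {K : ℝ → GN m N} {s : Set ℝ} {t : ℝ}
    {ξ : ZMod N → 𝔤 m} (hK : HasDerivWithinAt (fun y => amb (K y)) (tangent ξ (K t)) s t)
    (L : GN m N) :
    HasDerivWithinAt (fun y => amb (gauge (K y) L))
      (tangent (gaugeField ξ (gauge (K t) L)) (gauge (K t) L)) s t := by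
  refine hasDerivWithinAt_pi.2 fun n => ?_
  have h1 := hasDerivWithinAt_pi.1 hK
  have h2 := hasDerivWithinAt_matrix_mul
    (hasDerivWithinAt_matrix_mul (h1 (n + 1)) (hasDerivWithinAt_const t s (L n : Mat m)))
    (hasDerivWithinAt_matrix_inv (h1 n) (by simp))
  have h3 : (fun y => amb (gauge (K y) L) n) =
      fun y => amb (K y) (n + 1) * (L n : Mat m) * (amb (K y) n)⁻¹ := by
    funext y
    simp only [gauge, amb_apply, coe_mul_eq, coe_inv_eq]
  rw [h3]
  refine h2.congr_deriv ?_
  simp only [tangent, gaugeField, amb_apply, gauge, coe_Ad, AddSubgroupClass.coe_sub,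
    coe_mul_eq, coe_inv_eq, Matrix.sub_mul, Matrix.mul_zero, add_zero, Matrix.mul_neg,
    Matrix.mul_inv_rev]
  rw [sub_eq_add_neg]
  congr 1
  · simp only [Matrix.mul_assoc]
  · congr 1
    have e0 := coe_inv_mul (L n)
    have e1 := coe_inv_mul (K t (n + 1))
    rw [Matrix.nonsing_inv_nonsing_inv _ (by simp)]
    calc _ = (K t (n + 1) : Mat m) * (L n) * (K t n : Mat m)⁻¹ * (ξ n : Mat m) *
          ((K t n : Mat m) * (K t n : Mat m)⁻¹) := by simp only [Matrix.mul_assoc]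
      _ = (K t (n + 1) : Mat m) * (L n) * (K t n : Mat m)⁻¹ * (ξ n : Mat m) *
          ((K t n : Mat m) * (((L n : Mat m)⁻¹ * ((K t (n + 1) : Mat m)⁻¹ * (K t (n + 1) : Mat m))
            * (L n : Mat m))) * (K t n : Mat m)⁻¹) := by
        rw [e1, Matrix.mul_one, e0, Matrix.mul_one]
      _ = _ := by simp only [Matrix.mul_assoc]

/-- Invariance under the gauge action of `H^N`. -/
def IsGaugeInvariant [NeZero m] (F : GN m N → ℝ) : Prop :=
  ∀ h L : GN m N, (∀ n, h n ∈ H m) → F (gauge h L) = F L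

theorem proj_gauge [NeZero m] {h : GN m N} (hh : ∀ n, h n ∈ H m) (L : GN m N) :
    proj (gauge h L) = proj L :=
  (Quotient.sound (s := gaugeSetoid m N) ⟨h, hh, rfl⟩).symm

theorem proj_eq_iff [NeZero m] {L L' : GN m N} :
    proj L = proj L' ↔ ∃ h : GN m N, (∀ n, h n ∈ H m) ∧ L' = gauge h L :=
  Quotient.eq (r := gaugeSetoid m N)

theorem isGaugeInvariant_comp_proj [NeZero m] (f : Moduli m N → ℝ) :
    IsGaugeInvariant (fun L : GN m N => f (proj L)) := fun h L hh => by
  simp only [proj_gauge hh]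

theorem gauge_one (L : GN m N) : gauge (fun _ => 1) L = L := by
  funext n
  simp [gauge]

variable [NeZero N]

theorem hasDerivWithinAt_expG (ξ : ZMod N → 𝔤 m) :
    HasDerivWithinAt (fun ε : ℝ => amb fun n => expG (ε • ξ n))
      (tangent ξ fun n => expG ((0 : ℝ) • ξ n)) Set.univ 0 := by
  have := hasDerivAt_expG_mul ξ (fun _ => (1 : G m))
  simp only [mul_one] at this
  simp only [zero_smul, expG_zero]
  exact this.hasDerivWithinAt

section Invariant

variable [NeZero m] {F E : GN m N → ℝ} {L : GN m N}

/-- `F` is constant along the gauge flow generated by `ζ`, and `moment` is the transpose of the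
infinitesimal action. -/
theorem IsGaugeInvariant.pairing_moment_eq_zero (hF : IsGaugeInvariant F) (hs : SmoothAt F L)
    {ζ : ZMod N → 𝔤 m} (hζ : ∀ n, IsParabolic (ζ n : Mat m)) :
    pairing (moment (leftGrad F L) L) ζ = 0 := by
  have h1 := hasDerivWithinAt_gauge (hasDerivWithinAt_expG ζ) L
  have h0 : gauge (fun n => expG ((0 : ℝ) • ζ n)) L = L := by
    simp only [zero_smul, expG_zero, gauge_one]
  rw [h0] at h1
  have h2 := hs.comp h0 h1
  rw [pairing_gaugeField] at h2
  refine h2.hasDerivAt Filter.univ_mem |>.unique ?_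
  have : (fun y : ℝ => F (gauge (fun n => expG (y • ζ n)) L)) = fun _ => F L :=
    funext fun y => hF _ L fun n => expG_mem_H (hζ n) y
  rw [this]
  exact hasDerivAt_const _ _

open Classical in
theorem IsGaugeInvariant.isNilradical_moment (hF : IsGaugeInvariant F) (hs : SmoothAt F L)
    (n : ZMod N) : IsNilradical (moment (leftGrad F L) L n : Mat m) := by
  intro i j h
  rw [← pairing_single_entryDual]
  refine hF.pairing_moment_eq_zero hs fun k => ?_
  by_cases hk : k = n
  · subst hk
    rw [Pi.single_eq_same]
    exact isParabolic_entryDual h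
  · rw [Pi.single_eq_of_ne hk]
    exact fun _ _ => rfl

/-- The hypotheses make `A`, `A'` agree on and below the diagonal, and likewise `B`, `B'`. Comparing
the contributions of the products of an entry `(i, j)` with an entry `(j, i)` separately for `i <
j`, `i = j` and `i > j`, the tensor terms cancel the mixed wedge terms. -/
theorem rWedge_add_rWedge {A A' B B' : 𝔤 m} (hA : IsNilradical ((A : Mat m) - (A' : Mat m)))
    (hB : IsNilradical ((B : Mat m) - (B' : Mat m))) :
    rWedge A B + rWedge A' B' - rTensor A' B + rTensor B' A =
      (1 / 2 : ℝ) * ((((A : Mat m) - (A' : Mat m)) * (B : Mat m)).trace -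
        ((A : Mat m) * ((B : Mat m) - (B' : Mat m))).trace) := by
  have h1 : rTensor B' A = ∑ i, ∑ j, (upper A) i j * (lower B') j i := by
    rw [rTensor, Matrix.trace_mul_comm]
    simp [Matrix.trace, Matrix.mul_apply]
  rw [h1]
  simp only [rWedge, rTensor, Matrix.trace, Matrix.diag_apply, Matrix.mul_apply,
    ← Finset.sum_add_distrib, ← Finset.sum_sub_distrib, Finset.mul_sum]
  refine Finset.sum_congr rfl fun i _ => Finset.sum_congr rfl fun j _ => ?_
  simp only [Rmat, upper, lower, Matrix.smul_apply, Matrix.sub_apply, Matrix.of_apply, smul_eq_mul]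
  rcases lt_trichotomy i j with h | h | h
  · have hb := hB j i (Or.inl (fun h0 => by simp [h0] at h))
    rw [Matrix.sub_apply] at hb
    have hb' : (B' : Mat m) j i = (B : Mat m) j i := by linarith
    simp only [h, not_lt_of_gt h, if_true, if_false, hb']
    ring
  · subst h
    have hb := hB i i (ne_or_eq i 0)
    have ha := hA i i (ne_or_eq i 0)
    rw [Matrix.sub_apply] at hb ha
    rw [ha, hb]
    simp
  · have ha := hA i j (Or.inl (fun h0 => by simp [h0] at h))
    rw [Matrix.sub_apply] at ha
    have ha' : (A' : Mat m) i j = (A : Mat m) i j := by linarith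
    simp only [h, not_lt_of_gt h, if_true, if_false, ha']
    ring

theorem sum_shift (φ : ZMod N → ℝ) : ∑ s, φ s = ∑ s, φ (s - 1) :=
  (Equiv.sum_comp (Equiv.subRight (1 : ZMod N)) φ).symm

/-- With `a' = Ad(L)⁻¹ a` and `b' = Ad(L)⁻¹ b` one has `(a - a') b + a (b - b') = a b - a' b' + (a -
a')(b - b')`, where unprimed terms carry the shifted index. The last product is traceless by
nilpotency, and the rest sums to zero by `Ad`-invariance of the trace and periodicity. -/
theorem sum_trace_moment {a b : ZMod N → 𝔤 m}
    (ha : ∀ n, IsNilradical (moment a L n : Mat m))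
    (hb : ∀ n, IsNilradical (moment b L n : Mat m)) :
    ∑ s, ((moment a L s : Mat m) * (b (s - 1) : Mat m)).trace +
      ∑ s, ((a (s - 1) : Mat m) * (moment b L s : Mat m)).trace = 0 := by
  have h1 : ∑ s, ((a (s - 1) : Mat m) * (b (s - 1) : Mat m)).trace =
      ∑ s, ((Ad (L s)⁻¹ (a s) : Mat m) * (Ad (L s)⁻¹ (b s) : Mat m)).trace := by
    simp only [trace_Ad_mul_Ad]
    exact (sum_shift (fun s => ((a s : Mat m) * (b s : Mat m)).trace)).symm
  have h2 : ∀ s, ((moment a L s : Mat m) * (b (s - 1) : Mat m)).trace +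
      ((a (s - 1) : Mat m) * (moment b L s : Mat m)).trace =
      ((a (s - 1) : Mat m) * (b (s - 1) : Mat m)).trace -
      ((Ad (L s)⁻¹ (a s) : Mat m) * (Ad (L s)⁻¹ (b s) : Mat m)).trace := by
    intro s
    have h3 := trace_mul_eq_zero (ha s) (hb s).isParabolic
    simp only [coe_moment, Matrix.mul_sub, Matrix.sub_mul, Matrix.trace_sub] at h3 ⊢
    linarith
  rw [← Finset.sum_add_distrib, Finset.sum_congr rfl fun s _ => h2 s, Finset.sum_sub_distrib, h1,
    sub_self]

/-- For gauge invariant functions the twisted bracket is the derivative of the first function along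
the infinitesimal gauge transformation given by the shifted gradient of the second. -/
theorem twistedBracket_eq (hF : IsGaugeInvariant F) (hE : IsGaugeInvariant E)
    (hFs : SmoothAt F L) (hEs : SmoothAt E L) :
    twistedBracket F E L =
      pairing (leftGrad F L) (gaugeField (fun n => leftGrad E L (n - 1)) L) := by
  have ha := hF.isNilradical_moment hFs
  have hb := hE.isNilradical_moment hEs
  set a := leftGrad F L with hadef
  set b := leftGrad E L with hbdef
  have h1 : twistedBracket F E L = ∑ s, (rWedge (a (s - 1)) (b (s - 1)) +
      rWedge (Ad (L s)⁻¹ (a s)) (Ad (L s)⁻¹ (b s)) -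
      rTensor (Ad (L s)⁻¹ (a s)) (b (s - 1)) + rTensor (Ad (L s)⁻¹ (b s)) (a (s - 1))) := by
    rw [twistedBracket, sum_shift (fun s => rWedge (leftGrad F L s) (leftGrad E L s)),
      sum_shift (fun s => rTensor (rightGrad F L (s + 1)) (leftGrad E L s)),
      sum_shift (fun s => rTensor (rightGrad E L (s + 1)) (leftGrad F L s))]
    simp only [hFs.rightGrad_eq, hEs.rightGrad_eq, sub_add_cancel]
    simp only [Finset.sum_add_distrib, Finset.sum_sub_distrib, ← hadef, ← hbdef]
  -- The bracket is now half the difference of the two sums in `sum_trace_moment`. They are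
  -- opposite, so it equals the first sum.
  rw [h1, pairing_gaugeField,
    Finset.sum_congr rfl fun s _ => rWedge_add_rWedge (ha s) (hb s), ← Finset.mul_sum,
    Finset.sum_sub_distrib]
  have h2 := sum_trace_moment ha hb
  have h3 : pairing (moment a L) (fun n => b (n - 1)) =
    ∑ s, ((moment a L s : Mat m) * (b (s - 1) : Mat m)).trace := rfl
  rw [h3]
  simp only [coe_moment] at h2 ⊢
  linarith

theorem IsGaugeInvariant.leftGrad_gauge (hF : IsGaugeInvariant F) (hs : SmoothAt F L) {h : GN m N}
    (hh : ∀ n, h n ∈ H m) (hs' : SmoothAt F (gauge h L)) (n : ZMod N) :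
    leftGrad F (gauge h L) n = Ad (h (n + 1)) (leftGrad F L n) := by
  refine congrFun (pairing_ext (b := fun n => Ad (h (n + 1)) (leftGrad F L n)) fun ξ => ?_) n
  have h1 := hs'.comp (γ := fun ε => fun n => expG (ε • ξ n) * gauge h L n) (t := 0)
    (by funext n; simp [expG_zero]) (hasDerivAt_expG_mul ξ (gauge h L)).hasDerivWithinAt
    (s := Set.univ)
  have h2 : HasDerivWithinAt
      (fun ε : ℝ => amb (fun n => (h (n + 1))⁻¹ * expG (ε • ξ n) * h (n + 1) * L n))
      (tangent (fun n => Ad (h (n + 1))⁻¹ (ξ n)) L) Set.univ 0 := by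
    refine hasDerivWithinAt_pi.2 fun n => ?_
    have h3 := hasDerivWithinAt_matrix_mul (hasDerivWithinAt_matrix_mul
      (hasDerivWithinAt_const (0 : ℝ) Set.univ ((h (n + 1) : Mat m)⁻¹))
      (hasDerivAt_expG (ξ n)).hasDerivWithinAt)
      (hasDerivWithinAt_const (0 : ℝ) Set.univ ((h (n + 1) : Mat m) * (L n : Mat m)))
    have h4 : (fun ε : ℝ => amb (fun n => (h (n + 1))⁻¹ * expG (ε • ξ n) * h (n + 1) * L n) n) =
        fun ε => ((h (n + 1) : Mat m)⁻¹) * (expG (ε • ξ n) : Mat m) *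
          ((h (n + 1) : Mat m) * (L n : Mat m)) := by
      funext ε
      simp only [amb_apply, coe_mul_eq, coe_inv_eq, Matrix.mul_assoc]
    rw [h4]
    refine h3.congr_deriv ?_
    simp [tangent, coe_Ad_inv, Matrix.mul_assoc]
  have h5 := hs.comp (by funext n; simp [expG_zero]) h2
  have h6 : (fun ε : ℝ => F (fun n => expG (ε • ξ n) * gauge h L n)) =
      fun ε => F (fun n => (h (n + 1))⁻¹ * expG (ε • ξ n) * h (n + 1) * L n) := by
    funext ε
    rw [← hF h (fun n => (h (n + 1))⁻¹ * expG (ε • ξ n) * h (n + 1) * L n) hh]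
    congr 1
    funext n
    simp [gauge, mul_assoc]
  rw [h6] at h1
  rw [(h1.hasDerivAt Filter.univ_mem).unique (h5.hasDerivAt Filter.univ_mem)]
  exact Finset.sum_congr rfl fun n _ => (trace_Ad_mul _ _ _).symm

/-- In the collapsed form both factors of each trace, the moment of `F` and the shifted gradient of
`E`, are conjugated by the same `h n`. -/
theorem twistedBracket_gauge (hF : IsGaugeInvariant F) (hE : IsGaugeInvariant E)
    (hFs : SmoothAt F L) (hEs : SmoothAt E L) {h : GN m N} (hh : ∀ n, h n ∈ H m)
    (hFs' : SmoothAt F (gauge h L)) (hEs' : SmoothAt E (gauge h L)) :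
    twistedBracket F E (gauge h L) = twistedBracket F E L := by
  rw [twistedBracket_eq hF hE hFs hEs, twistedBracket_eq hF hE hFs' hEs', pairing_gaugeField,
    pairing_gaugeField]
  refine Finset.sum_congr rfl fun n _ => ?_
  have h1 : moment (leftGrad F (gauge h L)) (gauge h L) n =
      Ad (h n) (moment (leftGrad F L) L n) := by
    rw [moment, moment, hF.leftGrad_gauge hFs hh hFs', hF.leftGrad_gauge hFs hh hFs', Ad_sub,
      ← Ad_mul, ← Ad_mul, sub_add_cancel]
    simp [gauge, mul_assoc]
  simp only [h1, hE.leftGrad_gauge hEs hh hEs', sub_add_cancel, trace_Ad_mul_Ad]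

end Invariant

theorem reducedBracket_proj [NeZero m] {f g : Moduli m N → ℝ} {U : Set (Moduli m N)}
    (hf : SmoothOn f U) (hg : SmoothOn g U) {L : GN m N} (hL : proj L ∈ U) :
    reducedBracket f g (proj L) =
      twistedBracket (fun L' => f (proj L')) (fun L' => g (proj L')) L := by
  have h1 : proj (Quotient.out (s := gaugeSetoid m N) (proj L)) = proj L :=
    Quotient.out_eq (s := gaugeSetoid m N) (proj L)
  obtain ⟨h, hh, h2⟩ := proj_eq_iff.1 h1.symm
  have hL' : proj (gauge h L) ∈ U := by rw [← h2, h1]; exact hL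
  rw [reducedBracket, h2]
  exact twistedBracket_gauge (isGaugeInvariant_comp_proj f) (isGaugeInvariant_comp_proj g)
    (hf L hL) (hg L hL) hh (hf _ hL') (hg _ hL')

end TwistedGon

/-! ### Infinitesimal rigidity of nondegenerate polygons. -/

namespace TwistedGon

open Matrix Topology

variable {m N : ℕ}

section Chain

variable {v : ℕ → Fin m → ℝ}

/-- These are the coordinates in the basis of `m` consecutive vertices, together with the trace
computed in that basis. -/
theorem exists_dual_family {n : ℕ} (hv : (Matrix.of fun i j : Fin m => v (n + j) i).det ≠ 0) :
    ∃ φ : Fin m → (Fin m → ℝ) →ₗ[ℝ] ℝ, (∀ i j : Fin m, φ i (v (n + j)) = if i = j then 1 else 0) ∧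
      (∀ A : Mat m, A.trace = ∑ i, φ i (A *ᵥ v (n + i))) ∧
      ∀ w, w = ∑ i, φ i w • v (n + i) := by
  set B : Mat m := Matrix.of fun i j : Fin m => v (n + j) i with hB
  have hu : IsUnit B.det := isUnit_iff_ne_zero.2 hv
  have hcol : ∀ A : Mat m, ∀ i j : Fin m, (A * B) i j = (A *ᵥ v (n + j)) i := fun A i j => by
    simp [Matrix.mul_apply, Matrix.mulVec, dotProduct, hB]
  have hφ : ∀ (i : Fin m) w, (LinearMap.proj i ∘ₗ Matrix.mulVecLin B⁻¹ :
      (Fin m → ℝ) →ₗ[ℝ] ℝ) w = (B⁻¹ *ᵥ w) i := fun i w => rfl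
  refine ⟨fun i => LinearMap.proj i ∘ₗ Matrix.mulVecLin B⁻¹, fun i j => ?_, fun A => ?_,
    fun w => ?_⟩
  · rw [hφ, ← hcol, Matrix.nonsing_inv_mul _ hu, Matrix.one_apply]
  · have : A.trace = (B⁻¹ * (A * B)).trace := by
      rw [Matrix.trace_mul_comm, Matrix.mul_assoc, Matrix.mul_nonsing_inv _ hu, Matrix.mul_one]
    rw [this]
    refine Finset.sum_congr rfl fun i _ => ?_
    rw [hφ, Matrix.diag_apply, ← Matrix.mul_assoc, hcol, Matrix.mulVec_mulVec]
  · simp only [hφ]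
    have h1 : w = B *ᵥ (B⁻¹ *ᵥ w) := by
      rw [Matrix.mulVec_mulVec, Matrix.mul_nonsing_inv _ hu, Matrix.one_mulVec]
    conv_lhs => rw [h1]
    funext i
    rw [Finset.sum_apply]
    simp [Matrix.mulVec, dotProduct, hB, mul_comm]

theorem map_eq_zero_of_mem_span {φ : (Fin m → ℝ) →ₗ[ℝ] ℝ} {s : Set ℕ}
    (h : ∀ l ∈ s, φ (v l) = 0) {w : Fin m → ℝ} (hw : w ∈ Submodule.span ℝ (v '' s)) : φ w = 0 := by
  have : Submodule.span ℝ (v '' s) ≤ LinearMap.ker φ := by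
    rw [Submodule.span_le]
    rintro _ ⟨l, hl, rfl⟩
    exact h l hl
  exact this hw

/-- A sequence of endomorphisms `Zₙ` such that `vₙ` is an eigenvector of `Zₙ` and
`Zₙ₊₁ - Zₙ` has its image in the line of `vₙ` and kills `vₙ`. -/
structure IsChain (v : ℕ → Fin m → ℝ) (Z : ℕ → Mat m) (l : ℕ → ℝ) : Prop where
  eigen : ∀ n, Z n *ᵥ v n = l n • v n
  step_self : ∀ n, Z (n + 1) *ᵥ v n = Z n *ᵥ v n
  step : ∀ n w, ∃ c : ℝ, Z (n + 1) *ᵥ w = Z n *ᵥ w + c • v n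

variable {Z : ℕ → Mat m} {l : ℕ → ℝ}

/-- The step from `n` to `n + 1` does not alter the value on `vₙ`, and each later step adds a
multiple of the then current vertex. -/
theorem IsChain.sub_mem_span (h : IsChain v Z l) (n j : ℕ) :
    Z (n + j) *ᵥ v n - l n • v n ∈ Submodule.span ℝ (v '' Set.Ico (n + 1) (n + j)) := by
  induction j with
  | zero => simp [h.eigen]
  | succ j ih =>
    rcases Nat.eq_zero_or_pos j with rfl | hj
    · simp [h.step_self, h.eigen]
    · obtain ⟨c, hc⟩ := h.step (n + j) (v n)
      rw [← add_assoc, hc, add_sub_right_comm]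
      refine add_mem (Submodule.span_mono (Set.image_mono (Set.Ico_subset_Ico_right ?_)) ih)
        (Submodule.smul_mem _ _ (Submodule.subset_span ⟨n + j, ⟨?_, ?_⟩, rfl⟩)) <;> omega

variable (hv : ∀ n, (Matrix.of fun i j : Fin m => v (n + j) i).det ≠ 0)
include hv

/-- In the basis `vₙ, …, vₙ₊ₘ₋₁` the last endomorphism `Zₙ₊ₘ₋₁` is lower triangular, and its
diagonal entries are the eigenvalues. -/
theorem IsChain.trace_eq (h : IsChain v Z l) (hm : 1 ≤ m) (n : ℕ) :
    (Z (n + (m - 1))).trace = ∑ i : Fin m, l (n + i) := by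
  obtain ⟨φ, h1, h2, -⟩ := exists_dual_family (hv n)
  rw [h2]
  refine Finset.sum_congr rfl fun i _ => ?_
  have h3 := h.sub_mem_span (n + i) (m - 1 - i)
  have h4 : n + i + (m - 1 - i) = n + (m - 1) := by omega
  rw [h4] at h3
  have h5 := map_eq_zero_of_mem_span (φ := φ i) (fun k hk => ?_) h3
  · rw [map_sub, map_smul, h1, if_pos rfl, smul_eq_mul, mul_one, sub_eq_zero] at h5
    exact h5
  · obtain ⟨hk1, hk2⟩ := hk
    have h6 := h1 i ⟨k - n, by omega⟩
    rw [if_neg (by rw [Fin.ext_iff]; simp; omega)] at h6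
    convert h6 using 3
    simp
    omega

/-- Descending induction on `k`. For `k = m - 2` evaluate on a basis of consecutive vertices ending
with `vₙ`. To pass from `k + 1` to `k`, intersect the bound for `Zₙ` with the one that `Zₙ₊₁ = Zₙ`
modulo `vₙ` provides; the `k + 2 ≤ m` vertices involved are independent. -/
theorem IsChain.image_subset (h : IsChain v Z 0) {k : ℕ} (hk : k + 2 ≤ m) :
    ∀ n, m ≤ n → ∀ w, Z n *ᵥ w ∈ Submodule.span ℝ (v '' Set.Ico (n - k) n) := by
  induction hj : m - 2 - k generalizing k with
  | zero =>
    intro n hn w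
    obtain rfl : k = m - 2 := by omega
    obtain ⟨φ, -, -, h3⟩ := exists_dual_family (hv (n - (m - 1)))
    rw [h3 w, Matrix.mulVec_sum]
    refine sum_mem fun i _ => ?_
    rw [Matrix.mulVec_smul]
    refine Submodule.smul_mem _ _ ?_
    have h4 := h.sub_mem_span (n - (m - 1) + i) (m - 1 - i)
    have h5 : n - (m - 1) + i + (m - 1 - i) = n := by omega
    rw [h5, Pi.zero_apply, zero_smul, sub_zero] at h4
    exact Submodule.span_mono (Set.image_mono (Set.Ico_subset_Ico_left (by omega))) h4
  | succ j ih =>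
    intro n hn w
    have hP := ih (k := k + 1) (by omega) (by omega)
    have h1 := hP n hn w
    have h2 : Z n *ᵥ w ∈ Submodule.span ℝ (v '' Set.Ico (n - k) (n + 1)) := by
      obtain ⟨c, hc⟩ := h.step n w
      rw [eq_sub_of_add_eq hc.symm]
      refine sub_mem ?_ (Submodule.smul_mem _ _ (Submodule.subset_span ⟨n, ⟨?_, ?_⟩, rfl⟩))
      · have := hP (n + 1) (by omega) w
        rwa [Nat.add_sub_add_right] at this
      all_goals omega
    -- The first coordinate in the basis starting at `vₙ₋ₖ₋₁` detects that vertex and kills the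
    -- vertices after it, up to `vₙ`.
    obtain ⟨φ, hφ, -, -⟩ := exists_dual_family (hv (n - (k + 1)))
    have hφ0 : φ ⟨0, by omega⟩ (v (n - (k + 1))) = 1 := by
      simpa using hφ ⟨0, by omega⟩ ⟨0, by omega⟩
    have hφ1 : ∀ s ∈ Set.Ico (n - k) (n + 1), φ ⟨0, by omega⟩ (v s) = 0 := by
      rintro s ⟨hs1, hs2⟩
      have h6 := hφ ⟨0, by omega⟩ ⟨s - (n - (k + 1)), by omega⟩
      rw [if_neg (by rw [Fin.ext_iff]; simp; omega)] at h6
      convert h6 using 3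
      simp
      omega
    have hins : Set.Ico (n - (k + 1)) n = insert (n - (k + 1)) (Set.Ico (n - k) n) := by
      ext s
      simp only [Set.mem_Ico, Set.mem_insert_iff]
      omega
    rw [hins, Set.image_insert_eq, Submodule.mem_span_insert] at h1
    obtain ⟨c, z, hz, hZ⟩ := h1
    have hz0 : φ ⟨0, by omega⟩ z = 0 := map_eq_zero_of_mem_span
      (fun s hs => hφ1 s (Set.Ico_subset_Ico_right (by omega) hs)) hz
    have hZ0 := map_eq_zero_of_mem_span hφ1 h2
    rw [hZ, map_add, map_smul, hφ0, hz0, add_zero, smul_eq_mul, mul_one] at hZ0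
    rw [hZ, hZ0, zero_smul, zero_add]
    exact hz

theorem IsChain.eq_zero (h : IsChain v Z 0) (hm : 2 ≤ m) {n : ℕ} (hn : m ≤ n) : Z n = 0 := by
  have h1 : ∀ w, Z n *ᵥ w = 0 := fun w => by
    have := h.image_subset hv (k := 0) (by omega) n hn w
    simpa using this
  ext i j
  have := congrFun (h1 (Pi.single j 1)) i
  simpa using this

end Chain

/-- A function on `ℤ/N` whose sums over `m` consecutive arguments vanish is zero. -/
theorem eq_zero_of_window_sum [NeZero N] (hm : 1 ≤ m) (hmN : Nat.Coprime m N) {l : ZMod N → ℝ}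
    (h : ∀ s, ∑ i : Fin m, l (s + (i : ℕ)) = 0) : l = 0 := by
  -- Two adjacent windows differ only in their end terms, so `l` has period `m`. It also has period
  -- `N`, and since `m` is a unit modulo `N`, it is constant.
  have h1 : ∀ s, l (s + m) = l s := by
    intro s
    obtain ⟨k, rfl⟩ : ∃ k, m = k + 1 := ⟨m - 1, by omega⟩
    have ha := h s
    have hb := h (s + 1)
    rw [Fin.sum_univ_succ] at ha
    rw [Fin.sum_univ_castSucc] at hb
    have hc : ∑ i : Fin k, l (s + ((i.succ : Fin (k + 1)) : ℕ)) =
        ∑ i : Fin k, l (s + 1 + ((i.castSucc : Fin (k + 1)) : ℕ)) :=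
      Finset.sum_congr rfl fun i _ => by
        congr 1
        simp
        ring
    rw [hc] at ha
    simp only [Fin.val_zero, Nat.cast_zero, add_zero, Fin.val_last] at ha hb
    have hd : s + 1 + (k : ZMod N) = s + ((k + 1 : ℕ) : ZMod N) := by push_cast; ring
    rw [hd] at hb
    linarith
  have h2 : ∀ (k : ℕ) s, l (s + k * m) = l s := by
    intro k
    induction k with
    | zero => simp
    | succ k ih =>
      intro s
      rw [← ih s, ← h1 (s + k * m)]
      congr 1
      push_cast
      ring
  have h3 : ∀ s, l s = l 0 := by
    intro s
    have hu : ((m : ZMod N)⁻¹ : ZMod N) * m = 1 := by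
      rw [mul_comm]
      exact ZMod.coe_mul_inv_eq_one m hmN
    have := h2 (s * (m : ZMod N)⁻¹).val 0
    rw [ZMod.natCast_zmod_val, mul_assoc, hu, mul_one, zero_add] at this
    exact this
  funext s
  have h4 := h 0
  simp only [h3] at h4
  rw [Finset.sum_const, Finset.card_univ, Fintype.card_fin, nsmul_eq_mul] at h4
  rw [h3, Pi.zero_apply]
  have : (m : ℝ) ≠ 0 := by positivity
  exact (mul_eq_zero.1 h4).resolve_left this

theorem coe_frame_succ (L : GN m N) (n : ℕ) :
    (frame L (n + 1) : Mat m) = (frame L n : Mat m) * ((L n : Mat m))⁻¹ := by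
  rw [frame, coe_mul_eq, coe_inv_eq]

/-- Infinitesimal rigidity of nondegenerate polygons. -/
theorem eq_zero_of_parabolic_of_nilradical [NeZero m] [NeZero N] (hm : 2 ≤ m)
    (hmN : Nat.Coprime m N) {L : GN m N} (hL : PolygonNondegenerate L) {ζ ν : ZMod N → Mat m}
    (htr : ∀ s, (ζ s).trace = 0) (hζ : ∀ s, IsParabolic (ζ s)) (hν : ∀ s, IsNilradical (ν s))
    (h : ∀ s, ζ (s + 1) = (L s : Mat m) * (ζ s - ν s) * (L s : Mat m)⁻¹) : ζ = 0 := by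
  -- Viewed in the fixed frame, the recursion becomes `Zₙ₊₁ = Zₙ - gₙ νₙ gₙ⁻¹`. Since `νₙ` kills
  -- `e₁` and has image in its line, this is a chain along the vertices.
  let Z : ℕ → Mat m := fun n => (frame L n : Mat m) * ζ n * (frame L n : Mat m)⁻¹
  have hcancel : ∀ (g : G m) (w : Fin m → ℝ), (g : Mat m)⁻¹ *ᵥ ((g : Mat m) *ᵥ w) = w :=
    fun g w => by rw [Matrix.mulVec_mulVec, coe_inv_mul, Matrix.one_mulVec]
  have hstep : ∀ (n : ℕ) w, Z (n + 1) *ᵥ w = Z n *ᵥ w -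
      (frame L n : Mat m) *ᵥ (ν n *ᵥ ((frame L n : Mat m)⁻¹ *ᵥ w)) := by
    intro n w
    have h1 : Z (n + 1) = Z n - (frame L n : Mat m) * ν n * (frame L n : Mat m)⁻¹ := by
      simp only [Z, Nat.cast_add, Nat.cast_one, h, coe_frame_succ, Matrix.mul_inv_rev]
      rw [Matrix.nonsing_inv_nonsing_inv _ (by simp)]
      have e := coe_inv_mul (L (n : ZMod N))
      calc _ = (frame L n : Mat m) * (((L n : Mat m)⁻¹ * (L n : Mat m)) * (ζ n - ν n)) *
            (((L n : Mat m)⁻¹ * (L n : Mat m)) * (frame L n : Mat m)⁻¹) := by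
            simp only [Matrix.mul_assoc]
        _ = _ := by
            rw [e, Matrix.one_mul, Matrix.one_mul, Matrix.mul_sub, Matrix.sub_mul]
    rw [h1, Matrix.sub_mulVec, Matrix.mulVec_mulVec, Matrix.mulVec_mulVec]
  have hchain : IsChain (vertex L) Z fun n => ζ n 0 0 := by
    refine ⟨fun n => ?_, fun n => ?_, fun n w => ?_⟩
    · have h1 : ζ n *ᵥ e₁ m = ζ n 0 0 • e₁ m := by
        rw [mulVec_e₁]
        funext i
        by_cases hi : i = 0
        · simp [e₁, hi]
        · simp [e₁, hi, hζ n i hi]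
      simp only [Z, vertex]
      rw [← Matrix.mulVec_mulVec, hcancel, ← Matrix.mulVec_mulVec, h1, Matrix.mulVec_smul]
    · rw [hstep, vertex, hcancel]
      have h1 : ν n *ᵥ e₁ m = 0 := by
        rw [mulVec_e₁]
        funext i
        exact hν n i 0 (Or.inr rfl)
      rw [h1, Matrix.mulVec_zero, sub_zero]
    · refine ⟨-(ν n *ᵥ ((frame L n : Mat m)⁻¹ *ᵥ w)) 0, ?_⟩
      have h1 : ∀ u, ν n *ᵥ u = (ν n *ᵥ u) 0 • e₁ m := by
        intro u
        funext i
        by_cases hi : i = 0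
        · simp [e₁, hi]
        · simp only [e₁, Pi.smul_apply, Pi.single_eq_of_ne hi, smul_zero]
          simp only [Matrix.mulVec, dotProduct]
          exact Finset.sum_eq_zero fun j _ => by rw [hν n i j (Or.inl hi), zero_mul]
      rw [hstep, vertex, neg_smul, sub_eq_add_neg]
      conv_lhs => rw [h1, Matrix.mulVec_smul]
  have hZtr : ∀ n, (Z n).trace = 0 := fun n => by
    simp only [Z]
    rw [Matrix.trace_mul_cycle, coe_inv_mul, Matrix.one_mul, htr]
  -- Tracelessness makes all window sums of eigenvalues vanish; here coprimality enters.
  have hl : (fun s => ζ s 0 0) = 0 := by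
    refine eq_zero_of_window_sum (by omega) hmN fun s => ?_
    have h1 := hchain.trace_eq hL (by omega) s.val
    rw [hZtr] at h1
    rw [h1]
    refine Finset.sum_congr rfl fun i _ => ?_
    simp
  have hl' : (fun n : ℕ => ζ n 0 0) = 0 := funext fun n => congrFun hl n
  rw [hl'] at hchain
  funext s
  -- A multiple of `N` is added to the index because the chain argument looks back over earlier
  -- vertices and needs an index at least `m`.
  have h1 := hchain.eq_zero hL hm (n := s.val + N * m)
    (le_add_left (Nat.le_mul_of_pos_left m (NeZero.pos N)))
  have h2 : ((s.val + N * m : ℕ) : ZMod N) = s := by simp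
  simp only [Z] at h1
  rw [h2] at h1
  set g := frame L (s.val + N * m)
  calc ζ s = ((g : Mat m)⁻¹ * (g : Mat m)) * ζ s * ((g : Mat m)⁻¹ * (g : Mat m)) := by
        rw [coe_inv_mul, Matrix.one_mul, Matrix.mul_one]
    _ = (g : Mat m)⁻¹ * ((g : Mat m) * ζ s * (g : Mat m)⁻¹) * (g : Mat m) := by
        simp only [Matrix.mul_assoc]
    _ = 0 := by rw [h1, Matrix.mul_zero, Matrix.zero_mul]

end TwistedGon

/-! ### Normal forms and local sections of the quotient map. -/

namespace TwistedGon

open Matrix Topology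
open scoped ContDiff Matrix.Norms.Elementwise

variable {m N : ℕ}

/-! ### Products over arithmetic windows -/

theorem prod_range_mul {M : Type*} [CommMonoid M] (f : ℕ → M) (a b : ℕ) :
    ∏ i ∈ Finset.range b, ∏ j ∈ Finset.range a, f (a * i + j) =
      ∏ l ∈ Finset.range (a * b), f l := by
  induction b with
  | zero => simp
  | succ b ih => rw [Finset.prod_range_succ, ih, Nat.mul_succ, Finset.prod_range_add]

theorem prod_range_period [NeZero N] {M : Type*} [CommMonoid M] (f : ZMod N → M) (n : ℕ) :
    ∏ l ∈ Finset.range N, f ((n + l : ℕ) : ZMod N) = ∏ s, f s := by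
  rw [← Equiv.prod_comp (Equiv.addLeft (n : ZMod N)) f]
  refine Finset.prod_bij (fun l _ => (l : ZMod N)) (fun _ _ => Finset.mem_univ _) ?_ ?_ ?_
  · intro a ha b hb hab
    rw [ZMod.natCast_eq_natCast_iff] at hab
    exact Nat.ModEq.eq_of_lt_of_lt hab (Finset.mem_range.1 ha) (Finset.mem_range.1 hb)
  · intro s _
    exact ⟨s.val, Finset.mem_range.2 s.val_lt, by simp⟩
  · intro l _
    simp

theorem prod_range_one_add_mul [NeZero N] {M : Type*} [CommMonoid M] (f : ZMod N → M) (n q : ℕ) :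
    ∏ l ∈ Finset.range (1 + N * q), f ((n + l : ℕ) : ZMod N) = f n * (∏ s, f s) ^ q := by
  rw [add_comm, Finset.prod_range_succ, mul_comm]
  congr 1
  · simp
  · rw [← prod_range_mul (fun l => f ((n + l : ℕ) : ZMod N)), ← Finset.card_range q,
      ← Finset.prod_const, Finset.card_range]
    refine Finset.prod_congr rfl fun i _ => ?_
    rw [← prod_range_period f (n + N * i)]
    simp only [add_assoc]

theorem exists_mul_eq_one_add [NeZero N] (hm : 1 ≤ m) (hmN : Nat.Coprime m N) :
    ∃ r q : ℕ, m * r = 1 + N * q := by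
  -- Adding `N` keeps `r` positive, also when `N = 1` and the representative of the inverse is `0`.
  let r := ((m : ZMod N)⁻¹).val + N
  have h1 : ((m * r : ℕ) : ZMod N) = (1 : ℕ) := by
    simp [r, ZMod.coe_mul_inv_eq_one m hmN]
  rw [ZMod.natCast_eq_natCast_iff] at h1
  have h2 : 1 ≤ m * r := Nat.mul_pos hm (Nat.add_pos_right _ (NeZero.pos N))
  obtain ⟨q, hq⟩ := (Nat.modEq_iff_dvd' h2).1 h1.symm
  exact ⟨r, q, by omega⟩

/-! ### The normal form -/

/-- The frame, on the ambient space. -/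
noncomputable def ambFrame (X : Amb m N) : ℕ → Mat m
  | 0 => 1
  | n + 1 => ambFrame X n * (X n)⁻¹

theorem ambFrame_amb (L : GN m N) (n : ℕ) : ambFrame (amb L) n = (frame L n : Mat m) := by
  induction n with
  | zero => rfl
  | succ n ih => rw [ambFrame, ih, coe_frame_succ, amb_apply]

theorem contDiffAt_ambFrame [NeZero N] (L : GN m N) (n : ℕ) :
    ContDiffAt ℝ ∞ (fun X : Amb m N => ambFrame X n) (amb L) := by
  induction n with
  | zero => exact contDiffAt_const
  | succ n ih =>
    refine contDiffAt_matrix_mul ih (contDiffAt_matrix_inv ?_ (by simp))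
    exact contDiffAt_pi.1 contDiffAt_id _

variable [NeZero m]

/-- The determinant of `m` consecutive vertices. -/
noncomputable def windowDet (X : Amb m N) (n : ℕ) : ℝ :=
  (Matrix.of fun i j : Fin m => ambFrame X (n + j) i 0).det

/-- A product of window determinants that scales like a single vertex. -/
noncomputable def weight (r : ℕ) (X : Amb m N) (n : ℕ) : ℝ :=
  ∏ i ∈ Finset.range r, windowDet X (n + m * i)

/-- `m` consecutive rescaled vertices. -/
noncomputable def window (r : ℕ) (X : Amb m N) (n : ℕ) : Mat m :=
  Matrix.of fun i j : Fin m => (weight r X (n + j))⁻¹ * ambFrame X (n + j) i 0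

/-- The gauge transformation which brings the polygon to its normal form. -/
noncomputable def normalizer (r : ℕ) (X : Amb m N) (s : ZMod N) : Mat m :=
  (window r X s.val)⁻¹ * ambFrame X s.val

theorem vertex_eq (L : GN m N) (n : ℕ) (i : Fin m) : vertex L n i = ambFrame (amb L) n i 0 := by
  rw [vertex, mulVec_e₁, ambFrame_amb]

theorem polygonNondegenerate_iff {L : GN m N} :
    PolygonNondegenerate L ↔ ∀ n, windowDet (amb L) n ≠ 0 := by
  simp only [PolygonNondegenerate, vertex_eq, windowDet]

/-- Passing once around the polygon multiplies all vertices by the monodromy, which has determinant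
one. -/
theorem windowDet_add (L : GN m N) (n : ℕ) :
    windowDet (amb L) (n + N) = windowDet (amb L) n := by
  have h : (Matrix.of fun i j : Fin m => ambFrame (amb L) (n + N + j) i 0) =
      (monodromy L : Mat m) * (Matrix.of fun i j : Fin m => ambFrame (amb L) (n + j) i 0) := by
    ext i j
    have h1 : n + N + j = n + j + N := by omega
    rw [Matrix.of_apply, h1, ambFrame_amb, frame_add, coe_mul_eq, Matrix.mul_apply,
      Matrix.mul_apply]
    simp [ambFrame_amb]
  rw [windowDet, h, Matrix.det_mul]
  simp [windowDet]

theorem windowDet_val [NeZero N] (L : GN m N) (n : ℕ) :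
    windowDet (amb L) (n : ZMod N).val = windowDet (amb L) n := by
  rw [ZMod.val_natCast]
  have h : ∀ k, windowDet (amb L) (n % N + N * k) = windowDet (amb L) (n % N) := by
    intro k
    induction k with
    | zero => rfl
    | succ k ih => rw [Nat.mul_succ, ← add_assoc, windowDet_add, ih]
  have h1 := h (n / N)
  rw [Nat.mod_add_div] at h1
  exact h1.symm

theorem weight_ne_zero {L : GN m N} (hL : PolygonNondegenerate L) (r n : ℕ) :
    weight r (amb L) n ≠ 0 :=
  Finset.prod_ne_zero_iff.2 fun _ _ => polygonNondegenerate_iff.1 hL _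

/-- The weights of `m` consecutive vertices multiply to a product of `m * r = 1 + N * q` consecutive
window determinants. That is one extra factor, which cancels the determinant of the window itself,
and `q` full periods. In particular the result does not depend on `n`. -/
theorem det_window [NeZero N] {L : GN m N} (hL : PolygonNondegenerate L) {r q : ℕ}
    (hr : m * r = 1 + N * q) (n : ℕ) :
    (window r (amb L) n).det = ((∏ s : ZMod N, windowDet (amb L) s.val) ^ q)⁻¹ := by
  rw [window, Matrix.det_mul_row (fun j : Fin m => (weight r (amb L) (n + j))⁻¹)
    (fun i j : Fin m => ambFrame (amb L) (n + j) i 0)]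
  have h1 : ∏ j : Fin m, weight r (amb L) (n + j) =
      windowDet (amb L) n * (∏ s : ZMod N, windowDet (amb L) s.val) ^ q := by
    rw [Fin.prod_univ_eq_prod_range (fun j => weight r (amb L) (n + j)) m]
    simp only [weight]
    rw [Finset.prod_comm]
    have h2 := prod_range_mul (fun l => windowDet (amb L) (n + l)) m r
    have h3 := prod_range_one_add_mul (fun s : ZMod N => windowDet (amb L) s.val) n q
    simp only [windowDet_val] at h3
    rw [← h3, ← hr, ← h2]
    refine Finset.prod_congr rfl fun i _ => Finset.prod_congr rfl fun j _ => ?_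
    congr 1
    ring
  have h4 := polygonNondegenerate_iff.1 hL n
  have h5 : (Matrix.det fun i j : Fin m => ambFrame (amb L) (n + j) i 0) =
    windowDet (amb L) n := rfl
  rw [Finset.prod_inv_distrib, h1, h5, mul_inv]
  field_simp

theorem window_prod_ne_zero [NeZero N] {L : GN m N} (hL : PolygonNondegenerate L) (q : ℕ) :
    (∏ s : ZMod N, windowDet (amb L) s.val) ^ q ≠ 0 :=
  pow_ne_zero _ (Finset.prod_ne_zero_iff.2 fun _ _ => polygonNondegenerate_iff.1 hL _)

theorem det_normalizer [NeZero N] {L : GN m N} (hL : PolygonNondegenerate L) {r q : ℕ}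
    (hr : m * r = 1 + N * q) (s : ZMod N) :
    (normalizer r (amb L) s).det = (∏ s : ZMod N, windowDet (amb L) s.val) ^ q := by
  rw [normalizer, Matrix.det_mul, Matrix.det_nonsing_inv, det_window hL hr, ambFrame_amb]
  simp

theorem det_normalizer_ne_zero [NeZero N] {L : GN m N} (hL : PolygonNondegenerate L) {r q : ℕ}
    (hr : m * r = 1 + N * q) (s : ZMod N) : (normalizer r (amb L) s).det ≠ 0 := by
  rw [det_normalizer hL hr]
  exact window_prod_ne_zero hL q

/-- The first column of the frame is a multiple of the first column of the window, whose inverse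
sends it to a multiple of `e₁`. -/
theorem isParabolic_normalizer [NeZero N] {L : GN m N} (hL : PolygonNondegenerate L) {r q : ℕ}
    (hr : m * r = 1 + N * q) (s : ZMod N) : IsParabolic (normalizer r (amb L) s) := by
  have hu : IsUnit (window r (amb L) s.val).det := by
    rw [det_window hL hr]
    exact (isUnit_iff_ne_zero.2 (inv_ne_zero (window_prod_ne_zero hL q)))
  have h1 : ∀ k, ambFrame (amb L) s.val k 0 =
      weight r (amb L) s.val * window r (amb L) s.val k 0 := by
    intro k
    have := weight_ne_zero hL r s.val
    simp [window, this]
  intro i hi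
  have h2 : normalizer r (amb L) s i 0 = weight r (amb L) s.val *
      ((window r (amb L) s.val)⁻¹ * window r (amb L) s.val) i 0 := by
    rw [normalizer, Matrix.mul_apply, Matrix.mul_apply, Finset.mul_sum]
    refine Finset.sum_congr rfl fun k _ => ?_
    rw [h1]
    ring
  rw [h2, Matrix.nonsing_inv_mul _ hu, Matrix.one_apply_ne hi, mul_zero]

/-! ### Behaviour under the gauge action -/

theorem diag_ne_zero {h : G m} (hh : h ∈ H m) : (h : Mat m) 0 0 ≠ 0 := by
  obtain ⟨a, ha, h1⟩ := hh
  have := congrFun h1 0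
  rw [mulVec_e₁] at this
  simp only [e₁, Pi.smul_apply, Pi.single_eq_same, smul_eq_mul, mul_one] at this
  rwa [this]

theorem mul_inv_apply_zero {h : G m} (hh : h ∈ H m) (A : Mat m) (i : Fin m) :
    (A * (h : Mat m)⁻¹) i 0 = ((h : Mat m) 0 0)⁻¹ * A i 0 := by
  have h1 : A * (h : Mat m)⁻¹ * (h : Mat m) = A := by
    rw [Matrix.mul_assoc, coe_inv_mul, Matrix.mul_one]
  have h2 : A i 0 = (A * (h : Mat m)⁻¹) i 0 * (h : Mat m) 0 0 := by
    conv_lhs => rw [← h1]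
    rw [Matrix.mul_apply, Finset.sum_eq_single 0]
    · intro j _ hj
      rw [mem_H_iff.1 hh j hj, mul_zero]
    · simp
  rw [h2]
  field_simp [diag_ne_zero hh]

theorem ambFrame_gauge {h : GN m N} (hh : ∀ n, h n ∈ H m) (L : GN m N) (n : ℕ) (i : Fin m) :
    ambFrame (amb (gauge h L)) n i 0 =
      ((h n : Mat m) 0 0)⁻¹ * ((h 0 : Mat m) * ambFrame (amb L) n) i 0 := by
  rw [ambFrame_amb, frame_gauge, coe_mul_eq, coe_inv_eq, mul_inv_apply_zero (hh n), coe_mul_eq,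
    ambFrame_amb]

theorem windowDet_gauge {h : GN m N} (hh : ∀ n, h n ∈ H m) (L : GN m N) (n : ℕ) :
    windowDet (amb (gauge h L)) n =
      (∏ j ∈ Finset.range m, ((h ((n + j : ℕ) : ZMod N) : Mat m) 0 0)⁻¹) * windowDet (amb L) n := by
  have h1 : (Matrix.of fun i j : Fin m => ambFrame (amb (gauge h L)) (n + j) i 0) =
      Matrix.of fun i j : Fin m => ((h ((n + j : ℕ) : ZMod N) : Mat m) 0 0)⁻¹ *
        ((h 0 : Mat m) * Matrix.of fun i j : Fin m => ambFrame (amb L) (n + j) i 0) i j := by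
    ext i j
    rw [Matrix.of_apply, ambFrame_gauge hh, Matrix.of_apply, Matrix.mul_apply, Matrix.mul_apply]
    rfl
  rw [windowDet, h1,
    Matrix.det_mul_row (fun j : Fin m => ((h ((n + j : ℕ) : ZMod N) : Mat m) 0 0)⁻¹),
    Matrix.det_mul, Fin.prod_univ_eq_prod_range
    (fun j => ((h ((n + j : ℕ) : ZMod N) : Mat m) 0 0)⁻¹) m]
  simp [windowDet]

theorem PolygonNondegenerate.gauge {L : GN m N} (hL : PolygonNondegenerate L) {h : GN m N}
    (hh : ∀ n, h n ∈ H m) : PolygonNondegenerate (gauge h L) := by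
  rw [polygonNondegenerate_iff] at *
  intro n
  rw [windowDet_gauge hh]
  exact mul_ne_zero (Finset.prod_ne_zero_iff.2 fun j _ => inv_ne_zero (diag_ne_zero (hh _))) (hL n)

theorem proj_mem_nondegenerate {L : GN m N} :
    proj L ∈ nondegenerate m N ↔ PolygonNondegenerate L := by
  constructor
  · rintro ⟨L', hL', h⟩
    obtain ⟨k, hk, rfl⟩ := proj_eq_iff.1 h
    exact hL'.gauge hk
  · exact fun h => ⟨L, h, rfl⟩

/-- Each window determinant scales by the inverse of `m` consecutive diagonal entries. The weight
thus collects `1 + N * q` consecutive ones: the entry at `n` and a factor common to all vertices. -/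
theorem weight_gauge [NeZero N] {h : GN m N} (hh : ∀ n, h n ∈ H m) (L : GN m N) {r q : ℕ}
    (hr : m * r = 1 + N * q) (n : ℕ) :
    weight r (amb (gauge h L)) n =
      ((h n : Mat m) 0 0 * (∏ s, (h s : Mat m) 0 0) ^ q)⁻¹ * weight r (amb L) n := by
  simp only [weight, windowDet_gauge hh]
  rw [Finset.prod_mul_distrib]
  congr 1
  rw [← prod_range_one_add_mul (fun s => (h s : Mat m) 0 0) n q, ← hr,
    ← prod_range_mul (fun l => (h ((n + l : ℕ) : ZMod N) : Mat m) 0 0),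
    ← Finset.prod_inv_distrib]
  refine Finset.prod_congr rfl fun i _ => ?_
  rw [Finset.prod_inv_distrib]
  simp only [add_assoc]

theorem window_gauge [NeZero N] {h : GN m N} (hh : ∀ n, h n ∈ H m) (L : GN m N) {r q : ℕ}
    (hr : m * r = 1 + N * q) (n : ℕ) :
    window r (amb (gauge h L)) n =
      (∏ s, (h s : Mat m) 0 0) ^ q • ((h 0 : Mat m) * window r (amb L) n) := by
  ext i j
  rw [Matrix.smul_apply, window, Matrix.of_apply, weight_gauge hh L hr, ambFrame_gauge hh,
    Matrix.mul_apply, Matrix.mul_apply]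
  simp only [window, Matrix.of_apply, Finset.mul_sum, smul_eq_mul]
  refine Finset.sum_congr rfl fun k _ => ?_
  have h1 := diag_ne_zero (hh ((n + j : ℕ) : ZMod N))
  rw [mul_inv, inv_inv]
  field_simp

omit [NeZero m] in
theorem inv_smul_of_ne_zero {c : ℝ} (hc : c ≠ 0) (A : Mat m) : (c • A)⁻¹ = c⁻¹ • A⁻¹ := by
  by_cases hA : IsUnit A.det
  · exact Matrix.inv_smul' A (Units.mk0 c hc) hA
  · have hA' : ¬ IsUnit (c • A).det := by
      rw [isUnit_iff_ne_zero, not_not] at hA ⊢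
      rw [Matrix.det_smul, hA, mul_zero]
    rw [Matrix.nonsing_inv_apply_not_isUnit _ hA, Matrix.nonsing_inv_apply_not_isUnit _ hA',
      smul_zero]

omit [NeZero m] in
theorem amb_gauge (h L : GN m N) (s : ZMod N) :
    amb (gauge h L) s = (h (s + 1) : Mat m) * (L s : Mat m) * (h s : Mat m)⁻¹ := by
  rw [amb_apply, gauge, coe_mul_eq, coe_mul_eq, coe_inv_eq]

theorem normalizer_gauge [NeZero N] {h : GN m N} (hh : ∀ n, h n ∈ H m) (L : GN m N) {r q : ℕ}
    (hr : m * r = 1 + N * q) (s : ZMod N) :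
    normalizer r (amb (gauge h L)) s =
      ((∏ s, (h s : Mat m) 0 0) ^ q)⁻¹ • (normalizer r (amb L) s * (h s : Mat m)⁻¹) := by
  have h0 : (∏ s, (h s : Mat m) 0 0) ^ q ≠ 0 :=
    pow_ne_zero _ (Finset.prod_ne_zero_iff.2 fun s _ => diag_ne_zero (hh s))
  have h1 : ambFrame (amb (gauge h L)) s.val =
      (h 0 : Mat m) * ambFrame (amb L) s.val * (h s : Mat m)⁻¹ := by
    rw [ambFrame_amb, frame_gauge, coe_mul_eq, coe_mul_eq, coe_inv_eq, ambFrame_amb,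
      ZMod.natCast_zmod_val]
  rw [normalizer, window_gauge hh L hr, inv_smul_of_ne_zero h0, Matrix.mul_inv_rev, h1, normalizer,
    Matrix.smul_mul]
  congr 1
  have e := coe_inv_mul (h 0)
  calc _ = (window r (amb L) s.val)⁻¹ * ((h 0 : Mat m)⁻¹ * (h 0 : Mat m)) *
        ambFrame (amb L) s.val * (h s : Mat m)⁻¹ := by simp only [Matrix.mul_assoc]
    _ = _ := by rw [e, Matrix.mul_one]

/-- The normal form of a polygon. -/
noncomputable def normalForm (r : ℕ) (X : Amb m N) : Amb m N := fun s =>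
  normalizer r X (s + 1) * X s * (normalizer r X s)⁻¹

/-- The normalizer absorbs `h s` up to a scalar that is the same for all `s`, and this scalar
cancels between its two occurrences. -/
theorem normalForm_gauge [NeZero N] {L : GN m N} {h : GN m N} (hh : ∀ n, h n ∈ H m)
    {r q : ℕ} (hr : m * r = 1 + N * q) :
    normalForm r (amb (gauge h L)) = normalForm r (amb L) := by
  obtain ⟨c, hc, hN⟩ : ∃ c : ℝ, c ≠ 0 ∧ ∀ s, normalizer r (amb (gauge h L)) s =
      c⁻¹ • (normalizer r (amb L) s * (h s : Mat m)⁻¹) :=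
    ⟨_, pow_ne_zero q (Finset.prod_ne_zero_iff.2 fun s _ => diag_ne_zero (hh s)),
      normalizer_gauge hh L hr⟩
  funext s
  simp only [normalForm, hN]
  rw [inv_smul_of_ne_zero (inv_ne_zero hc), inv_inv, Matrix.mul_inv_rev,
    Matrix.nonsing_inv_nonsing_inv _ (by simp), Matrix.smul_mul, Matrix.smul_mul, Matrix.mul_smul,
    smul_smul, inv_mul_cancel₀ hc, one_smul, amb_gauge]
  have e1 := coe_inv_mul (h (s + 1))
  have e2 := coe_inv_mul (h s)
  calc _ = normalizer r (amb L) (s + 1) * ((h (s + 1) : Mat m)⁻¹ * (h (s + 1) : Mat m)) *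
        (L s : Mat m) * ((h s : Mat m)⁻¹ * (h s : Mat m)) * (normalizer r (amb L) s)⁻¹ := by
        simp only [Matrix.mul_assoc]
    _ = _ := by rw [e1, e2, Matrix.mul_one, Matrix.mul_one, amb_apply]

/-! ### Smoothness -/

section Smooth

variable [NeZero N] {L : GN m N}

theorem contDiffAt_windowDet (L : GN m N) (n : ℕ) :
    ContDiffAt ℝ ∞ (fun X : Amb m N => windowDet X n) (amb L) :=
  contDiffAt_matrix_det (contDiffAt_matrix.2 fun i _ =>
    contDiffAt_matrix.1 (contDiffAt_ambFrame L _) i 0)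

theorem contDiffAt_window (hL : PolygonNondegenerate L) (r n : ℕ) :
    ContDiffAt ℝ ∞ (fun X : Amb m N => window r X n) (amb L) := by
  refine contDiffAt_matrix.2 fun i j => ?_
  simp only [window, Matrix.of_apply]
  refine ContDiffAt.mul (ContDiffAt.inv ?_ (weight_ne_zero hL r _))
    (contDiffAt_matrix.1 (contDiffAt_ambFrame L _) i 0)
  exact contDiffAt_prod fun k _ => contDiffAt_windowDet L _

theorem contDiffAt_normalizer (hL : PolygonNondegenerate L) {r q : ℕ} (hr : m * r = 1 + N * q)
    (s : ZMod N) : ContDiffAt ℝ ∞ (fun X : Amb m N => normalizer r X s) (amb L) := by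
  refine contDiffAt_matrix_mul (contDiffAt_matrix_inv (contDiffAt_window hL r _) ?_)
    (contDiffAt_ambFrame L _)
  rw [det_window hL hr]
  exact inv_ne_zero (window_prod_ne_zero hL q)

theorem contDiffAt_normalForm (hL : PolygonNondegenerate L) {r q : ℕ} (hr : m * r = 1 + N * q) :
    ContDiffAt ℝ ∞ (normalForm r : Amb m N → Amb m N) (amb L) := by
  refine contDiffAt_pi.2 fun s => ?_
  refine contDiffAt_matrix_mul (contDiffAt_matrix_mul (contDiffAt_normalizer hL hr _)
    (contDiffAt_pi.1 contDiffAt_id s)) (contDiffAt_matrix_inv (contDiffAt_normalizer hL hr _) ?_)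
  exact det_normalizer_ne_zero hL hr s

/-- By periodicity only finitely many window determinants have to remain nonzero. -/
theorem eventually_polygonNondegenerate (hL : PolygonNondegenerate L) :
    ∀ᶠ L' in 𝓝 L, PolygonNondegenerate L' := by
  have h1 : ∀ n : ℕ, ∀ᶠ L' in 𝓝 L, windowDet (amb L') n ≠ 0 := fun n =>
    (ContinuousAt.comp (f := amb) (contDiffAt_windowDet L n).continuousAt
      continuous_amb.continuousAt).eventually_ne (polygonNondegenerate_iff.1 hL n)
  have h2 : ∀ᶠ L' in 𝓝 L, ∀ s : ZMod N, windowDet (amb L') s.val ≠ 0 :=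
    Filter.eventually_all.2 fun s => h1 s.val
  filter_upwards [h2] with L' h3
  rw [polygonNondegenerate_iff]
  intro n
  rw [← windowDet_val]
  exact h3 n

end Smooth

/-- A local section of `G^N → G^N / H^N` near `L₀`. The map `sec` is invariant and defined for all
nondegenerate polygons; near `L₀` it is the gauge transformation by `nor`. -/
structure LocalSection [NeZero N] (L₀ : GN m N) where
  /-- the section, as an invariant map -/
  sec : Amb m N → Amb m N
  /-- the gauge transformation onto the image of the section -/
  nor : Amb m N → Amb m N
  /-- the domain on which `nor` is a gauge transformation -/
  dom : Set (GN m N)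
  isOpen_dom : IsOpen dom
  mem_dom : L₀ ∈ dom
  nondeg : ∀ L ∈ dom, PolygonNondegenerate L
  contDiffAt_sec : ∀ L, PolygonNondegenerate L → ContDiffAt ℝ ∞ sec (amb L)
  sec_mem : ∀ L, PolygonNondegenerate L → ∃ L', sec (amb L) = amb L'
  sec_gauge : ∀ h L : GN m N, (∀ n, h n ∈ H m) → sec (amb (gauge h L)) = sec (amb L)
  contDiffAt_nor : ∀ L ∈ dom, ContDiffAt ℝ ∞ nor (amb L)
  nor_spec : ∀ L ∈ dom, ∃ κ : GN m N, (∀ n, κ n ∈ H m) ∧ amb κ = nor (amb L) ∧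
    amb (gauge κ L) = sec (amb L)
  sec_base : sec (amb L₀) = amb L₀

/-- The section is the normal form, conjugated by the fixed normalizer `P` of `L₀` so that `L₀` is
fixed. It has determinant one because determinants of normalizers do not depend on the index. The
scalar needed to put the gauge transformation itself into `SL` cancels in the section, so only `nor`
needs the smaller domain. -/
theorem nonempty_localSection [NeZero N] (hm : 1 ≤ m) (hmN : Nat.Coprime m N) {L₀ : GN m N}
    (hL₀ : PolygonNondegenerate L₀) : Nonempty (LocalSection L₀) := by
  obtain ⟨r, q, hr⟩ := exists_mul_eq_one_add hm hmN
  let P : ZMod N → Mat m := fun s => normalizer r (amb L₀) s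
  have hP : ∀ s, (P s).det ≠ 0 := det_normalizer_ne_zero hL₀ hr
  have hPu : ∀ s, IsUnit (P s).det := fun s => isUnit_iff_ne_zero.2 (hP s)
  let δ : Amb m N → ℝ := fun X => (normalizer r X 0).det / (P 0).det
  -- An `m`-th root normalizes the determinant; it is smooth where the ratio `δ` is positive, which
  -- holds near `L₀`, where `δ = 1`.
  let ρ : Amb m N → ℝ := fun X => (δ X) ^ (-(1 / (m : ℝ)))
  let nor : Amb m N → Amb m N := fun X s => ρ X • ((P s)⁻¹ * normalizer r X s)
  let sec : Amb m N → Amb m N := fun X s => (P (s + 1))⁻¹ * normalForm r X s * P s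
  have hδs : ∀ L : GN m N, PolygonNondegenerate L → ContDiffAt ℝ ∞ δ (amb L) := fun L hL =>
    (contDiffAt_matrix_det (contDiffAt_normalizer hL hr 0)).div_const _
  have hev : ∀ᶠ L in 𝓝 L₀, PolygonNondegenerate L ∧ 0 < δ (amb L) := by
    refine (eventually_polygonNondegenerate hL₀).and ?_
    refine (ContinuousAt.comp (f := amb) (hδs L₀ hL₀).continuousAt
      continuous_amb.continuousAt).eventually_const_lt (u := 0) ?_
    exact one_pos.trans_eq (div_self (hP 0)).symm
  obtain ⟨Ω, hΩ, hΩo, hmem⟩ := mem_nhds_iff.1 hev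
  have hm0 : (m : ℝ) ≠ 0 := by positivity
  have hPpar : ∀ s, IsParabolic (P s)⁻¹ := by
    intro s i hi
    have h1 : IsParabolic (P s) := isParabolic_normalizer hL₀ hr s
    have h2 : ((P s)⁻¹ * P s) i 0 = (P s)⁻¹ i 0 * P s 0 0 := by
      rw [Matrix.mul_apply, Finset.sum_eq_single 0]
      · intro j _ hj
        rw [h1 j hj, mul_zero]
      · simp
    have h3 : (P s) 0 0 ≠ 0 := by
      intro h0
      refine hP s (Matrix.det_eq_zero_of_column_eq_zero 0 fun j => ?_)
      by_cases hj : j = 0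
      · rw [hj, h0]
      · exact h1 j hj
    rw [Matrix.nonsing_inv_mul _ (hPu s), Matrix.one_apply_ne hi] at h2
    exact (mul_eq_zero.1 h2.symm).resolve_right h3
  refine ⟨⟨sec, nor, Ω, hΩo, hmem, fun L hL => (hΩ hL).1, fun L hL => ?_, fun L hL => ?_,
    fun h L hh => ?_, fun L hL => ?_, fun L hL => ?_, ?_⟩⟩
  · refine contDiffAt_pi.2 fun s => ?_
    exact contDiffAt_matrix_mul (contDiffAt_matrix_mul contDiffAt_const
      (contDiffAt_pi.1 (contDiffAt_normalForm hL hr) s)) contDiffAt_const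
  · have hdet : ∀ s, (sec (amb L) s).det = 1 := by
      intro s
      simp only [sec, normalForm, P]
      have h1 := window_prod_ne_zero hL q
      have h2 := window_prod_ne_zero hL₀ q
      simp only [Matrix.det_mul, Matrix.det_nonsing_inv, Ring.inverse_eq_inv',
        det_normalizer hL hr, det_normalizer hL₀ hr, amb_apply]
      field_simp
      exact (L s).2
    exact ⟨fun s => ⟨_, hdet s⟩, rfl⟩
  · simp only [sec, normalForm_gauge hh hr]
  · obtain ⟨h1, h2⟩ := hΩ hL
    have hρ : ContDiffAt ℝ ∞ ρ (amb L) := (hδs L h1).rpow_const_of_ne h2.ne'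
    refine contDiffAt_pi.2 fun s => contDiffAt_matrix.2 fun i j => ?_
    exact hρ.mul (contDiffAt_matrix.1 (contDiffAt_matrix_mul (contDiffAt_const (c := (P s)⁻¹))
      (contDiffAt_normalizer h1 hr s)) i j)
  · obtain ⟨h1, h2⟩ := hΩ hL
    have hdet : ∀ s, (nor (amb L) s).det = 1 := by
      intro s
      simp only [nor]
      rw [Matrix.det_smul, Fintype.card_fin, Matrix.det_mul, Matrix.det_nonsing_inv,
        Ring.inverse_eq_inv']
      have e1 : (P s).det = (P 0).det := by
        simp only [P, det_normalizer hL₀ hr]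
      have e2 : (normalizer r (amb L) s).det = (normalizer r (amb L) 0).det := by
        simp only [det_normalizer h1 hr]
      have e3 : (P s).det⁻¹ * (normalizer r (amb L) s).det = δ (amb L) := by
        rw [e1, e2, inv_mul_eq_div]
      rw [e3]
      simp only [ρ]
      rw [← Real.rpow_natCast, ← Real.rpow_mul h2.le, neg_mul, one_div_mul_cancel hm0,
        Real.rpow_neg_one, inv_mul_cancel₀ h2.ne']
    refine ⟨fun s => ⟨nor (amb L) s, hdet s⟩, fun s => ?_, rfl, ?_⟩
    · exact mem_H_iff.2 (((hPpar s).mul (isParabolic_normalizer h1 hr s)).smul _)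
    · funext s
      have hρ : ρ (amb L) ≠ 0 := (Real.rpow_pos_of_pos h2 _).ne'
      have e2 : (nor (amb L) s)⁻¹ = (ρ (amb L))⁻¹ • ((normalizer r (amb L) s)⁻¹ * P s) := by
        refine Matrix.inv_eq_left_inv ?_
        simp only [nor]
        rw [Matrix.smul_mul, Matrix.mul_smul, smul_smul, inv_mul_cancel₀ hρ, one_smul]
        have u1 := Matrix.mul_nonsing_inv _ (hPu s)
        have u2 := Matrix.nonsing_inv_mul _
          (isUnit_iff_ne_zero.2 (det_normalizer_ne_zero h1 hr s))
        calc _ = (normalizer r (amb L) s)⁻¹ * (P s * (P s)⁻¹) * normalizer r (amb L) s := by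
              simp only [Matrix.mul_assoc]
          _ = 1 := by rw [u1, Matrix.mul_one, u2]
      refine (amb_gauge _ L s).trans ?_
      change nor (amb L) (s + 1) * (L s : Mat m) * (nor (amb L) s)⁻¹ = _
      rw [e2]
      simp only [nor, sec, normalForm]
      rw [Matrix.smul_mul, Matrix.smul_mul, Matrix.mul_smul, smul_smul, mul_inv_cancel₀ hρ,
        one_smul, amb_apply]
      simp only [Matrix.mul_assoc]
  · funext s
    simp only [sec, normalForm]
    have u1 := Matrix.nonsing_inv_mul _ (hPu (s + 1))
    have u2 := Matrix.nonsing_inv_mul _ (hPu s)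
    calc _ = ((P (s + 1))⁻¹ * P (s + 1)) * amb L₀ s * ((P s)⁻¹ * P s) := by
          simp only [Matrix.mul_assoc, P]
      _ = _ := by rw [u1, u2, Matrix.one_mul, Matrix.mul_one]

end TwistedGon

/-! ### Lax equations preserve conjugacy classes. -/

namespace TwistedGon

open Matrix Topology
open scoped ContDiff Matrix.Norms.Elementwise

variable {m N : ℕ}

/-! ### Normalization of matrices of positive determinant -/

open Classical in
/-- The multiple of determinant one of a matrix of positive determinant. -/
noncomputable def toSL (X : Mat m) : G m :=
  if h : ((X.det) ^ (-(1 / (m : ℝ))) • X).det = 1 then ⟨_, h⟩ else 1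

theorem coe_toSL (hm : m ≠ 0) {X : Mat m} (hX : 0 < X.det) :
    (toSL X : Mat m) = (X.det) ^ (-(1 / (m : ℝ))) • X := by
  have h : ((X.det) ^ (-(1 / (m : ℝ))) • X).det = 1 := by
    have hm0 : (m : ℝ) ≠ 0 := by positivity
    rw [Matrix.det_smul, Fintype.card_fin, ← Real.rpow_natCast, ← Real.rpow_mul hX.le, neg_mul,
      one_div_mul_cancel hm0, Real.rpow_neg_one, inv_mul_cancel₀ hX.ne']
  exact congrArg Subtype.val (dif_pos h : toSL X = _)

/-- Positivity of the determinant allows the intertwining matrix to be rescaled into `SL`, which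
does not affect the conjugation. -/
theorem isConj_of_mul_eq (hm : m ≠ 0) {A B : G m} {X : Mat m} (hX : 0 < X.det)
    (h : X * (A : Mat m) = (B : Mat m) * X) : IsConj A B := by
  refine isConj_iff.2 ⟨toSL X, ?_⟩
  rw [mul_inv_eq_iff_eq_mul]
  apply Subtype.ext
  change ((toSL X * A : G m) : Mat m) = ((B * toSL X : G m) : Mat m)
  rw [coe_mul_eq, coe_mul_eq, coe_toSL hm hX, Matrix.smul_mul, Matrix.mul_smul, h]

/-! ### Lax equations -/

/-- Left multiplication, as a continuous linear map. -/
noncomputable def mulLeftL (m : ℕ) : Mat m →L[ℝ] Mat m →L[ℝ] Mat m :=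
  LinearMap.toContinuousLinearMap
    ((LinearMap.toContinuousLinearMap : (Mat m →ₗ[ℝ] Mat m) ≃ₗ[ℝ] (Mat m →L[ℝ] Mat m)).toLinearMap
      ∘ₗ LinearMap.mul ℝ (Mat m))

/-- Local existence for linear differential equations. -/
theorem exists_linear_ode {E : Type*} [NormedAddCommGroup E] [NormedSpace ℝ E] [CompleteSpace E]
    {a b t₀ : ℝ} (ht₀ : t₀ ∈ Set.Icc a b) {A : ℝ → E →L[ℝ] E}
    (hA : ContinuousOn A (Set.Icc a b)) (x₀ : E) :
    ∃ δ > 0, ∃ u : ℝ → E, u t₀ = x₀ ∧ ∀ t ∈ Set.Icc (max a (t₀ - δ)) (min b (t₀ + δ)),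
      HasDerivWithinAt u (A t (u t)) (Set.Icc (max a (t₀ - δ)) (min b (t₀ + δ))) t := by
  obtain ⟨M, hM⟩ := isCompact_Icc.exists_bound_of_continuousOn hA
  have hM0 : 0 ≤ M := (norm_nonneg _).trans (hM t₀ ht₀)
  set C : ℝ := M * (‖x₀‖ + 1) with hC
  have hC0 : 0 ≤ C := by positivity
  -- `C` bounds the speed on the unit ball around `x₀`. A solution therefore cannot leave this ball
  -- within a time `1 / (C + 1)`.
  refine ⟨1 / (C + 1), by positivity, ?_⟩
  set δ : ℝ := 1 / (C + 1) with hδ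
  have hδ0 : 0 < δ := by positivity
  have hsub : Set.Icc (max a (t₀ - δ)) (min b (t₀ + δ)) ⊆ Set.Icc a b :=
    Set.Icc_subset_Icc (le_max_left _ _) (min_le_left _ _)
  have hmem : t₀ ∈ Set.Icc (max a (t₀ - δ)) (min b (t₀ + δ)) :=
    ⟨max_le ht₀.1 (by linarith), le_min ht₀.2 (by linarith)⟩
  have hpl : IsPicardLindelof (fun t x => A t x) (⟨t₀, hmem⟩ :
      Set.Icc (max a (t₀ - δ)) (min b (t₀ + δ))) x₀ 1 0 ⟨C, hC0⟩ ⟨M, hM0⟩ := by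
    refine ⟨fun t ht => ?_, fun x _ => ?_, fun t ht x hx => ?_, ?_⟩
    · exact ((A t).lipschitz.weaken (hM t (hsub ht))).lipschitzOnWith
    · exact (hA.mono hsub).clm_apply continuousOn_const
    · have h1 : ‖x‖ ≤ ‖x₀‖ + 1 := by
        have := mem_closedBall_iff_norm.1 hx
        have h2 := norm_le_insert' x x₀
        simp only [NNReal.coe_one] at this
        linarith
      exact ((A t).le_opNorm x).trans (mul_le_mul (hM t (hsub ht)) h1 (norm_nonneg _) hM0)
    · have h1 : max (min b (t₀ + δ) - t₀) (t₀ - max a (t₀ - δ)) ≤ δ := by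
        refine max_le ?_ ?_
        · linarith [min_le_right b (t₀ + δ)]
        · linarith [le_max_right a (t₀ - δ)]
      have h2 : C * δ ≤ 1 := by
        rw [hδ, mul_one_div, div_le_one (by positivity)]
        linarith
      simp only [NNReal.coe_one, NNReal.coe_zero, sub_zero]
      exact (mul_le_mul_of_nonneg_left h1 hC0).trans h2
  exact hpl.exists_eq_forall_mem_Icc_hasDerivWithinAt₀

/-- Solutions of a Lax equation stay locally in one conjugacy class. -/
theorem eventually_conj_of_lax {a b t₀ : ℝ} (ht₀ : t₀ ∈ Set.Icc a b) {T β : ℝ → Mat m}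
    (h : ∀ᶠ t in 𝓝[Set.Icc a b] t₀, HasDerivWithinAt T (β t * T t - T t * β t) (Set.Icc a b) t ∧
      ContinuousWithinAt β (Set.Icc a b) t) :
    ∀ᶠ t in 𝓝[Set.Icc a b] t₀, ∃ X : Mat m, 0 < X.det ∧ X * T t₀ = T t * X := by
  obtain ⟨ε, hε, hball⟩ := Metric.mem_nhdsWithin_iff.1 h
  set a' := max a (t₀ - ε / 2)
  set b' := min b (t₀ + ε / 2)
  have hsub : Set.Icc a' b' ⊆ Set.Icc a b :=
    Set.Icc_subset_Icc (le_max_left _ _) (min_le_left _ _)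
  have hP : ∀ t ∈ Set.Icc a' b', HasDerivWithinAt T (β t * T t - T t * β t) (Set.Icc a b) t ∧
      ContinuousWithinAt β (Set.Icc a b) t := fun t ht => by
    refine hball ⟨?_, hsub ht⟩
    rw [Metric.mem_ball, Real.dist_eq, abs_lt]
    have h1 := (le_max_right a (t₀ - ε / 2)).trans ht.1
    have h2 := ht.2.trans (min_le_right b (t₀ + ε / 2))
    constructor <;> linarith
  have ht₀' : t₀ ∈ Set.Icc a' b' :=
    ⟨max_le ht₀.1 (by linarith), le_min ht₀.2 (by linarith)⟩
  have hA : ContinuousOn (fun t => mulLeftL m (β t)) (Set.Icc a' b') := fun t ht =>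
    (mulLeftL m).continuous.continuousAt.comp_continuousWithinAt ((hP t ht).2.mono hsub)
  -- The conjugating matrix solves `u' = β u` with `u t₀ = 1`; then `u⁻¹ T u` is constant as long as
  -- `u` is invertible.
  obtain ⟨δ, hδ, u, hu0, hu⟩ := exists_linear_ode ht₀' hA 1
  set J := Set.Icc (max a' (t₀ - δ)) (min b' (t₀ + δ)) with hJ
  have hJsub : J ⊆ Set.Icc a' b' := Set.Icc_subset_Icc (le_max_left _ _) (min_le_left _ _)
  have ht₀J : t₀ ∈ J := ⟨max_le ht₀'.1 (by linarith), le_min ht₀'.2 (by linarith)⟩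
  have hJn : J ∈ 𝓝[Set.Icc a b] t₀ := by
    rw [Metric.mem_nhdsWithin_iff]
    refine ⟨min δ (ε / 2), by positivity, ?_⟩
    rintro t ⟨h1, h2⟩
    rw [Metric.mem_ball, Real.dist_eq, lt_min_iff, abs_lt, abs_lt] at h1
    refine ⟨max_le (max_le h2.1 (by linarith)) (by linarith),
      le_min (le_min h2.2 (by linarith)) (by linarith)⟩
  have hcu : ContinuousWithinAt (fun t => (u t).det) J t₀ := by
    have h1 : ContinuousAt (fun A : Mat m => A.det) (u t₀) := by fun_prop
    exact h1.comp_continuousWithinAt (f := u) (hu t₀ ht₀J).continuousWithinAt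
  have hpos : ∀ᶠ t in 𝓝[J] t₀, 0 < (u t).det := by
    refine hcu.eventually_const_lt ?_
    simp only [hu0, Matrix.det_one]
    exact one_pos
  obtain ⟨η, hη, hηball⟩ := Metric.mem_nhdsWithin_iff.1 hpos
  have hconv : Convex ℝ (Metric.ball t₀ η ∩ J) := (convex_ball t₀ η).inter (convex_Icc _ _)
  have hder : ∀ t ∈ Metric.ball t₀ η ∩ J,
      HasDerivWithinAt (fun t => (u t)⁻¹ * T t * u t) 0 (Metric.ball t₀ η ∩ J) t := by
    intro t ht
    have hdet : (u t).det ≠ 0 := (hηball ht).ne'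
    have hun : IsUnit (u t).det := isUnit_iff_ne_zero.2 hdet
    have h1 : HasDerivWithinAt u (β t * u t) (Metric.ball t₀ η ∩ J) t :=
      (hu t ht.2).mono Set.inter_subset_right
    have h2 := (hP t (hJsub ht.2)).1.mono
      ((Set.inter_subset_right (s := Metric.ball t₀ η)).trans (hJsub.trans hsub))
    refine (hasDerivWithinAt_matrix_mul (hasDerivWithinAt_matrix_mul
      (hasDerivWithinAt_matrix_inv h1 hdet) h2) h1).congr_deriv ?_
    have e1 := Matrix.mul_nonsing_inv _ hun
    have e2 : (u t)⁻¹ * (β t * u t) * (u t)⁻¹ = (u t)⁻¹ * β t := by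
      calc _ = (u t)⁻¹ * β t * (u t * (u t)⁻¹) := by simp only [Matrix.mul_assoc]
        _ = _ := by rw [e1, Matrix.mul_one]
    rw [e2]
    simp only [Matrix.mul_sub, Matrix.neg_mul, Matrix.mul_assoc, Matrix.sub_mul, Matrix.add_mul]
    abel
  have hev : ∀ᶠ t in 𝓝[Set.Icc a b] t₀, t ∈ Metric.ball t₀ η ∩ J :=
    Filter.inter_mem (mem_nhdsWithin_of_mem_nhds (Metric.ball_mem_nhds t₀ hη)) hJn
  filter_upwards [hev] with t ht
  have hdet : 0 < (u t).det := hηball ht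
  refine ⟨u t, hdet, ?_⟩
  have h1 := hconv.norm_image_sub_le_of_norm_hasDerivWithin_le hder
    (C := 0) (fun _ _ => by simp) ⟨Metric.mem_ball_self hη, ht₀J⟩ ht
  rw [zero_mul, norm_le_zero_iff, sub_eq_zero, hu0] at h1
  rw [inv_one, Matrix.one_mul, Matrix.mul_one] at h1
  rw [← h1, Matrix.mul_assoc, Matrix.mul_nonsing_inv_cancel_left _ _ (isUnit_iff_ne_zero.2 hdet.ne')]

end TwistedGon

namespace TwistedGon

open Matrix Topology
open scoped ContDiff Matrix.Norms.Elementwise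

variable {m N : ℕ} [NeZero m]

/-! ### The quotient topology -/

theorem continuous_proj : Continuous (proj : GN m N → Moduli m N) := continuous_coinduced_rng

theorem proj_surjective : Function.Surjective (proj : GN m N → Moduli m N) :=
  Quotient.mk_surjective

omit [NeZero m] in
theorem continuous_gauge (h : GN m N) : Continuous (gauge h : GN m N → GN m N) :=
  continuous_pi fun n => (continuous_const.mul (continuous_apply n)).mul continuous_const

/-- The saturation of an open set is the union of its preimages under gauge transformations, each of
which is continuous. -/
theorem isOpenMap_proj : IsOpenMap (proj : GN m N → Moduli m N) := by
  intro O hO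
  have h1 : proj ⁻¹' (proj '' O) =
      ⋃ h : {h : GN m N // ∀ n, h n ∈ H m}, (gauge h.1 : GN m N → GN m N) ⁻¹' O := by
    ext L
    simp only [Set.mem_preimage, Set.mem_image, Set.mem_iUnion]
    constructor
    · rintro ⟨L', hL', h⟩
      obtain ⟨k, hk, rfl⟩ := proj_eq_iff.1 h.symm
      exact ⟨⟨k, hk⟩, hL'⟩
    · rintro ⟨⟨k, hk⟩, h⟩
      exact ⟨_, h, proj_gauge hk L⟩
  change IsOpen (proj ⁻¹' (proj '' O))
  rw [h1]
  exact isOpen_iUnion fun h => hO.preimage (continuous_gauge h.1)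

variable [NeZero N] {L₀ : GN m N}

/-- The section as a map on the quotient. -/
noncomputable def LocalSection.onQuot (S : LocalSection L₀) (q : Moduli m N) : Amb m N :=
  S.sec (amb (Quotient.out (s := gaugeSetoid m N) q))

theorem LocalSection.onQuot_proj (S : LocalSection L₀) (L : GN m N) :
    S.onQuot (proj L) = S.sec (amb L) := by
  have h1 : proj (Quotient.out (s := gaugeSetoid m N) (proj L)) = proj L :=
    Quotient.out_eq (s := gaugeSetoid m N) (proj L)
  obtain ⟨h, hh, h2⟩ := proj_eq_iff.1 h1.symm
  rw [LocalSection.onQuot, h2, S.sec_gauge h L hh]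

/-- This is the source of functions on the quotient: test functions reading off the monodromy, and
Hamiltonians. -/
theorem LocalSection.smoothOn_comp (S : LocalSection L₀) {U : Set (Moduli m N)}
    (hU : U ⊆ nondegenerate m N) {φ : Amb m N → ℝ}
    (hφ : ∀ L, proj L ∈ U → ContDiffAt ℝ ∞ φ (S.sec (amb L))) :
    SmoothOn (fun q => φ (S.onQuot q)) U := by
  intro L hL
  refine ⟨fun X => φ (S.sec X), ?_, Filter.Eventually.of_forall fun L' => ?_⟩
  · exact (hφ L hL).comp _ (S.contDiffAt_sec L (proj_mem_nondegenerate.1 (hU hL)))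
  · simp only [S.onQuot_proj]
    rfl

theorem LocalSection.continuousAt_onQuot (S : LocalSection L₀) {q : Moduli m N}
    (hq : q ∈ nondegenerate m N) : ContinuousAt S.onQuot q := by
  obtain ⟨L, rfl⟩ := proj_surjective q
  have h1 : ContinuousAt (fun L' : GN m N => S.sec (amb L')) L :=
    ContinuousAt.comp (f := amb)
      (S.contDiffAt_sec L (proj_mem_nondegenerate.1 hq)).continuousAt continuous_amb.continuousAt
  refine Filter.Tendsto.mono_left ?_ (isOpenMap_proj.nhds_le L)
  rw [S.onQuot_proj, Filter.tendsto_map'_iff]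
  have h2 : S.onQuot ∘ proj = fun L' : GN m N => S.sec (amb L') := funext S.onQuot_proj
  rw [h2]
  exact h1

/-- Continuous local lifts of points of the quotient. -/
theorem LocalSection.exists_lift (S : LocalSection L₀) :
    ∃ (O : Set (Moduli m N)) (lift : Moduli m N → GN m N), IsOpen O ∧ proj L₀ ∈ O ∧
      ContinuousOn lift O ∧ lift (proj L₀) = L₀ ∧
      ∀ q ∈ O, proj (lift q) = q ∧ lift q ∈ S.dom ∧ amb (lift q) = S.onQuot q := by
  have h1 : ∀ q : Moduli m N, ∃ ℓ : GN m N, q ∈ proj '' S.dom → proj ℓ = q ∧ amb ℓ = S.onQuot q := by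
    intro q
    by_cases hq : q ∈ proj '' S.dom
    · obtain ⟨L, hL, rfl⟩ := hq
      obtain ⟨κ, hκ, -, h2⟩ := S.nor_spec L hL
      exact ⟨gauge κ L, fun _ => ⟨proj_gauge hκ L, by rw [h2, S.onQuot_proj]⟩⟩
    · exact ⟨L₀, fun h => absurd h hq⟩
  choose lift hlift using h1
  have hO1 : IsOpen (proj '' S.dom : Set (Moduli m N)) := isOpenMap_proj _ S.isOpen_dom
  have hc : ContinuousOn lift (proj '' S.dom) := by
    intro q hq
    rw [isInducing_amb.continuousWithinAt_iff]
    have hqn : q ∈ nondegenerate m N := by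
      obtain ⟨L, hL, rfl⟩ := hq
      exact proj_mem_nondegenerate.2 (S.nondeg L hL)
    exact (S.continuousAt_onQuot hqn).continuousWithinAt.congr
      (fun y hy => (hlift y hy).2) (hlift q hq).2
  have h0 : proj L₀ ∈ (proj '' S.dom : Set (Moduli m N)) := ⟨L₀, S.mem_dom, rfl⟩
  have hl0 : lift (proj L₀) = L₀ := amb_injective (by
    rw [(hlift _ h0).2, S.onQuot_proj, S.sec_base])
  refine ⟨proj '' S.dom ∩ lift ⁻¹' S.dom, lift, hc.isOpen_inter_preimage hO1 S.isOpen_dom,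
    ⟨h0, by rw [Set.mem_preimage, hl0]; exact S.mem_dom⟩, hc.mono Set.inter_subset_left, hl0, ?_⟩
  rintro q ⟨hq1, hq2⟩
  exact ⟨(hlift q hq1).1, hq2, (hlift q hq1).2⟩

/-! ### Hamiltonian trajectories preserve the class of the monodromy -/

/-- The infinitesimal gauge transformation induced by a Hamiltonian. -/
noncomputable def hamGauge (h : Moduli m N → ℝ) (L : GN m N) : ZMod N → 𝔤 m :=
  fun n => leftGrad (fun L' => h (proj L')) L (n - 1)

/-- The infinitesimal conjugation of the monodromy along a Hamiltonian trajectory. -/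
noncomputable def LocalSection.laxField (S : LocalSection L₀) (h : Moduli m N → ℝ) (L : GN m N) :
    Mat m :=
  (fderiv ℝ (fun X => S.nor X 0) (amb L) (tangent (gaugeField (hamGauge h L) L) L) +
    S.nor (amb L) 0 * (hamGauge h L 0 : Mat m)) * (S.nor (amb L) 0)⁻¹

theorem LocalSection.det_nor (S : LocalSection L₀) {L : GN m N} (hL : L ∈ S.dom) (s : ZMod N) :
    (S.nor (amb L) s).det = 1 := by
  obtain ⟨κ, -, h, -⟩ := S.nor_spec L hL
  rw [← h]
  exact (κ s).2

omit [NeZero m] in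
theorem continuousAt_matrix_mul {X : Type*} [TopologicalSpace X] {f g : X → Mat m} {x : X}
    (hf : ContinuousAt f x) (hg : ContinuousAt g x) : ContinuousAt (fun y => f y * g y) x := by
  have h : Continuous fun p : Mat m × Mat m => p.1 * p.2 := continuous_fst.matrix_mul continuous_snd
  exact ContinuousAt.comp (f := fun y => (f y, g y)) h.continuousAt (hf.prodMk hg)

theorem LocalSection.continuousAt_laxField (S : LocalSection L₀) {h : Moduli m N → ℝ}
    {U : Set (Moduli m N)} (hh : SmoothOn h U) {L : GN m N} (hL : L ∈ S.dom) (hU : proj L ∈ U) :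
    ContinuousAt (S.laxField h) L := by
  have hn : ContDiffAt ℝ ∞ (fun X => S.nor X 0) (amb L) :=
    contDiffAt_pi.1 (S.contDiffAt_nor L hL) 0
  have hn1 : ContDiffAt ℝ 1 (fun X => S.nor X 0) (amb L) := hn.of_le (by exact_mod_cast le_top)
  have hg : ∀ n, ContinuousAt (fun L' => (hamGauge h L' n : Mat m)) L := fun n =>
    (hh L hU).continuousAt_leftGrad (n - 1)
  have ha : ∀ n, ContinuousAt (fun L' : GN m N => (L' n : Mat m)) L := fun n =>
    ((continuous_apply n).comp continuous_amb).continuousAt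
  have hai : ∀ n, ContinuousAt (fun L' : GN m N => (L' n : Mat m)⁻¹) L := fun n => by
    have h1 : ContinuousAt (fun A : Mat m => A⁻¹) (L n : Mat m) :=
      (contDiffAt_matrix_inv (k := 0) contDiffAt_id (by simp)).continuousAt
    exact ContinuousAt.comp (f := fun L' : GN m N => (L' n : Mat m)) h1 (ha n)
  have hfd : ContinuousAt (fun L' => fderiv ℝ (fun X => S.nor X 0) (amb L')) L :=
    ContinuousAt.comp (f := amb) (hn1.continuousAt_fderiv one_ne_zero) continuous_amb.continuousAt
  have ht : ContinuousAt (fun L' => tangent (gaugeField (hamGauge h L') L') L') L := by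
    refine continuousAt_pi.2 fun n => ?_
    exact continuousAt_matrix_mul ((hg (n + 1)).sub
      (continuousAt_matrix_mul (continuousAt_matrix_mul (ha n) (hg n)) (hai n))) (ha n)
  have hk : ContinuousAt (fun L' : GN m N => S.nor (amb L') 0) L :=
    ContinuousAt.comp (f := amb) hn.continuousAt continuous_amb.continuousAt
  have hki : ContinuousAt (fun L' : GN m N => (S.nor (amb L') 0)⁻¹) L :=
    ContinuousAt.comp (f := amb)
      (contDiffAt_matrix_inv hn (by rw [S.det_nor hL]; exact one_ne_zero)).continuousAt
      continuous_amb.continuousAt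
  exact continuousAt_matrix_mul ((hfd.clm_apply ht).add (continuousAt_matrix_mul hk (hg 0))) hki

/-- The bracket differentiates along the gauge curve of `hamGauge h L`. Bringing this curve back to
the section conjugates the monodromy by `Q ε = nor₀ · exp (ε ξ₀)`, and the commutator comes from the
logarithmic derivative of `Q` at zero. -/
theorem LocalSection.reducedBracket_monodromy (S : LocalSection L₀) {h : Moduli m N → ℝ}
    {U : Set (Moduli m N)} (hh : SmoothOn h U) {L : GN m N} (hL : L ∈ S.dom)
    (hLS : S.sec (amb L) = amb L) (hU : proj L ∈ U) (i j : Fin m)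
    (hf : SmoothOn (fun q => ambFrame (S.onQuot q) N i j) U) :
    reducedBracket (fun q => ambFrame (S.onQuot q) N i j) h (proj L) =
      (S.laxField h L * ambFrame (amb L) N - ambFrame (amb L) N * S.laxField h L) i j := by
  set ξ := hamGauge h L with hξ
  refine ((reducedBracket_proj hf hh hU).trans (twistedBracket_eq
    (isGaugeInvariant_comp_proj fun q => ambFrame (S.onQuot q) N i j)
    (isGaugeInvariant_comp_proj _) (hf L hU) (hh L hU))).trans ?_
  change pairing _ (gaugeField ξ L) = _
  have hder := hasDerivWithinAt_gauge (hasDerivWithinAt_expG ξ) L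
  have h0 : gauge (fun n => expG ((0 : ℝ) • ξ n)) L = L := by
    simp only [zero_smul, expG_zero, gauge_one]
  rw [h0] at hder
  have h1 := (hf L hU).comp h0 hder
  -- the conjugating matrix along the curve
  let Q : ℝ → Mat m := fun ε =>
    S.nor (amb (gauge (fun n => expG (ε • ξ n)) L)) 0 * (expG (ε • ξ 0) : Mat m)
  have hQ0 : Q 0 = S.nor (amb L) 0 := by
    simp only [Q]
    rw [h0, zero_smul, expG_zero]
    exact Matrix.mul_one _
  have hQdet : (Q 0).det ≠ 0 := by
    rw [hQ0, S.det_nor hL]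
    exact one_ne_zero
  have hQ : HasDerivWithinAt Q (fderiv ℝ (fun X => S.nor X 0) (amb L)
      (tangent (gaugeField ξ L) L) + S.nor (amb L) 0 * (ξ 0 : Mat m)) Set.univ 0 := by
    have hn : HasFDerivAt (fun X => S.nor X 0) (fderiv ℝ (fun X => S.nor X 0) (amb L))
        (amb (gauge (fun n => expG ((0 : ℝ) • ξ n)) L)) := by
      rw [h0]
      exact ((contDiffAt_pi.1 (S.contDiffAt_nor L hL) 0).differentiableAt (by simp)).hasFDerivAt
    have h2 := hn.comp_hasDerivWithinAt
      (f := fun ε : ℝ => amb (gauge (fun n => expG (ε • ξ n)) L)) 0 hder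
    refine (hasDerivWithinAt_matrix_mul h2 (hasDerivAt_expG (ξ 0)).hasDerivWithinAt).congr_deriv ?_
    simp only [Function.comp]
    rw [h0, zero_smul, expG_zero]
    congr 1
    exact Matrix.mul_one _
  have hcurve : ContinuousAt (fun ε : ℝ => gauge (fun n => expG (ε • ξ n)) L) 0 := by
    rw [isInducing_amb.continuousAt_iff]
    exact (hder.hasDerivAt Filter.univ_mem).continuousAt
  have hdom : ∀ᶠ ε in 𝓝 (0 : ℝ), gauge (fun n => expG (ε • ξ n)) L ∈ S.dom :=
    hcurve.eventually (S.isOpen_dom.mem_nhds (by beta_reduce; rw [h0]; exact hL))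
  have heq : ∀ᶠ ε in 𝓝 (0 : ℝ), ambFrame (S.onQuot (proj (gauge (fun n => expG (ε • ξ n)) L))) N =
      Q ε * ambFrame (amb L) N * (Q ε)⁻¹ := by
    filter_upwards [hdom] with ε hε
    obtain ⟨κ, -, h2, h3⟩ := S.nor_spec _ hε
    rw [S.onQuot_proj, ← h3, ambFrame_amb, ambFrame_amb]
    change (monodromy (gauge κ (gauge _ L)) : Mat m) = _
    rw [monodromy_gauge, monodromy_gauge]
    simp only [coe_mul_eq, coe_inv_eq, Q, Matrix.mul_inv_rev]
    rw [← h2]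
    simp only [amb_apply, Matrix.mul_assoc]
    rfl
  -- The matrix `Q 0` need not be the identity. It commutes with the monodromy because `L` lies on
  -- the section, and this is enough.
  have hT : Q 0 * ambFrame (amb L) N * (Q 0)⁻¹ = ambFrame (amb L) N := by
    rw [← heq.self_of_nhds, h0, S.onQuot_proj, hLS]
  have h3 := hasDerivWithinAt_matrix_mul (hasDerivWithinAt_matrix_mul hQ
    (hasDerivWithinAt_const (0 : ℝ) Set.univ (ambFrame (amb L) N)))
    (hasDerivWithinAt_matrix_inv hQ hQdet)
  have h4 := hasDerivWithinAt_matrix.1 h3 i j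
  have h5 : HasDerivWithinAt (fun ε : ℝ =>
      ambFrame (S.onQuot (proj (gauge (fun n => expG (ε • ξ n)) L))) N i j) _ Set.univ 0 :=
    h4.congr_of_eventuallyEq (by
      rw [nhdsWithin_univ]
      filter_upwards [heq] with ε hε
      rw [hε]) (by rw [heq.self_of_nhds])
  rw [(h1.hasDerivAt Filter.univ_mem).unique (h5.hasDerivAt Filter.univ_mem)]
  have hu : IsUnit (Q 0).det := isUnit_iff_ne_zero.2 hQdet
  have hQi := Matrix.nonsing_inv_mul _ hu
  rw [LocalSection.laxField, ← hQ0, ← hξ]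
  set A := fderiv ℝ (fun X => S.nor X 0) (amb L) (tangent (gaugeField ξ L) L) +
    Q 0 * (ξ 0 : Mat m) with hA
  set T := ambFrame (amb L) N
  rw [Matrix.mul_zero, add_zero]
  have e1 : A * T * (Q 0)⁻¹ = A * (Q 0)⁻¹ * (Q 0 * T * (Q 0)⁻¹) := by
    calc _ = A * ((Q 0)⁻¹ * Q 0) * T * (Q 0)⁻¹ := by rw [hQi, Matrix.mul_one]
      _ = _ := by simp only [Matrix.mul_assoc]
  have e2 : Q 0 * T * -((Q 0)⁻¹ * A * (Q 0)⁻¹) = - (Q 0 * T * (Q 0)⁻¹ * (A * (Q 0)⁻¹)) := by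
    simp only [Matrix.mul_assoc, Matrix.mul_neg]
  rw [e1, e2, hT, ← sub_eq_add_neg]

/-- The trajectory condition, tested on the entries of the monodromy of the section, is a Lax
equation. Its coefficient is continuous along the trajectory because the local lift is. -/
theorem eventually_monodromyClass_eq (hm : 2 ≤ m) (hmN : Nat.Coprime m N) {U : Set (Moduli m N)}
    (hUn : U ⊆ nondegenerate m N) {h : Moduli m N → ℝ} (hh : SmoothOn h U) {c : ℝ → Moduli m N}
    (hc : IsHamiltonianTrajectory U h c) {t₀ : ℝ} (ht₀ : t₀ ∈ Set.Icc (0 : ℝ) 1) :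
    ∀ᶠ t in 𝓝[Set.Icc 0 1] t₀, monodromyClass (c t) = monodromyClass (c t₀) := by
  obtain ⟨L₀, hL₀⟩ := proj_surjective (c t₀)
  have hnd : PolygonNondegenerate L₀ :=
    proj_mem_nondegenerate.1 (hUn (by rw [hL₀]; exact hc.mapsTo t₀ ht₀))
  obtain ⟨S⟩ := nonempty_localSection (by omega) hmN hnd
  obtain ⟨O, lift, hO, hmem, hlc, hl0, hlift⟩ := S.exists_lift
  rw [hL₀] at hmem hl0
  have hev : ∀ᶠ t in 𝓝[Set.Icc 0 1] t₀, t ∈ Set.Icc (0 : ℝ) 1 ∧ c t ∈ O :=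
    (eventually_mem_nhdsWithin).and ((hc.continuousOn t₀ ht₀).eventually (hO.mem_nhds hmem))
  have hf : ∀ i j, SmoothOn (fun q => ambFrame (S.onQuot q) N i j) U := fun i j =>
    S.smoothOn_comp hUn (φ := fun X => ambFrame X N i j) fun L hL => by
      obtain ⟨L', hL'⟩ := S.sec_mem L (proj_mem_nondegenerate.1 (hUn hL))
      rw [hL']
      exact contDiffAt_matrix.1 (contDiffAt_ambFrame L' N) i j
  have hlax := eventually_conj_of_lax ht₀ (T := fun t => ambFrame (S.onQuot (c t)) N)
    (β := fun t => S.laxField h (lift (c t))) (by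
      filter_upwards [hev] with t ht
      obtain ⟨h1, h2, h3⟩ := hlift _ ht.2
      have hU : proj (lift (c t)) ∈ U := by rw [h1]; exact hc.mapsTo t ht.1
      have hLS : S.sec (amb (lift (c t))) = amb (lift (c t)) := by
        rw [← S.onQuot_proj, h1, h3]
      refine ⟨hasDerivWithinAt_matrix.2 fun i j => ?_, ?_⟩
      · refine (hc.hasDeriv _ (hf i j) t ht.1).congr_deriv ?_
        rw [← h3, ← S.reducedBracket_monodromy hh h2 hLS hU i j (hf i j), h1]
      · refine ContinuousAt.comp_continuousWithinAt (f := fun t => lift (c t))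
          (S.continuousAt_laxField hh h2 hU) ?_
        exact ContinuousAt.comp_continuousWithinAt (f := c)
          (hlc.continuousAt (hO.mem_nhds ht.2)) (hc.continuousOn t ht.1))
  filter_upwards [hlax, hev] with t ⟨X, hX, hXT⟩ ht
  obtain ⟨h1, -, h3⟩ := hlift _ ht.2
  obtain ⟨k1, -, k3⟩ := hlift _ hmem
  rw [← h1, ← k1]
  change ConjClasses.mk (monodromy (lift (c t))) = ConjClasses.mk (monodromy (lift (c t₀)))
  rw [eq_comm, ConjClasses.mk_eq_mk_iff_isConj]
  simp only [← h3, ← k3, ambFrame_amb] at hXT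
  exact isConj_of_mul_eq (NeZero.ne m) hX hXT

theorem monodromyClass_trajectory (hm : 2 ≤ m) (hmN : Nat.Coprime m N) {U : Set (Moduli m N)}
    (hUn : U ⊆ nondegenerate m N) {h : Moduli m N → ℝ} (hh : SmoothOn h U) {c : ℝ → Moduli m N}
    (hc : IsHamiltonianTrajectory U h c) {t : ℝ} (ht : t ∈ Set.Icc (0 : ℝ) 1) :
    monodromyClass (c t) = monodromyClass (c 0) := by
  have h1 : IsLocallyConstant fun s : Set.Icc (0 : ℝ) 1 => monodromyClass (c s) := by
    rw [IsLocallyConstant.iff_eventually_eq]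
    intro s
    exact (eventually_nhds_subtype_iff _ s fun t => monodromyClass (c t) = monodromyClass (c s)).2
      (eventually_monodromyClass_eq hm hmN hUn hh hc s.2)
  exact h1.apply_eq_of_preconnectedSpace ⟨t, ht⟩ ⟨0, by simp⟩

end TwistedGon

/-! ### Gauge directions as shifted invariant covectors. -/

namespace TwistedGon

open Matrix Topology
open scoped ContDiff Matrix.Norms.Elementwise

variable {m N : ℕ} [NeZero m] [NeZero N]

/-- The linear operator `ζ ↦ ζₛ - Xₛ⁻¹ ζₛ₊₁ Xₛ` modulo the nilradical, on parabolic `ζ`, completed to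
an endomorphism of the ambient space. -/
noncomputable def rigidityMap (X : Amb m N) : Amb m N →ₗ[ℝ] Amb m N where
  -- The first-row entries off the diagonal, left free by the nilradical, are used to record the
  -- entries of `ζ` that must vanish for parabolicity. The added multiple of the identity controls
  -- the total trace and so excludes the scalar solutions.
  toFun ζ s := Matrix.of fun i j => if i = 0 ∧ j ≠ 0 then ζ s j i else
    (ζ s - (X s)⁻¹ * ζ (s + 1) * X s) i j + (∑ k, (ζ k).trace) * (1 : Mat m) i j
  map_add' ζ η := by
    funext s
    ext i j
    simp only [Matrix.of_apply, Pi.add_apply, Matrix.add_apply]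
    split_ifs
    · rfl
    · simp only [Matrix.trace_add, Finset.sum_add_distrib, Matrix.sub_apply, Matrix.add_apply,
        Matrix.mul_add, Matrix.add_mul]
      ring
  map_smul' c ζ := by
    funext s
    ext i j
    simp only [Matrix.of_apply, Pi.smul_apply, Matrix.smul_apply, RingHom.id_apply]
    split_ifs
    · rfl
    · simp only [Matrix.trace_smul, smul_eq_mul, ← Finset.mul_sum, Matrix.sub_apply, Matrix.smul_apply,
        Matrix.mul_smul, Matrix.smul_mul]
      ring

theorem rigidityMap_apply (X ζ : Amb m N) (s : ZMod N) (i j : Fin m) :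
    rigidityMap X ζ s i j = if i = 0 ∧ j ≠ 0 then ζ s j i else
      (ζ s - (X s)⁻¹ * ζ (s + 1) * X s) i j + (∑ k, (ζ k).trace) * (1 : Mat m) i j := rfl

omit [NeZero m] [NeZero N] in
theorem trace_inv_mul_mul (L : GN m N) (A : Mat m) (s : ZMod N) :
    ((amb L s)⁻¹ * A * amb L s).trace = A.trace := by
  rw [Matrix.trace_mul_cycle, amb_apply, coe_mul_inv, Matrix.one_mul]

/-- The consequences of an equation `rigidityMap X ζ = η`. -/
theorem rigidityMap_spec {L : GN m N} {ζ η : Amb m N} (h : rigidityMap (amb L) ζ = η)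
    (hη : ∀ s i j, i = 0 ∧ j ≠ 0 → η s i j = 0) (htr : ∀ s, ∃ A : Mat m, A.trace = 0 ∧
      ∀ i j, ¬ (i = 0 ∧ j ≠ 0) → η s i j = ((amb L s)⁻¹ * A * amb L s) i j) :
    (∀ s, (ζ s).trace = 0) ∧ (∀ s, IsParabolic (ζ s)) ∧
      ∀ s i j, ¬ (i = 0 ∧ j ≠ 0) →
        (ζ s - (amb L s)⁻¹ * ζ (s + 1) * amb L s) i j = η s i j := by
  have hpar : ∀ s, IsParabolic (ζ s) := fun s i hi => by
    have h1 := rigidityMap_apply (amb L) ζ s 0 i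
    rw [if_pos ⟨rfl, hi⟩, h, hη s 0 i ⟨rfl, hi⟩] at h1
    exact h1.symm
  have hent : ∀ s i j, ¬ (i = 0 ∧ j ≠ 0) →
      (ζ s - (amb L s)⁻¹ * ζ (s + 1) * amb L s) i j + (∑ k, (ζ k).trace) * (1 : Mat m) i j =
        η s i j := fun s i j hij => by
    have h1 := rigidityMap_apply (amb L) ζ s i j
    rw [if_neg hij, h] at h1
    exact h1.symm
  set S := ∑ k, (ζ k).trace with hS
  have hm0 : (m : ℝ) ≠ 0 := Nat.cast_ne_zero.2 (NeZero.ne m)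
  have hN0 : (N : ℝ) ≠ 0 := Nat.cast_ne_zero.2 (NeZero.ne N)
  -- Taking traces removes the conjugation. Summing over the period makes the differences telescope,
  -- so the total trace `S` vanishes; the traces are then all equal with sum zero.
  have h1 : ∀ s, (ζ s).trace - (ζ (s + 1)).trace + S * m = 0 := by
    intro s
    obtain ⟨A, hA0, hA⟩ := htr s
    have h2 : (η s).trace = 0 := by
      rw [← hA0, ← trace_inv_mul_mul L A s]
      exact Finset.sum_congr rfl fun i _ => hA i i (by tauto)
    have h3 : (η s).trace =
        (ζ s - (amb L s)⁻¹ * ζ (s + 1) * amb L s).trace + (S • (1 : Mat m)).trace := by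
      rw [← Matrix.trace_add]
      exact Finset.sum_congr rfl fun i _ => (hent s i i (by tauto)).symm
    rw [h2, Matrix.trace_sub, trace_inv_mul_mul, Matrix.trace_smul, Matrix.trace_one,
      Fintype.card_fin, smul_eq_mul] at h3
    exact h3.symm
  have hS0 : S = 0 := by
    have h2 : ∑ s, ((ζ s).trace - (ζ (s + 1)).trace + S * m) = 0 :=
      Finset.sum_eq_zero fun s _ => h1 s
    have hsh : ∑ s, (ζ (s + 1)).trace = ∑ s, (ζ s).trace :=
      Equiv.sum_comp (Equiv.addRight (1 : ZMod N)) (fun s => (ζ s).trace)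
    rw [Finset.sum_add_distrib, Finset.sum_sub_distrib, hsh, sub_self, zero_add,
      Finset.sum_const, Finset.card_univ, ZMod.card, nsmul_eq_mul] at h2
    simpa [hm0, hN0] using h2
  have h2 : ∀ s, (ζ (s + 1)).trace = (ζ s).trace := fun s => by
    have := h1 s
    rw [hS0] at this
    linarith
  have h3 : ∀ n : ℕ, (ζ n).trace = (ζ 0).trace := by
    intro n
    induction n with
    | zero => simp
    | succ n ih => rw [Nat.cast_succ, h2, ih]
  have h4 : ∀ s, (ζ s).trace = (ζ 0).trace := fun s => by
    have := h3 s.val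
    rwa [ZMod.natCast_zmod_val] at this
  have h5 : (ζ 0).trace = 0 := by
    simp only [h4] at hS
    rw [hS0, Finset.sum_const, Finset.card_univ, ZMod.card, nsmul_eq_mul] at hS
    exact (mul_eq_zero.1 hS.symm).resolve_left hN0
  refine ⟨fun s => by rw [h4, h5], hpar, fun s i j hij => ?_⟩
  have := hent s i j hij
  rwa [hS0, zero_mul, add_zero] at this

/-- An element of the kernel is traceless and parabolic and satisfies the recursion of the rigidity
theorem, with `ν` its nilradical defect. -/
theorem injective_rigidityMap (hm : 2 ≤ m) (hmN : Nat.Coprime m N) {L : GN m N}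
    (hL : PolygonNondegenerate L) : Function.Injective (rigidityMap (amb L)) := by
  rw [← LinearMap.ker_eq_bot, LinearMap.ker_eq_bot']
  intro ζ hζ
  obtain ⟨h1, h2, h3⟩ := rigidityMap_spec hζ (fun _ _ _ _ => rfl)
    (fun s => ⟨0, Matrix.trace_zero _ _, fun i j _ => by simp⟩)
  refine eq_zero_of_parabolic_of_nilradical hm hmN hL h1 h2
    (ν := fun s => ζ s - (amb L s)⁻¹ * ζ (s + 1) * amb L s) (fun s i j hij => ?_) fun s => ?_
  · refine h3 s i j ?_
    tauto
  · rw [sub_sub_cancel]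
    calc ζ (s + 1) = ((L s : Mat m) * (L s : Mat m)⁻¹) * ζ (s + 1) *
          ((L s : Mat m) * (L s : Mat m)⁻¹) := by
          rw [coe_mul_inv, Matrix.one_mul, Matrix.mul_one]
      _ = _ := by simp only [Matrix.mul_assoc, amb_apply]

/-- The correction of `ξ` by a parabolic element that makes it a shifted gradient. -/
noncomputable def rigiditySolve (X ξ : Amb m N) : Amb m N :=
  -- `invFun` gives a total definition; the solution is meaningful where the operator is bijective,
  -- in particular at and near nondegenerate polygons.
  ξ + Function.invFun (rigidityMap X) (fun s => Matrix.of fun i j => if i = 0 ∧ j ≠ 0 then 0 else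
    ((X s)⁻¹ * (ξ (s + 1) - X s * ξ s * (X s)⁻¹) * X s) i j)

/-- Every infinitesimal gauge transformation is, modulo parabolic ones, a shifted gradient of an
invariant function. -/
theorem rigiditySolve_spec (hm : 2 ≤ m) (hmN : Nat.Coprime m N) {L : GN m N}
    (hL : PolygonNondegenerate L) (ξ : ZMod N → 𝔤 m) :
    ∃ b : ZMod N → 𝔤 m,
      (∀ s, (b s : Mat m) = rigiditySolve (amb L) (fun n => (ξ n : Mat m)) (s + 1)) ∧
      (∀ s, IsNilradical (moment b L s : Mat m)) ∧
      ∀ s, IsParabolic ((b (s - 1) : Mat m) - (ξ s : Mat m)) := by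
  set X : Amb m N := fun n => (ξ n : Mat m) with hX
  set η : Amb m N := fun s => Matrix.of fun i j => if i = 0 ∧ j ≠ 0 then 0 else
    ((amb L s)⁻¹ * (X (s + 1) - amb L s * X s * (amb L s)⁻¹) * amb L s) i j with hη
  set ζ : Amb m N := Function.invFun (rigidityMap (amb L)) η with hζ
  have hsol : rigidityMap (amb L) ζ = η := Function.rightInverse_invFun
    (LinearMap.injective_iff_surjective.1 (injective_rigidityMap hm hmN hL)) η
  obtain ⟨h1, h2, h3⟩ := rigidityMap_spec hsol
    (fun s i j hij => by simp only [hη, Matrix.of_apply]; rw [if_pos hij])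
    (fun s => ⟨X (s + 1) - amb L s * X s * (amb L s)⁻¹, by
      have := trace_coe (gaugeField ξ L s)
      exact this, fun i j hij => by simp only [hη, Matrix.of_apply]; rw [if_neg hij]⟩)
  have htr : ∀ s, (X s + ζ s).trace = 0 := fun s => by
    rw [Matrix.trace_add, h1, add_zero, hX]
    exact trace_coe (ξ s)
  -- The shift by one is chosen so that `b (s - 1)` is `ξ s` plus the parabolic correction.
  refine ⟨fun s => ⟨X (s + 1) + ζ (s + 1), mem_sl_iff.2 (htr _)⟩, fun s => rfl, fun s i j hij => ?_,
    fun s => ?_⟩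
  · have hij' : ¬ (i = 0 ∧ j ≠ 0) := by tauto
    have h4 := h3 s i j hij'
    simp only [hη, Matrix.of_apply] at h4
    rw [if_neg hij'] at h4
    have e1 : (amb L s)⁻¹ * (X (s + 1) - amb L s * X s * (amb L s)⁻¹) * amb L s =
        (amb L s)⁻¹ * X (s + 1) * amb L s - X s := by
      have e0 : (amb L s)⁻¹ * amb L s = 1 := coe_inv_mul (L s)
      rw [Matrix.mul_sub, Matrix.sub_mul]
      congr 1
      calc _ = ((amb L s)⁻¹ * amb L s) * X s * ((amb L s)⁻¹ * amb L s) := by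
            simp only [Matrix.mul_assoc]
        _ = _ := by rw [e0, Matrix.one_mul, Matrix.mul_one]
    rw [e1] at h4
    rw [coe_moment, coe_Ad_inv]
    simp only [sub_add_cancel, Matrix.sub_apply, Matrix.add_apply, Matrix.mul_add,
      Matrix.add_mul, amb_apply] at h4 ⊢
    linarith
  · have h5 : X (s - 1 + 1) + ζ (s - 1 + 1) - (ξ s : Mat m) = ζ s := by
      rw [sub_add_cancel, hX, add_sub_cancel_left]
    change IsParabolic (X (s - 1 + 1) + ζ (s - 1 + 1) - (ξ s : Mat m))
    rw [h5]
    exact h2 s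

section Smooth

variable {V : Type*} [NormedAddCommGroup V] [NormedSpace ℝ V]

/-- On a finite-dimensional space an operator is determined linearly by its values on a basis, so
pointwise smoothness suffices. -/
theorem contDiffAt_clm_of_apply {E F : Type*} [NormedAddCommGroup E] [NormedSpace ℝ E]
    [NormedAddCommGroup F] [NormedSpace ℝ F] [FiniteDimensional ℝ E] {f : V → E →L[ℝ] F} {x : V}
    {k : WithTop ℕ∞} (h : ∀ y, ContDiffAt ℝ k (fun v => f v y) x) : ContDiffAt ℝ k f x := by
  let e₁ : E ≃L[ℝ] (Fin (Module.finrank ℝ E) → ℝ) := ContinuousLinearEquiv.ofFinrankEq (by simp)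
  let e₂ := (e₁.arrowCongr (1 : F ≃L[ℝ] F)).trans
    (ContinuousLinearEquiv.piRing (Fin (Module.finrank ℝ E)))
  rw [← Function.id_comp f, ← e₂.symm_comp_self]
  exact e₂.symm.contDiff.contDiffAt.comp x (contDiffAt_pi.2 fun i => h _)

/-- Injectivity of an endomorphism is an open condition. -/
theorem eventually_exists_equiv {E : Type*} [NormedAddCommGroup E] [NormedSpace ℝ E]
    [FiniteDimensional ℝ E] {f : V → E →ₗ[ℝ] E} {x : V} {k : WithTop ℕ∞}
    (hf : ∀ y, ContDiffAt ℝ k (fun v => f v y) x) (hx : Function.Injective (f x)) :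
    ∀ᶠ v in 𝓝 x, ∃ A : E ≃L[ℝ] E, (A : E →L[ℝ] E) = LinearMap.toContinuousLinearMap (f v) := by
  have : CompleteSpace E := FiniteDimensional.complete ℝ E
  have hg : ContDiffAt ℝ k (fun v => LinearMap.toContinuousLinearMap (f v)) x :=
    contDiffAt_clm_of_apply hf
  exact hg.continuousAt.eventually
    (ContinuousLinearEquiv.nhds (LinearEquiv.ofInjectiveEndo _ hx).toContinuousLinearEquiv)

/-- The solution of a linear equation depends smoothly on its coefficients. -/
theorem contDiffAt_invFun {E : Type*} [NormedAddCommGroup E] [NormedSpace ℝ E]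
    [FiniteDimensional ℝ E] {f : V → E →ₗ[ℝ] E} {r : V → E} {x : V} {k : WithTop ℕ∞}
    (hf : ∀ y, ContDiffAt ℝ k (fun v => f v y) x) (hx : Function.Injective (f x))
    (hr : ContDiffAt ℝ k r x) : ContDiffAt ℝ k (fun v => Function.invFun (f v) (r v)) x := by
  have : CompleteSpace E := FiniteDimensional.complete ℝ E
  let g : V → E →L[ℝ] E := fun v => LinearMap.toContinuousLinearMap (f v)
  have hg : ContDiffAt ℝ k g x := contDiffAt_clm_of_apply hf
  let e : E ≃L[ℝ] E := (LinearEquiv.ofInjectiveEndo _ hx).toContinuousLinearEquiv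
  have he : (e : E →L[ℝ] E) = g x := rfl
  have h2 : ContDiffAt ℝ k (fun v => (g v).inverse) x := by
    have h3 := contDiffAt_map_inverse (n := k) e
    rw [he] at h3
    exact h3.comp x hg
  refine (h2.clm_apply hr).congr_of_eventuallyEq ?_
  filter_upwards [eventually_exists_equiv hf hx] with v ⟨A, hA⟩
  have hA' : ∀ y, f v y = A y := fun y => (DFunLike.congr_fun hA y).symm
  have hgv : g v = A := hA.symm
  rw [hgv, ContinuousLinearMap.inverse_equiv]
  apply A.injective
  have hsurj : Function.Surjective (f v) := fun y => ⟨A.symm y, by rw [hA', A.apply_symm_apply]⟩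
  rw [← hA', Function.rightInverse_invFun hsurj]
  exact (A.apply_symm_apply _).symm

theorem contDiffAt_rigiditySolve (hm : 2 ≤ m) (hmN : Nat.Coprime m N) {L : GN m N}
    (hL : PolygonNondegenerate L) {X ξ : V → Amb m N} {x : V} (hx : X x = amb L)
    (hX : ContDiffAt ℝ ∞ X x) (hξ : ContDiffAt ℝ ∞ ξ x) :
    ContDiffAt ℝ ∞ (fun v => rigiditySolve (X v) (ξ v)) x := by
  have hXi : ∀ s, ContDiffAt ℝ ∞ (fun v => (X v s)⁻¹) x := fun s =>
    contDiffAt_matrix_inv (contDiffAt_pi.1 hX s) (by rw [hx]; simp)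
  have h1 : ∀ ζ, ContDiffAt ℝ ∞ (fun v => rigidityMap (X v) ζ) x := by
    refine fun ζ => contDiffAt_pi.2 fun s => contDiffAt_matrix.2 fun i j => ?_
    have h2 : ContDiffAt ℝ ∞ (fun v => ζ s - (X v s)⁻¹ * ζ (s + 1) * X v s) x :=
      contDiffAt_const.sub (contDiffAt_matrix_mul (contDiffAt_matrix_mul (hXi s) contDiffAt_const)
        (contDiffAt_pi.1 hX s))
    by_cases hij : i = 0 ∧ j ≠ 0
    · have : (fun v => rigidityMap (X v) ζ s i j) = fun _ => ζ s j i := funext fun v => if_pos hij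
      rw [this]
      exact contDiffAt_const
    · have : (fun v => rigidityMap (X v) ζ s i j) = fun v =>
          (ζ s - (X v s)⁻¹ * ζ (s + 1) * X v s) i j + (∑ k, (ζ k).trace) * (1 : Mat m) i j :=
        funext fun v => if_neg hij
      rw [this]
      exact (contDiffAt_matrix.1 h2 i j).add contDiffAt_const
  have h2 := injective_rigidityMap hm hmN hL
  rw [← hx] at h2
  refine hξ.add (contDiffAt_invFun h1 h2
    (contDiffAt_pi.2 fun s => contDiffAt_matrix.2 fun i j => ?_))
  simp only [Matrix.of_apply]
  split_ifs
  · exact contDiffAt_const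
  · refine contDiffAt_matrix.1 (contDiffAt_matrix_mul (contDiffAt_matrix_mul (hXi s) ?_)
      (contDiffAt_pi.1 hX s)) i j
    exact (contDiffAt_pi.1 hξ (s + 1)).sub (contDiffAt_matrix_mul (contDiffAt_matrix_mul
      (contDiffAt_pi.1 hX s) (contDiffAt_pi.1 hξ s)) (hXi s))

end Smooth

end TwistedGon

/-! ### The derivative of a local section. -/

namespace TwistedGon

open Matrix Topology
open scoped ContDiff Matrix.Norms.Elementwise

variable {m N : ℕ}

/-- A curve in `SL(m, ℝ)` has a velocity in the right trivialization. -/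
theorem exists_eq_tangent [NeZero N] {δ : ℝ → GN m N} {X : Amb m N} {t : ℝ}
    (h : HasDerivAt (fun y => amb (δ y)) X t) : ∃ ξ, X = tangent ξ (δ t) := by
  have h1 : ∀ n, HasDerivWithinAt (fun y => (δ y n : Mat m)) (X n) Set.univ t := fun n =>
    (hasDerivAt_pi.1 h n).hasDerivWithinAt
  have h2 : ∀ n, (X n * (δ t n : Mat m)⁻¹).trace = 0 := fun n =>
    trace_logDeriv_eq_zero (f := fun y => (δ y n : Mat m)) uniqueDiffWithinAt_univ
      (Set.mem_univ t) (h1 n) fun y _ => Matrix.SpecialLinearGroup.det_coe (δ y n)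
  refine ⟨fun n => ⟨X n * (δ t n : Mat m)⁻¹, mem_sl_iff.2 (h2 n)⟩, funext fun n => ?_⟩
  change X n = X n * (δ t n : Mat m)⁻¹ * (δ t n : Mat m)
  rw [Matrix.mul_assoc, coe_inv_mul, Matrix.mul_one]

theorem deriv_conj_eq {A B g z A' B' : Mat m} (hA : A.det = 1) (hg : g.det = 1) :
    (A' * g + A * (z * g)) * B⁻¹ + A * g * -(B⁻¹ * B' * B⁻¹) =
      A * (z + (A⁻¹ * A' - g * (B⁻¹ * B') * g⁻¹)) * A⁻¹ * (A * g * B⁻¹) := by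
  have hA1 := Matrix.nonsing_inv_mul A (by rw [hA]; exact isUnit_one)
  have hA2 := Matrix.mul_nonsing_inv A (by rw [hA]; exact isUnit_one)
  have hg1 := Matrix.nonsing_inv_mul g (by rw [hg]; exact isUnit_one)
  have e1 : A * (z + (A⁻¹ * A' - g * (B⁻¹ * B') * g⁻¹)) * A⁻¹ * (A * g * B⁻¹) =
      A * z * (A⁻¹ * A) * g * B⁻¹ + (A * A⁻¹) * A' * (A⁻¹ * A) * g * B⁻¹ -
        A * g * B⁻¹ * B' * (g⁻¹ * (A⁻¹ * A) * g) * B⁻¹ := by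
    noncomm_ring
  rw [e1, hA1, hA2, Matrix.mul_one g⁻¹, hg1]
  noncomm_ring

theorem trace_conormal_mul {x A b w : Mat m} (hA : A.det = 1) (hx : x.det = 1) :
    (x⁻¹ * (A * b * A⁻¹) * (A * w * A⁻¹ * x)).trace = (b * w).trace := by
  have hA1 := Matrix.nonsing_inv_mul A (by rw [hA]; exact isUnit_one)
  have hx2 := Matrix.mul_nonsing_inv x (by rw [hx]; exact isUnit_one)
  have e1 : x⁻¹ * (A * b * A⁻¹) * (A * w * A⁻¹ * x) =
      x⁻¹ * A * (b * (A⁻¹ * A) * w * A⁻¹ * x) := by noncomm_ring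
  have e2 : b * 1 * w * A⁻¹ * x * (x⁻¹ * A) = b * w * (A⁻¹ * (x * x⁻¹) * A) := by noncomm_ring
  rw [e1, Matrix.trace_mul_comm, hA1, e2, hx2, Matrix.mul_one A⁻¹, hA1, Matrix.mul_one]

variable [NeZero m] [NeZero N] {L₀ : GN m N}

/-- The covector at `S.sec X` induced by `B`. -/
noncomputable def LocalSection.conormal (S : LocalSection L₀) (X B : Amb m N) : Amb m N := fun n =>
  (S.sec X n)⁻¹ * (S.nor X (n + 1) * B n * (S.nor X (n + 1))⁻¹)

theorem LocalSection.sec_apply (S : LocalSection L₀) {L : GN m N} (hL : L ∈ S.dom) (n : ZMod N) :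
    S.sec (amb L) n = S.nor (amb L) (n + 1) * (L n : Mat m) * (S.nor (amb L) n)⁻¹ := by
  obtain ⟨κ, -, h2, h3⟩ := S.nor_spec L hL
  rw [← h3, ← h2, amb_gauge]
  rfl

/-- The derivative of the section along a curve. -/
theorem LocalSection.exists_hasDerivAt_sec (S : LocalSection L₀) {δ : ℝ → GN m N} {t : ℝ}
    {ζ : ZMod N → 𝔤 m} (hδ : HasDerivAt (fun y => amb (δ y)) (tangent ζ (δ t)) t)
    (hdom : δ t ∈ S.dom) : ∃ η : ZMod N → 𝔤 m, (∀ n, IsParabolic (η n : Mat m)) ∧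
      HasDerivAt (fun y => S.sec (amb (δ y))) (fun n => S.nor (amb (δ t)) (n + 1) *
        (ζ n + gaugeField η (δ t) n : Mat m) * (S.nor (amb (δ t)) (n + 1))⁻¹ *
          S.sec (amb (δ t)) n) t := by
  have hcont : ContinuousAt δ t := by
    rw [isInducing_amb.continuousAt_iff]
    exact hδ.continuousAt
  have hev : ∀ᶠ y in 𝓝 t, δ y ∈ S.dom := hcont.eventually (S.isOpen_dom.mem_nhds hdom)
  obtain ⟨D, hk⟩ : ∃ D, HasDerivAt (fun y => S.nor (amb (δ y))) D t :=
    ⟨_, ((S.contDiffAt_nor _ hdom).differentiableAt (by simp)).hasFDerivAt.comp_hasDerivAt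
      (f := fun y => amb (δ y)) t hδ⟩
  have hkn : ∀ n, HasDerivWithinAt (fun y => S.nor (amb (δ y)) n) (D n) Set.univ t := fun n =>
    (hasDerivAt_pi.1 hk n).hasDerivWithinAt
  have hδn : ∀ n, HasDerivWithinAt (fun y => (δ y n : Mat m)) ((ζ n : Mat m) * (δ t n : Mat m))
      Set.univ t := fun n => (hasDerivAt_pi.1 hδ n).hasDerivWithinAt
  have hdet := S.det_nor hdom
  obtain ⟨κ, hκ, hκ2, -⟩ := S.nor_spec _ hdom
  -- the logarithmic derivative of the normalizing gauge transformation
  have hpar : ∀ n, IsParabolic (D n) := fun n i hi => by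
    have h1 : HasDerivAt (fun y => S.nor (amb (δ y)) n i 0) (D n i 0) t :=
      (hasDerivWithinAt_matrix.1 (hkn n) i 0).hasDerivAt Filter.univ_mem
    have h2 : HasDerivAt (fun y => S.nor (amb (δ y)) n i 0) 0 t := by
      refine (hasDerivAt_const t (0 : ℝ)).congr_of_eventuallyEq ?_
      filter_upwards [hev] with y hy
      obtain ⟨κ, h1, h2, -⟩ := S.nor_spec _ hy
      rw [← h2]
      exact mem_H_iff.1 (h1 n) i hi
    exact h1.unique h2
  obtain ⟨s, hs, htS, hso⟩ : ∃ s : Set ℝ, (∀ y ∈ s, δ y ∈ S.dom) ∧ t ∈ s ∧ IsOpen s := by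
    obtain ⟨s, h1, h2, h3⟩ := eventually_nhds_iff.1 hev
    exact ⟨s, h1, h3, h2⟩
  have htr : ∀ n, ((S.nor (amb (δ t)) n)⁻¹ * D n).trace = 0 := fun n => by
    rw [Matrix.trace_mul_comm]
    exact trace_logDeriv_eq_zero (f := fun y => S.nor (amb (δ y)) n) (f' := D n)
      (hso.uniqueDiffWithinAt htS) htS ((hkn n).mono (Set.subset_univ s)) fun y hy => S.det_nor (hs y hy) n
  let η : ZMod N → 𝔤 m := fun n => ⟨(S.nor (amb (δ t)) n)⁻¹ * D n, mem_sl_iff.2 (htr n)⟩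
  refine ⟨η, fun n => IsParabolic.mul ?_ (hpar n), hasDerivAt_pi.2 fun n => ?_⟩
  · rw [← hκ2, amb_apply, ← coe_inv_eq]
    exact mem_H_iff.1 ((H m).inv_mem (hκ n))
  · have h1 := hasDerivWithinAt_matrix_mul (hasDerivWithinAt_matrix_mul (hkn (n + 1)) (hδn n))
      (hasDerivWithinAt_matrix_inv (hkn n) (by rw [hdet]; exact one_ne_zero))
    refine ((h1.hasDerivAt Filter.univ_mem).congr_of_eventuallyEq ?_).congr_deriv ?_
    · filter_upwards [hev] with y hy
      exact S.sec_apply hy n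
    · rw [S.sec_apply hdom n]
      exact deriv_conj_eq (hdet _) (δ t n).2

/-- The derivative of the section along a curve, paired with a covector. -/
theorem LocalSection.trace_conormal_deriv (S : LocalSection L₀) {δ : ℝ → GN m N} {t : ℝ}
    {ζ : ZMod N → 𝔤 m} (hδ : HasDerivAt (fun y => amb (δ y)) (tangent ζ (δ t)) t)
    (hdom : δ t ∈ S.dom) {b : ZMod N → 𝔤 m}
    (hb : ∀ n, IsNilradical (moment b (δ t) n : Mat m)) {V : Amb m N}
    (hV : HasDerivAt (fun y => S.sec (amb (δ y))) V t) :
    ∑ n, (S.conormal (amb (δ t)) (fun n => (b n : Mat m)) n * V n).trace = pairing b ζ := by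
  obtain ⟨η, hη, h⟩ := S.exists_hasDerivAt_sec hδ hdom
  obtain ⟨L', hL'⟩ := S.sec_mem _ (S.nondeg _ hdom)
  have hdet : ∀ n, (S.sec (amb (δ t)) n).det = 1 := fun n => by
    rw [hL']
    exact (L' n).2
  -- The motion of the normalizing transformation only adds a gauge direction of `H^N`, which an
  -- invariant covector does not see.
  have h1 : pairing b (gaugeField η (δ t)) = 0 := by
    rw [pairing_gaugeField]
    exact Finset.sum_eq_zero fun n _ => trace_mul_eq_zero (hb n) (hη n)
  have h2 := pairing_add b ζ (gaugeField η (δ t))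
  rw [h1, add_zero] at h2
  rw [← h2, hV.unique h]
  exact Finset.sum_congr rfl fun n _ => trace_conormal_mul (S.det_nor hdom _) (hdet n)

/-- The section is stationary only in the directions of the gauge orbits. -/
theorem LocalSection.exists_gaugeField_eq (S : LocalSection L₀) {δ : ℝ → GN m N} {t : ℝ}
    {ζ : ZMod N → 𝔤 m} (hδ : HasDerivAt (fun y => amb (δ y)) (tangent ζ (δ t)) t)
    (hdom : δ t ∈ S.dom) (hV : HasDerivAt (fun y => S.sec (amb (δ y))) 0 t) :
    ∃ η : ZMod N → 𝔤 m, (∀ n, IsParabolic (η n : Mat m)) ∧ ζ + gaugeField η (δ t) = 0 := by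
  obtain ⟨η, hη, h⟩ := S.exists_hasDerivAt_sec hδ hdom
  refine ⟨η, hη, funext fun n => Subtype.ext ?_⟩
  have h1 := congrFun (h.unique hV) n
  obtain ⟨L', hL'⟩ := S.sec_mem _ (S.nondeg _ hdom)
  obtain ⟨κ, -, hκ, -⟩ := S.nor_spec _ hdom
  rw [← hκ, hL'] at h1
  change (κ (n + 1) : Mat m) * (ζ n + gaugeField η (δ t) n : Mat m) * (κ (n + 1) : Mat m)⁻¹ *
    (L' n : Mat m) = 0 at h1
  set w : Mat m := (ζ n + gaugeField η (δ t) n : Mat m) with hw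
  have h2 : w = (κ (n + 1) : Mat m)⁻¹ * ((κ (n + 1) : Mat m) * w * (κ (n + 1) : Mat m)⁻¹ *
      (L' n : Mat m)) * ((L' n : Mat m)⁻¹ * (κ (n + 1) : Mat m)) := by
    calc w = ((κ (n + 1) : Mat m)⁻¹ * (κ (n + 1) : Mat m)) * w * ((κ (n + 1) : Mat m)⁻¹ *
        ((L' n : Mat m) * (L' n : Mat m)⁻¹) * (κ (n + 1) : Mat m)) := by
          rw [coe_inv_mul, coe_mul_inv, Matrix.mul_one, coe_inv_mul, Matrix.one_mul, Matrix.mul_one]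
      _ = _ := by noncomm_ring
  rw [h1, Matrix.mul_zero, Matrix.zero_mul] at h2
  exact h2

/-- A smooth function of one variable with positive derivative has a smooth inverse. -/
theorem exists_smooth_inverse {u : ℝ → ℝ} {J : Set ℝ} (hJ : IsOpen J) (hJc : Convex ℝ J)
    (hu : ∀ t ∈ J, ContDiffAt ℝ ∞ u t) (hpos : ∀ t ∈ J, 0 < deriv u t) :
    ∃ ι : ℝ → ℝ, (∀ t ∈ J, ι (u t) = t ∧ ContDiffAt ℝ ∞ ι (u t)) ∧ IsOpen (u '' J) := by
  have hc : ContinuousOn u J := fun t ht => (hu t ht).continuousAt.continuousWithinAt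
  have hmono : StrictMonoOn u J := strictMonoOn_of_deriv_pos hJc hc fun t ht =>
    hpos t (interior_subset ht)
  have hinv : ∀ t ∈ J, Function.invFunOn u J (u t) = t := fun t ht =>
    hmono.injOn.leftInvOn_invFunOn ht
  have hloc : ∀ t ∈ J, u '' J ∈ 𝓝 (u t) ∧ ContDiffAt ℝ ∞ (Function.invFunOn u J) (u t) := by
    intro t ht
    have hne := (hpos t ht).ne'
    have hd : HasFDerivAt u ((ContinuousLinearEquiv.unitsEquivAut ℝ (Units.mk0 _ hne) : ℝ ≃L[ℝ] ℝ) :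
        ℝ →L[ℝ] ℝ) t := by
      refine (((hu t ht).differentiableAt (by simp)).hasDerivAt.hasFDerivAt).congr_fderiv ?_
      ext
      simp
    have hn : (∞ : WithTop ℕ∞) ≠ 0 := by simp
    have h1 := (hu t ht).to_localInverse hd hn
    have hstrict := (hu t ht).hasStrictFDerivAt' hd hn
    have h2 := hstrict.eventually_right_inverse
    have h3 : ∀ᶠ y in 𝓝 (u t), (hu t ht).localInverse hd hn y ∈ J := by
      refine h1.continuousAt.eventually (hJ.mem_nhds ?_)
      rw [ContDiffAt.localInverse_apply_image]
      exact ht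
    refine ⟨?_, h1.congr_of_eventuallyEq ?_⟩
    · filter_upwards [h2, h3] with y h4 h5
      exact ⟨_, h5, h4⟩
    · filter_upwards [h2, h3] with y h4 h5
      have h4' : u ((hu t ht).localInverse hd hn y) = y := h4
      conv_lhs => rw [← h4']
      exact hinv _ h5
  refine ⟨Function.invFunOn u J, fun t ht => ⟨hinv t ht, (hloc t ht).2⟩, isOpen_iff_mem_nhds.2 ?_⟩
  rintro _ ⟨t, ht, rfl⟩
  exact (hloc t ht).1

theorem contDiffAt_deriv {E : Type*} [NormedAddCommGroup E] [NormedSpace ℝ E] {f : ℝ → E} {t : ℝ}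
    (hf : ContDiffAt ℝ ∞ f t) : ContDiffAt ℝ ∞ (deriv f) t :=
  hf.derivWithin (by simp)

end TwistedGon

/-! ### Curves in gauge orbits as Hamiltonian trajectories. -/

namespace TwistedGon

open Matrix Topology
open scoped ContDiff Matrix.Norms.Elementwise

variable {m N : ℕ}

theorem hasDerivAt_trace {f : ℝ → Mat m} {f' : Mat m} {t : ℝ}
    (hf : HasDerivWithinAt f f' Set.univ t) : HasDerivAt (fun y => (f y).trace) f'.trace t :=
  HasDerivAt.fun_sum fun i _ => (hasDerivWithinAt_matrix.1 hf i i).hasDerivAt Filter.univ_mem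

variable [NeZero N]

/-- The derivative of `X ↦ ∑ tr (Cₙ (Xₙ - xₙ))` along a curve, where `C` and the base point `x`
depend on a parameter such that `∑ tr (Cₙ x'ₙ) = 0`. -/
theorem hasDerivAt_sum_trace {C x X : ℝ → Amb m N} {C' v V : Amb m N} {σ : ℝ → ℝ} {σ' t t₀ : ℝ}
    (hC : HasDerivAt C C' t) (hx : HasDerivAt x v t) (hX : HasDerivAt X V t₀)
    (hσ : HasDerivAt σ σ' t₀) (hσt : σ t₀ = t) (hXx : X t₀ = x t)
    (hv : ∑ n, (C t n * v n).trace = 0) :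
    HasDerivAt (fun y => ∑ n, (C (σ y) n * (X y n - x (σ y) n)).trace)
      (∑ n, (C t n * V n).trace) t₀ := by
  subst hσt
  have h1 : ∀ n, HasDerivWithinAt (fun y => C (σ y) n) (σ' • C' n) Set.univ t₀ := fun n =>
    (hasDerivAt_pi.1 (hC.scomp t₀ hσ) n).hasDerivWithinAt
  have h2 : ∀ n, HasDerivWithinAt (fun y => X y n - x (σ y) n) (V n - σ' • v n) Set.univ t₀ :=
    fun n => (hasDerivAt_pi.1 hX n).hasDerivWithinAt.sub
      (hasDerivAt_pi.1 (hx.scomp t₀ hσ) n).hasDerivWithinAt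
  have h3 := HasDerivAt.fun_sum (u := Finset.univ) fun n (_ : n ∈ Finset.univ) =>
    hasDerivAt_trace (hasDerivWithinAt_matrix_mul (h1 n) (h2 n))
  refine h3.congr_deriv ?_
  have h4 : ∀ n, (σ' • C' n * (X t₀ n - x (σ t₀) n) + C (σ t₀) n * (V n - σ' • v n)).trace =
      (C (σ t₀) n * V n).trace - σ' * (C (σ t₀) n * v n).trace := fun n => by
    rw [hXx, sub_self, Matrix.mul_zero, zero_add, Matrix.mul_sub, Matrix.trace_sub,
      Matrix.mul_smul, Matrix.trace_smul, smul_eq_mul]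
  rw [Finset.sum_congr rfl fun n _ => h4 n, Finset.sum_sub_distrib, ← Finset.mul_sum, hv, mul_zero,
    sub_zero]

variable [NeZero m]

/-- This is the skew symmetry `{h, h} = 0` of the bracket, at the level of covectors. -/
theorem pairing_gaugeField_shift {L : GN m N} {b : ZMod N → 𝔤 m}
    (hb : ∀ n, IsNilradical (moment b L n : Mat m)) :
    pairing b (gaugeField (fun n => b (n - 1)) L) = 0 := by
  rw [pairing_gaugeField]
  have h1 := sum_trace_moment hb hb
  have h2 : ∑ s, ((b (s - 1) : Mat m) * (moment b L s : Mat m)).trace =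
      ∑ s, ((moment b L s : Mat m) * (b (s - 1) : Mat m)).trace :=
    Finset.sum_congr rfl fun s _ => Matrix.trace_mul_comm _ _
  rw [h2] at h1
  have h3 : pairing (moment b L) (fun n => b (n - 1)) =
    ∑ s, ((moment b L s : Mat m) * (b (s - 1) : Mat m)).trace := rfl
  linarith

/-- Infinitesimal gauge transformations that agree modulo the Lie algebra of `H` have the same
pairings with invariant covectors. -/
theorem pairing_gaugeField_congr {L : GN m N} {a ξ η : ZMod N → 𝔤 m}
    (ha : ∀ n, IsNilradical (moment a L n : Mat m))
    (h : ∀ n, IsParabolic ((η n : Mat m) - (ξ n : Mat m))) :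
    pairing a (gaugeField η L) = pairing a (gaugeField ξ L) := by
  rw [pairing_gaugeField, pairing_gaugeField, ← sub_eq_zero, ← pairing_sub]
  exact Finset.sum_eq_zero fun n _ => trace_mul_eq_zero (ha n) (h n)

omit [NeZero m] in
theorem contDiffAt_gauge {V : Type*} [NormedAddCommGroup V] [NormedSpace ℝ V] {K : V → GN m N}
    {v : V} (hK : ContDiffAt ℝ ∞ (fun y => amb (K y)) v) (L : GN m N) :
    ContDiffAt ℝ ∞ (fun y => amb (gauge (K y) L)) v := by
  refine contDiffAt_pi.2 fun n => ?_
  have h1 := contDiffAt_pi.1 hK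
  refine (contDiffAt_matrix_mul (contDiffAt_matrix_mul (h1 (n + 1))
    (contDiffAt_const (c := (L n : Mat m)))) (contDiffAt_matrix_inv (h1 n)
      ?_)).congr_of_eventuallyEq ?_
  · simp
  · exact Filter.Eventually.of_forall fun y => amb_gauge (K y) L n

variable {L₀ : GN m N}

/-- At each time, `rigiditySolve` provides the covector `b` that an autonomous Hamiltonian must have
as its gradient in order to generate the velocity of the curve. Monotonicity of `ℓ` along the
section curve recovers the time from the point, so these covectors can be assembled into one
function. -/
theorem LocalSection.hamiltonianStep_of_curve (hm : 2 ≤ m) (hmN : Nat.Coprime m N)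
    (S : LocalSection L₀) {W : Set (Moduli m N)} (hW : IsOpen W) (hWn : W ⊆ nondegenerate m N)
    {L₁ : GN m N} {K : ℝ → GN m N} {J : Set ℝ} (hJo : IsOpen J) (hJc : Convex ℝ J)
    (h01 : Set.Icc 0 1 ⊆ J) (hK : ∀ t ∈ J, ContDiffAt ℝ ∞ (fun y => amb (K y)) t)
    (hdom : ∀ t ∈ J, gauge (K t) L₁ ∈ S.dom)
    (hmem : ∀ t ∈ Set.Icc (0 : ℝ) 1, proj (gauge (K t) L₁) ∈ W) (ℓ : Amb m N →L[ℝ] ℝ)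
    (hpos : ∀ t ∈ J, 0 < deriv (fun y => ℓ (S.sec (amb (gauge (K y) L₁)))) t) :
    HamiltonianStep W (proj (gauge (K 0) L₁)) (proj (gauge (K 1) L₁)) := by
  set γ : ℝ → GN m N := fun t => gauge (K t) L₁ with hγ
  have hnd : ∀ t ∈ J, PolygonNondegenerate (γ t) := fun t ht => S.nondeg _ (hdom t ht)
  let Xi : ℝ → Amb m N := fun t n => deriv (fun y => amb (K y)) t n * (amb (K t) n)⁻¹
  let B : ℝ → Amb m N := fun t s => rigiditySolve (amb (γ t)) (Xi t) (s + 1)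
  let C : ℝ → Amb m N := fun t => S.conormal (amb (γ t)) (B t)
  let x : ℝ → Amb m N := fun t => S.sec (amb (γ t))
  have hγs : ∀ t ∈ J, ContDiffAt ℝ ∞ (fun y => amb (γ y)) t := fun t ht =>
    contDiffAt_gauge (hK t ht) L₁
  have hx : ∀ t ∈ J, ContDiffAt ℝ ∞ x t := fun t ht =>
    (S.contDiffAt_sec _ (hnd t ht)).comp t (hγs t ht)
  have hXi : ∀ t ∈ J, ContDiffAt ℝ ∞ Xi t := fun t ht => by
    refine contDiffAt_pi.2 fun n => contDiffAt_matrix_mul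
      (contDiffAt_pi.1 (contDiffAt_deriv (hK t ht)) n)
      (contDiffAt_matrix_inv (contDiffAt_pi.1 (hK t ht) n) ?_)
    simp
  have hB : ∀ t ∈ J, ContDiffAt ℝ ∞ B t := fun t ht => contDiffAt_pi.2 fun n =>
    contDiffAt_pi.1 (contDiffAt_rigiditySolve (X := fun y => amb (γ y)) hm hmN (hnd t ht) rfl
      (hγs t ht) (hXi t ht)) (n + 1)
  have hC : ∀ t ∈ J, ContDiffAt ℝ ∞ C t := fun t ht => by
    have hn : ∀ n, ContDiffAt ℝ ∞ (fun y => S.nor (amb (γ y)) n) t := fun n =>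
      contDiffAt_pi.1 ((S.contDiffAt_nor _ (hdom t ht)).comp t (hγs t ht)) n
    refine contDiffAt_pi.2 fun n => contDiffAt_matrix_mul
      (contDiffAt_matrix_inv (contDiffAt_pi.1 (hx t ht) n) ?_)
      (contDiffAt_matrix_mul (contDiffAt_matrix_mul (hn (n + 1)) (contDiffAt_pi.1 (hB t ht) n))
        (contDiffAt_matrix_inv (hn (n + 1)) ?_))
    · obtain ⟨L', hL'⟩ := S.sec_mem _ (hnd t ht)
      rw [hL']
      simp
    · rw [S.det_nor (hdom t ht)]
      exact one_ne_zero
  have hdata : ∀ t ∈ J, ∃ ξ b : ZMod N → 𝔤 m,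
      HasDerivAt (fun y => amb (K y)) (tangent ξ (K t)) t ∧
      (B t = fun n => (b n : Mat m)) ∧ (∀ s, IsNilradical (moment b (γ t) s : Mat m)) ∧
      ∀ s, IsParabolic ((b (s - 1) : Mat m) - (ξ s : Mat m)) := fun t ht => by
    have h1 := ((hK t ht).differentiableAt (by simp)).hasDerivAt
    obtain ⟨ξ, hξ⟩ := exists_eq_tangent h1
    obtain ⟨b, hb1, hb2, hb3⟩ := rigiditySolve_spec hm hmN (hnd t ht) ξ
    rw [hξ] at h1
    refine ⟨ξ, b, h1, funext fun n => ?_, hb2, hb3⟩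
    have h2 : Xi t = fun n => (ξ n : Mat m) := funext fun n => by
      refine (congrArg (· * (amb (K t) n)⁻¹) (congrFun hξ n)).trans ?_
      change (ξ n : Mat m) * (K t n : Mat m) * (K t n : Mat m)⁻¹ = _
      rw [Matrix.mul_assoc, coe_mul_inv, Matrix.mul_one]
    rw [hb1, ← h2]
  have hux : ∀ t ∈ J, ContDiffAt ℝ ∞ (fun y => ℓ (x y)) t := fun t ht =>
    ℓ.contDiff.contDiffAt.comp t (hx t ht)
  obtain ⟨ι, hι, hopen⟩ := exists_smooth_inverse hJo hJc hux hpos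
  -- To first order at the point of time `t`, this is the affine function with covector `C t`
  -- vanishing there. The time is read off by `ι ∘ ℓ`.
  let φ : Amb m N → ℝ := fun X => ∑ n, (C (ι (ℓ X)) n * (X n - x (ι (ℓ X)) n)).trace
  let U : Set (Moduli m N) := W ∩ {q | ℓ (S.onQuot q) ∈ (fun y => ℓ (x y)) '' J}
  have hUn : U ⊆ nondegenerate m N := fun q hq => hWn hq.1
  have hUo : IsOpen U := by
    refine isOpen_iff_mem_nhds.2 fun q hq => Filter.inter_mem (hW.mem_nhds hq.1) ?_
    exact (ContinuousAt.comp (f := S.onQuot) ℓ.continuous.continuousAt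
      (S.continuousAt_onQuot (hUn hq))).preimage_mem_nhds (hopen.mem_nhds hq.2)
  have hφ : SmoothOn (fun q => φ (S.onQuot q)) U := by
    refine S.smoothOn_comp hUn fun L hL => ?_
    obtain ⟨t, ht, htL⟩ := hL.2
    change ℓ (x t) = ℓ (S.onQuot (proj L)) at htL
    rw [S.onQuot_proj] at htL
    have hτ : ContDiffAt ℝ ∞ (fun X => ι (ℓ X)) (S.sec (amb L)) := by
      have h1 := (hι t ht).2
      change ContDiffAt ℝ ∞ ι (ℓ (x t)) at h1
      rw [htL] at h1
      exact h1.comp _ ℓ.contDiff.contDiffAt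
    have hτt : ι (ℓ (S.sec (amb L))) = t := by
      rw [← htL]
      exact (hι t ht).1
    have h1 : ContDiffAt ℝ ∞ (fun X => C (ι (ℓ X))) (S.sec (amb L)) := by
      refine ContDiffAt.comp (g := C) _ ?_ hτ
      rw [hτt]
      exact hC t ht
    have h2 : ContDiffAt ℝ ∞ (fun X => x (ι (ℓ X))) (S.sec (amb L)) := by
      refine ContDiffAt.comp (g := x) _ ?_ hτ
      rw [hτt]
      exact hx t ht
    refine ContDiffAt.sum fun n _ => ContDiffAt.sum fun i _ => ?_
    exact contDiffAt_matrix.1 (contDiffAt_matrix_mul (contDiffAt_pi.1 h1 n)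
      ((contDiffAt_pi.1 contDiffAt_id n).sub (contDiffAt_pi.1 h2 n))) i i
  have hγU : ∀ t ∈ Set.Icc (0 : ℝ) 1, proj (γ t) ∈ U := fun t ht =>
    ⟨hmem t ht, t, h01 ht, by rw [S.onQuot_proj]⟩
  refine ⟨U, fun q => φ (S.onQuot q), fun t => proj (γ t), hUo, Set.inter_subset_left, hφ,
    ⟨fun t ht => ?_, hγU, fun f hf t ht => ?_⟩, rfl, rfl⟩
  · have h1 : ContinuousAt γ t := by
      rw [isInducing_amb.continuousAt_iff]
      exact (hγs t (h01 ht)).continuousAt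
    exact (ContinuousAt.comp (f := γ) continuous_proj.continuousAt h1).continuousWithinAt
  · have htJ := h01 ht
    obtain ⟨ξ, b, hξ, hb1, hb2, hb3⟩ := hdata t htJ
    have hγd := hasDerivWithinAt_gauge (hξ.hasDerivWithinAt (s := Set.Icc 0 1)) L₁
    have hγd' : HasDerivAt (fun y => amb (γ y)) (tangent (gaugeField ξ (γ t)) (γ t)) t :=
      (hasDerivWithinAt_gauge (hξ.hasDerivWithinAt (s := Set.univ)) L₁).hasDerivAt Filter.univ_mem
    have hxd := ((hx t htJ).differentiableAt (by simp)).hasDerivAt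
    have hCd := ((hC t htJ).differentiableAt (by simp)).hasDerivAt
    -- The covector annihilates the velocity of the curve. This makes the dependence of `φ` on time
    -- through the base point `x` contribute nothing to its derivative.
    have hself : pairing b (gaugeField ξ (γ t)) = 0 := by
      rw [← pairing_gaugeField_congr hb2 hb3, pairing_gaugeField_shift hb2]
    have hCt : C t = S.conormal (amb (γ t)) (fun n => (b n : Mat m)) := by
      rw [← hb1]
    have hv : ∑ n, (C t n * deriv x t n).trace = 0 := by
      rw [hCt]
      exact (S.trace_conormal_deriv hγd' (hdom t htJ) hb2 hxd).trans hself
    -- The terms from differentiating `C` vanish since the displacement is zero on the curve, and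
    -- those from `x` vanish by `hv`. What remains is the conormal pairing, which returns `b`.
    have hgrad : leftGrad (fun L => φ (S.onQuot (proj L))) (γ t) = b := by
      refine pairing_ext fun ζ => ?_
      set δ : ℝ → GN m N := fun ε n => expG (ε • ζ n) * γ t n with hδ
      have h0 : δ 0 = γ t := by
        funext n
        simp [hδ, expG_zero]
      have hδd : HasDerivAt (fun y => amb (δ y)) (tangent ζ (δ 0)) 0 := by
        rw [h0]
        exact hasDerivAt_expG_mul ζ (γ t)
      have hsec : ContDiffAt ℝ ∞ S.sec (amb (δ 0)) := by
        rw [h0]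
        exact S.contDiffAt_sec _ (hnd t htJ)
      have hXd := (hsec.differentiableAt (by simp)).hasFDerivAt.comp_hasDerivAt
        (f := fun y => amb (δ y)) 0 hδd
      have hτ : DifferentiableAt ℝ (fun X => ι (ℓ X)) (S.sec (amb (δ 0))) := by
        rw [h0]
        exact (ContDiffAt.comp (f := ℓ) (g := ι) _ (hι t htJ).2
          ℓ.contDiff.contDiffAt).differentiableAt (by simp)
      have hσ := hτ.hasFDerivAt.comp_hasDerivAt (f := fun y => S.sec (amb (δ y))) 0 hXd
      have h1 := hasDerivAt_sum_trace hCd hxd hXd hσ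
        (by change ι (ℓ (S.sec (amb (δ 0)))) = t; rw [h0]; exact (hι t htJ).1)
        (by change S.sec (amb (δ 0)) = _; rw [h0]) hv
      have h2 : ∑ n, (C t n * (fderiv ℝ S.sec (amb (δ 0)) (tangent ζ (δ 0))) n).trace = pairing b ζ := by
        rw [hCt, ← h0]
        exact S.trace_conormal_deriv hδd (by rw [h0]; exact hdom t htJ) (by rw [h0]; exact hb2) hXd
      have h3 := (hφ (γ t) (hγU t ht)).comp h0 (by rw [← h0]; exact hδd.hasDerivWithinAt)
        (s := Set.univ)
      refine (h3.hasDerivAt Filter.univ_mem).unique ((h1.congr_deriv h2).congr_of_eventuallyEq ?_)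
      refine Filter.Eventually.of_forall fun y => ?_
      change φ (S.onQuot (proj (δ y))) = φ (S.sec (amb (δ y)))
      rw [S.onQuot_proj]
    have hinv := isGaugeInvariant_comp_proj (N := N) f
    have h1 := (hf (γ t) (hγU t ht)).comp rfl hγd
    refine h1.congr_deriv ?_
    refine Eq.symm ((reducedBracket_proj hf hφ (hγU t ht)).trans ((twistedBracket_eq hinv
      (isGaugeInvariant_comp_proj fun q => φ (S.onQuot q)) (hf _ (hγU t ht))
      (hφ _ (hγU t ht))).trans ?_))
    rw [hgrad]
    exact Eq.symm <| (pairing_gaugeField_congr (hinv.isNilradical_moment (hf _ (hγU t ht))) hb3).symm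

end TwistedGon

namespace TwistedGon

open Matrix Topology
open scoped ContDiff Matrix.Norms.Elementwise

variable {m N : ℕ}

/-! ### Reversal of trajectories -/

section Reversal

variable [NeZero m] [NeZero N]

omit [NeZero m] in
theorem SmoothAt.neg {F : GN m N → ℝ} {L : GN m N} (hF : SmoothAt F L) :
    SmoothAt (fun L' => -F L') L := by
  obtain ⟨F', h1, h2⟩ := hF
  exact ⟨fun X => -F' X, h1.neg, h2.mono fun L' h => congrArg Neg.neg h⟩

omit [NeZero m] in
theorem SmoothAt.leftGrad_neg {F : GN m N → ℝ} {L : GN m N} (hF : SmoothAt F L) :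
    leftGrad (fun L' => -F L') L = -leftGrad F L := by
  refine pairing_ext fun ζ => ?_
  have h0 : (fun n => expG ((0 : ℝ) • ζ n) * L n) = L := by
    funext n
    simp [expG_zero]
  have h1 := (hF.neg.comp h0 (hasDerivAt_expG_mul ζ L).hasDerivWithinAt
    (s := Set.univ)).hasDerivAt Filter.univ_mem
  have h2 := ((hF.comp h0 (hasDerivAt_expG_mul ζ L).hasDerivWithinAt
    (s := Set.univ)).hasDerivAt Filter.univ_mem).neg
  exact (h1.unique h2).trans (LinearMap.BilinForm.neg_left (B₁ := pairingForm m N) (leftGrad F L) ζ).symm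

theorem reducedBracket_neg {f h : Moduli m N → ℝ} {U : Set (Moduli m N)} (hf : SmoothOn f U)
    (hh : SmoothOn h U) {q : Moduli m N} (hq : q ∈ U) :
    reducedBracket f (fun q => -h q) q = -reducedBracket f h q := by
  obtain ⟨L, rfl⟩ := proj_surjective q
  have hh' : SmoothOn (fun q => -h q) U := fun L hL => (hh L hL).neg
  have i1 := isGaugeInvariant_comp_proj (N := N) f
  rw [reducedBracket_proj hf hh' hq, reducedBracket_proj hf hh hq,
    twistedBracket_eq i1 (isGaugeInvariant_comp_proj h) (hf L hq) (hh L hq)]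
  refine (twistedBracket_eq i1 (isGaugeInvariant_comp_proj fun q => -h q) (hf L hq)
    (hh' L hq)).trans ?_
  rw [(hh L hq).leftGrad_neg, pairing_gaugeField, pairing_gaugeField]
  exact LinearMap.BilinForm.neg_right (B₁ := pairingForm m N) _ _

/-- Running a trajectory backwards corresponds to negating the Hamiltonian. -/
theorem HamiltonianStep.symm {W : Set (Moduli m N)} {p q : Moduli m N}
    (h : HamiltonianStep W p q) : HamiltonianStep W q p := by
  obtain ⟨U, h, c, hU, hUW, hh, hc, h0, h1⟩ := h
  have hmaps : ∀ t ∈ Set.Icc (0 : ℝ) 1, 1 - t ∈ Set.Icc (0 : ℝ) 1 := fun t ht =>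
    ⟨by linarith [ht.2], by linarith [ht.1]⟩
  refine ⟨U, fun q => -h q, fun t => c (1 - t), hU, hUW, fun L hL => (hh L hL).neg,
    ⟨hc.continuousOn.comp (by fun_prop) hmaps, fun t ht => hc.mapsTo _ (hmaps t ht),
      fun f hf t ht => ?_⟩, by simpa using h1, by simpa using h0⟩
  have h2 : HasDerivWithinAt (fun t : ℝ => 1 - t) (-1) (Set.Icc 0 1) t :=
    ((hasDerivAt_id t).const_sub 1).hasDerivWithinAt
  have h3 := (hc.hasDeriv f hf _ (hmaps t ht)).scomp t h2 hmaps
  refine h3.congr_deriv ?_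
  rw [reducedBracket_neg hf hh (hc.mapsTo _ (hmaps t ht)), neg_smul, one_smul]

end Reversal

/-! ### Stabilizers -/

/-- The Lie algebra of the gauge group, as a subspace of `𝔤^N`. -/
def parabolicSubmodule (m N : ℕ) [NeZero m] : Submodule ℝ (ZMod N → 𝔤 m) where
  carrier := {ζ | ∀ n, IsParabolic (ζ n : Mat m)}
  add_mem' h1 h2 n := (h1 n).add (h2 n)
  zero_mem' _ _ _ := rfl
  smul_mem' c _ h n := (h n).smul c

theorem Ad_smul (g : G m) (c : ℝ) (ξ : 𝔤 m) : Ad g (c • ξ) = c • Ad g ξ := by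
  apply Subtype.ext
  simp [coe_Ad]

/-- The infinitesimal gauge action as a linear map. -/
noncomputable def gaugeFieldₗ (L : GN m N) : (ZMod N → 𝔤 m) →ₗ[ℝ] (ZMod N → 𝔤 m) where
  toFun ξ := gaugeField ξ L
  map_add' ξ η := by
    funext n
    simp only [gaugeField, Pi.add_apply, Ad_add]
    abel
  map_smul' c ξ := by
    funext n
    simp only [gaugeField, Pi.smul_apply, Ad_smul, smul_sub, RingHom.id_apply]

/-- The adjoint action of `G^N`. -/
noncomputable def adEquiv (K : GN m N) : (ZMod N → 𝔤 m) ≃ₗ[ℝ] (ZMod N → 𝔤 m) where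
  toFun ξ n := Ad (K n) (ξ n)
  map_add' _ _ := funext fun _ => Ad_add _ _ _
  map_smul' _ _ := funext fun _ => Ad_smul _ _ _
  invFun ξ n := Ad (K n)⁻¹ (ξ n)
  left_inv _ := funext fun _ => Ad_inv_Ad _ _
  right_inv _ := funext fun _ => Ad_Ad_inv _ _

theorem gaugeField_gauge (K L : GN m N) (ξ : ZMod N → 𝔤 m) :
    gaugeField (adEquiv K ξ) (gauge K L) =
      adEquiv (fun n => K (n + 1)) (gaugeField ξ L) := by
  funext n
  change Ad (K (n + 1)) (ξ (n + 1)) - Ad (K (n + 1) * L n * (K n)⁻¹) (Ad (K n) (ξ n)) =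
    Ad (K (n + 1)) (ξ (n + 1) - Ad (L n) (ξ n))
  rw [Ad_mul, Ad_inv_Ad, Ad_mul, Ad_sub]

variable [NeZero m] [NeZero N]

/-- This is rigidity with zero nilradical part: the action of `H^N` on nondegenerate polygons is
locally free. -/
theorem disjoint_parabolic_stabilizer (hm : 2 ≤ m) (hmN : Nat.Coprime m N) {L : GN m N}
    (hL : PolygonNondegenerate L) :
    Disjoint (parabolicSubmodule m N) (LinearMap.ker (gaugeFieldₗ L)) := by
  rw [Submodule.disjoint_def]
  intro ζ hζ h
  have h1 := eq_zero_of_parabolic_of_nilradical hm hmN hL (ζ := fun n => (ζ n : Mat m)) (ν := 0)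
    (fun s => trace_coe _) hζ (fun s i j _ => rfl) fun s => by
      have h2 : (ζ (s + 1) : Mat m) - (L s : Mat m) * (ζ s : Mat m) * (L s : Mat m)⁻¹ = 0 :=
        congrArg Subtype.val (congrFun (LinearMap.mem_ker.1 h) s)
      rw [Pi.zero_apply, sub_zero]
      exact sub_eq_zero.1 h2
  exact funext fun n => Subtype.ext (congrFun h1 n)

/-- If the gauge orbit of `H^N` is locally the full gauge orbit of `G^N` at one nondegenerate point,
then so it is at every other nondegenerate point of the gauge orbit of `G^N`. -/
theorem exists_gaugeField_eq_gauge (hm : 2 ≤ m) (hmN : Nat.Coprime m N) {L K : GN m N}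
    (hL : PolygonNondegenerate L) (hL' : PolygonNondegenerate (gauge K L))
    (h : ∀ ξ : ZMod N → 𝔤 m, ∃ η ∈ parabolicSubmodule m N, gaugeField ξ L = gaugeField η L)
    (ξ : ZMod N → 𝔤 m) :
    ∃ η ∈ parabolicSubmodule m N, gaugeField ξ (gauge K L) = gaugeField η (gauge K L) := by
  have hsup : parabolicSubmodule m N ⊔ LinearMap.ker (gaugeFieldₗ L) = ⊤ := by
    refine eq_top_iff.2 fun ξ _ => ?_
    obtain ⟨η, hη, h1⟩ := h ξ
    refine Submodule.mem_sup.2 ⟨η, hη, ξ - η, ?_, add_sub_cancel _ _⟩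
    rw [LinearMap.mem_ker, map_sub]
    exact sub_eq_zero.2 h1
  have hdim := Submodule.finrank_add_eq_of_isCompl
    ⟨disjoint_parabolic_stabilizer hm hmN hL, codisjoint_iff.2 hsup⟩
  have hle : (LinearMap.ker (gaugeFieldₗ L)).map (adEquiv K : (ZMod N → 𝔤 m) →ₗ[ℝ] _) ≤
      LinearMap.ker (gaugeFieldₗ (gauge K L)) := by
    rintro _ ⟨ζ, hζ, rfl⟩
    refine LinearMap.mem_ker.2 ?_
    have h1 : gaugeField ζ L = 0 := LinearMap.mem_ker.1 hζ
    refine (gaugeField_gauge K L ζ).trans ?_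
    rw [h1, map_zero]
  have hfin := Submodule.finrank_mono hle
  -- The stabilizer at `gauge K L` contains the conjugate of that at `L`, so its dimension is at
  -- least complementary to the parabolic part. Being disjoint from the latter, the two span
  -- everything.
  rw [LinearEquiv.finrank_map_eq] at hfin
  have hsup' := Submodule.eq_top_of_disjoint _ _ (by omega)
    (disjoint_parabolic_stabilizer hm hmN hL')
  obtain ⟨η, hη, ζ, hζ, h1⟩ := Submodule.mem_sup.1 (hsup'.symm ▸ Submodule.mem_top : ξ ∈ _)
  refine ⟨η, hη, ?_⟩
  have h2 := map_add (gaugeFieldₗ (gauge K L)) η ζ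
  rw [h1, LinearMap.mem_ker.1 hζ, add_zero] at h2
  exact h2

/-! ### A chart of `G^N` -/

/-- A chart of `G^N` around the identity. -/
noncomputable def chart (Y : Amb m N) : GN m N := fun n => toSL (1 + Y n)

omit [NeZero N] in
theorem chart_sub_one (K : GN m N) : chart (fun n => (K n : Mat m) - 1) = K := by
  funext n
  apply Subtype.ext
  simp only [chart, add_sub_cancel]
  have h1 : (K n : Mat m).det = 1 := (K n).2
  rw [coe_toSL (NeZero.ne m) (by rw [h1]; exact one_pos), h1, Real.one_rpow, one_smul]

omit [NeZero N] in
theorem chart_zero : chart (0 : Amb m N) = 1 := by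
  rw [← chart_sub_one 1]
  congr 1
  funext n
  exact (sub_self (1 : Mat m)).symm

theorem contDiffAt_chart {Y : Amb m N} (hY : ∀ n, 0 < (1 + Y n).det) :
    ContDiffAt ℝ ∞ (fun Y => amb (chart Y)) Y := by
  refine contDiffAt_pi.2 fun n => ?_
  have h1 : ContDiffAt ℝ ∞ (fun Y : Amb m N => 1 + Y n) Y :=
    contDiffAt_const.add (contDiffAt_pi.1 contDiffAt_id n)
  have h2 := contDiffAt_matrix_det h1
  refine ((h2.rpow_const_of_ne (p := -(1 / (m : ℝ))) (hY n).ne').smul h1).congr_of_eventuallyEq ?_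
  filter_upwards [h2.continuousAt.eventually (lt_mem_nhds (hY n))] with X hX
  exact coe_toSL (NeZero.ne m) hX

/-- Near a point where `g` has a positive derivative in some direction, there is a point such that
`g` increases along all segments that end there and start near the given point. -/
theorem exists_increasing_segments {E : Type*} [NormedAddCommGroup E] [NormedSpace ℝ E] {g : E → ℝ}
    {R : ℝ} (hR : 0 < R) (hg : ∀ Y ∈ Metric.ball 0 R, ContDiffAt ℝ ∞ g Y) {ξ : E}
    (hξ : 0 < fderiv ℝ g 0 ξ) : ∃ r, 0 < r ∧ r ≤ R ∧ ∃ Z ∈ Metric.ball 0 r, ∃ r₁, 0 < r₁ ∧ r₁ ≤ r ∧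
      ∀ Y ∈ Metric.ball (0 : E) r₁, ∀ t : ℝ, Y + t • (Z - Y) ∈ Metric.ball 0 r →
        0 < deriv (fun s : ℝ => g (Y + s • (Z - Y))) t := by
  have h0 : ContinuousAt (fun p : E × E => fderiv ℝ g p.1 p.2) (0, ξ) := by
    have h1 : ContinuousAt (fderiv ℝ g) 0 :=
      (hg 0 (Metric.mem_ball_self hR)).continuousAt_fderiv (by simp)
    exact (ContinuousAt.comp (f := Prod.fst) h1 continuousAt_fst).clm_apply continuousAt_snd
  have h1 : ∀ᶠ p in 𝓝 ((0 : E), ξ), 0 < fderiv ℝ g p.1 p.2 := h0.eventually (lt_mem_nhds hξ)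
  rw [nhds_prod_eq, Filter.eventually_prod_iff] at h1
  obtain ⟨pa, hpa, pb, hpb, hab⟩ := h1
  obtain ⟨r, hr, hra⟩ := Metric.eventually_nhds_iff_ball.1 hpa
  obtain ⟨ρ, hρ, hρb⟩ := Metric.eventually_nhds_iff_ball.1 hpb
  -- The endpoint will be `Z = δ ξ`. For `‖Y‖ < δ ρ` the direction `Z - Y = δ (ξ - Y / δ)` is within
  -- `ρ` of `ξ` up to the positive factor `δ`, which keeps the derivative positive.
  obtain ⟨δ, hδ, hδξ⟩ : ∃ δ : ℝ, 0 < δ ∧ δ * ‖ξ‖ < min r R := by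
    refine ⟨min r R / (‖ξ‖ + 1), by positivity, ?_⟩
    rw [div_mul_eq_mul_div, div_lt_iff₀ (by positivity)]
    have : 0 < min r R := by positivity
    nlinarith
  refine ⟨min r R, by positivity, min_le_right _ _, δ • ξ, ?_, min (min r R) (δ * ρ), by positivity,
    min_le_left _ _, fun Y hY t ht => ?_⟩
  · rw [mem_ball_zero_iff, norm_smul, Real.norm_of_nonneg hδ.le]
    exact hδξ
  · rw [mem_ball_zero_iff] at hY ht
    have hYt : Y + t • (δ • ξ - Y) ∈ Metric.ball (0 : E) R :=
      mem_ball_zero_iff.2 (ht.trans_le (min_le_right _ _))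
    have h2 : HasDerivAt (fun s : ℝ => Y + s • (δ • ξ - Y)) (δ • ξ - Y) t := by
      simpa using ((hasDerivAt_id t).smul_const (δ • ξ - Y)).const_add Y
    have h3 := ((hg _ hYt).differentiableAt (by simp)).hasFDerivAt.comp_hasDerivAt
      (f := fun s : ℝ => Y + s • (δ • ξ - Y)) t h2
    have h4 : δ • ξ - Y = δ • (ξ - δ⁻¹ • Y) := by
      rw [smul_sub, smul_inv_smul₀ hδ.ne']
    have h5 : 0 < fderiv ℝ g (Y + t • (δ • ξ - Y)) (ξ - δ⁻¹ • Y) := by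
      refine hab (hra _ (mem_ball_zero_iff.2 (ht.trans_le (min_le_left _ _)))) (hρb _ ?_)
      rw [mem_ball_iff_norm, sub_sub_cancel_left, norm_neg, norm_smul, norm_inv,
        Real.norm_of_nonneg hδ.le, inv_mul_lt_iff₀ hδ]
      exact hY.trans_le (min_le_right _ _)
    have h6 : deriv (fun s : ℝ => g (Y + s • (δ • ξ - Y))) t =
        fderiv ℝ g (Y + t • (δ • ξ - Y)) (δ • ξ - Y) := h3.deriv
    have h7 : fderiv ℝ g (Y + t • (δ • ξ - Y)) (δ • ξ - Y) =
        δ * fderiv ℝ g (Y + t • (δ • ξ - Y)) (ξ - δ⁻¹ • Y) :=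
      (congrArg (fderiv ℝ g (Y + t • (δ • ξ - Y))) h4).trans (map_smul _ δ _)
    rw [h6, h7]
    exact mul_pos hδ h5

end TwistedGon

/-! ### The leaf contains the projections of nearby points of the gauge orbit. -/

namespace TwistedGon

open Matrix Topology
open scoped ContDiff Matrix.Norms.Elementwise

variable {m N : ℕ} [NeZero m] [NeZero N]

theorem exists_pos_functional {E : Type*} [NormedAddCommGroup E] [NormedSpace ℝ E] {v : E}
    (hv : v ≠ 0) : ∃ ℓ : E →L[ℝ] ℝ, 0 < ℓ v := by
  obtain ⟨ℓ, hℓ⟩ := SeparatingDual.exists_ne_zero (R := ℝ) hv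
  rcases lt_or_gt_of_ne hℓ with h | h
  · exact ⟨-ℓ, neg_pos.2 h⟩
  · exact ⟨ℓ, h⟩

theorem hasDerivAt_smul_right {E : Type*} [NormedAddCommGroup E] [NormedSpace ℝ E] (v : E) (t : ℝ) :
    HasDerivAt (fun t : ℝ => t • v) v t := by
  simpa using (hasDerivAt_id t).smul_const v

omit [NeZero m] in
theorem hasDerivAt_gauge_expG (ξ : ZMod N → 𝔤 m) (L : GN m N) :
    HasDerivAt (fun ε : ℝ => amb (gauge (fun n => expG (ε • ξ n)) L))
      (tangent (gaugeField ξ L) L) 0 := by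
  have h1 := hasDerivWithinAt_gauge (hasDerivWithinAt_expG ξ) L
  have h0 : gauge (fun n => expG ((0 : ℝ) • ξ n)) L = L := by
    simp only [zero_smul, expG_zero, gauge_one]
  rw [h0] at h1
  exact h1.hasDerivAt Filter.univ_mem

variable {L₀ : GN m N}

theorem LocalSection.proj_eq_of_sec_eq (S : LocalSection L₀) {L : GN m N} (hL : L ∈ S.dom)
    (h : S.sec (amb L) = amb L₀) : proj L = proj L₀ := by
  obtain ⟨κ, hκ, -, h3⟩ := S.nor_spec L hL
  rw [← proj_gauge hκ, amb_injective (h3.trans h)]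

/-- If the section is stationary at `L₀` along the gauge orbit of `G^N`, then its derivative along
this orbit vanishes at every nondegenerate point. -/
theorem LocalSection.fderiv_sec_gaugeField (hm : 2 ≤ m) (hmN : Nat.Coprime m N)
    (S : LocalSection L₀) (hL₀ : ∀ ξ : ZMod N → 𝔤 m, HasDerivAt (fun ε : ℝ =>
      S.sec (amb (gauge (fun n => expG (ε • ξ n)) L₀))) 0 0)
    {K : GN m N} (hK : PolygonNondegenerate (gauge K L₀)) (ξ : ZMod N → 𝔤 m) :
    fderiv ℝ S.sec (amb (gauge K L₀)) (tangent (gaugeField ξ (gauge K L₀)) (gauge K L₀)) = 0 := by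
  have h1 : ∀ ξ : ZMod N → 𝔤 m, ∃ η ∈ parabolicSubmodule m N,
      gaugeField ξ L₀ = gaugeField η L₀ := fun ξ => by
    have h0 : gauge (fun n => expG ((0 : ℝ) • ξ n)) L₀ = L₀ := by
      simp only [zero_smul, expG_zero, gauge_one]
    have h2 := hasDerivAt_gauge_expG ξ L₀
    obtain ⟨η, hη, h3⟩ := S.exists_gaugeField_eq
      (δ := fun ε : ℝ => gauge (fun n => expG (ε • ξ n)) L₀) (t := 0) (ζ := gaugeField ξ L₀)
      (by beta_reduce; rw [h0]; exact h2) (by rw [h0]; exact S.mem_dom) (hL₀ ξ)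
    rw [h0] at h3
    refine ⟨-η, (parabolicSubmodule m N).neg_mem hη, ?_⟩
    rw [eq_neg_of_add_eq_zero_left h3]
    exact ((gaugeFieldₗ L₀).map_neg η).symm
  obtain ⟨η, hη, h2⟩ := exists_gaugeField_eq_gauge hm hmN (S.nondeg _ S.mem_dom) hK h1 ξ
  rw [h2]
  have h0 : gauge (fun n => expG ((0 : ℝ) • η n)) (gauge K L₀) = gauge K L₀ := by
    simp only [zero_smul, expG_zero, gauge_one]
  have h3 : HasFDerivAt S.sec (fderiv ℝ S.sec (amb (gauge K L₀)))
      (amb (gauge (fun n => expG ((0 : ℝ) • η n)) (gauge K L₀))) := by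
    rw [h0]
    exact ((S.contDiffAt_sec _ hK).differentiableAt (by simp)).hasFDerivAt
  have h4 := h3.comp_hasDerivAt (f := fun ε : ℝ => amb (gauge (fun n => expG (ε • η n)) (gauge K L₀)))
    0 (hasDerivAt_gauge_expG η (gauge K L₀))
  refine h4.unique ((hasDerivAt_const (0 : ℝ) (S.sec (amb (gauge K L₀)))).congr_of_eventuallyEq
    (Filter.Eventually.of_forall fun ε => ?_))
  exact S.sec_gauge _ _ fun n => expG_mem_H (hη n) ε

/-- All points of the gauge orbit of `G^N` near `L₀` project into the symplectic leaf. -/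
theorem eventually_gauge_mem_leaf (hm : 2 ≤ m) (hmN : Nat.Coprime m N) {W : Set (Moduli m N)}
    (hW : IsOpen W) (hWn : W ⊆ nondegenerate m N) (h0 : proj L₀ ∈ W) :
    ∀ᶠ K in 𝓝 (1 : GN m N), proj (gauge K L₀) ∈ symplecticLeaf W (proj L₀) := by
  obtain ⟨S⟩ := nonempty_localSection (by omega) hmN (proj_mem_nondegenerate.1 (hWn h0))
  have hg1 : gauge (1 : GN m N) L₀ = L₀ := gauge_one L₀
  have hdet0 : ∀ n, 0 < (1 + (0 : Amb m N) n).det := fun n => by simp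
  have hev : ∀ᶠ Y in 𝓝 (0 : Amb m N), (∀ n, 0 < (1 + Y n).det) ∧
      gauge (chart Y) L₀ ∈ S.dom ∧ proj (gauge (chart Y) L₀) ∈ W := by
    refine Filter.Eventually.and (Filter.eventually_all.2 fun n => ?_) ?_
    · have h1 : ContDiffAt ℝ ∞ (fun Y : Amb m N => 1 + Y n) 0 :=
        contDiffAt_const.add (contDiffAt_pi.1 contDiffAt_id n)
      exact (contDiffAt_matrix_det h1).continuousAt.eventually (lt_mem_nhds (hdet0 n))
    · have h1 : ContinuousAt (fun Y : Amb m N => gauge (chart Y) L₀) 0 := by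
        rw [isInducing_amb.continuousAt_iff]
        exact (contDiffAt_gauge (contDiffAt_chart hdet0) L₀).continuousAt
      have h2 : gauge (chart (0 : Amb m N)) L₀ = L₀ := by rw [chart_zero, hg1]
      exact h1.eventually (Filter.inter_mem
        (S.isOpen_dom.mem_nhds (by beta_reduce; rw [h2]; exact S.mem_dom))
        ((hW.preimage continuous_proj).mem_nhds (by rw [Set.mem_preimage]; beta_reduce; rw [h2]; exact h0)))
  obtain ⟨R, hR, hball⟩ := Metric.eventually_nhds_iff_ball.1 hev
  have hK : ∀ Y ∈ Metric.ball (0 : Amb m N) R, ContDiffAt ℝ ∞ (fun Y => amb (chart Y)) Y :=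
    fun Y hY => contDiffAt_chart (hball Y hY).1
  let Θ : Amb m N → Amb m N := fun Y => S.sec (amb (gauge (chart Y) L₀))
  have hΘ : ∀ Y ∈ Metric.ball (0 : Amb m N) R, ContDiffAt ℝ ∞ Θ Y := fun Y hY =>
    (S.contDiffAt_sec _ (S.nondeg _ (hball Y hY).2.1)).comp Y (contDiffAt_gauge (hK Y hY) L₀)
  -- it is enough to reach the points in a small ball of the chart
  suffices h : ∃ r₁ > 0, ∀ Y ∈ Metric.ball (0 : Amb m N) r₁,
      proj (gauge (chart Y) L₀) ∈ symplecticLeaf W (proj L₀) by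
    obtain ⟨r₁, hr₁, h⟩ := h
    have h1 : Continuous fun K : GN m N => (fun n => (K n : Mat m) - 1 : Amb m N) :=
      continuous_pi fun n => ((continuous_apply n).comp continuous_amb).sub continuous_const
    have h2 : (fun n => ((1 : GN m N) n : Mat m) - 1 : Amb m N) = 0 :=
      funext fun n => sub_self (1 : Mat m)
    have h3 := h1.continuousAt (x := (1 : GN m N))
    have h4 := h3.eventually (Metric.isOpen_ball.mem_nhds (x := _) (s := Metric.ball (0 : Amb m N) r₁)
      (by beta_reduce; rw [h2]; exact Metric.mem_ball_self hr₁))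
    filter_upwards [h4] with K hK
    have := h _ hK
    rwa [chart_sub_one] at this
  have hR0 : (0 : Amb m N) ∈ Metric.ball (0 : Amb m N) R := Metric.mem_ball_self hR
  have hΘ0 := ((hΘ 0 hR0).differentiableAt (by simp)).hasFDerivAt
  -- If the projected orbit moves at `L₀` in some direction, a functional detects it, and segments
  -- towards a common endpoint `Z` are Hamiltonian.
  by_cases hcase : ∃ ξ, fderiv ℝ Θ 0 ξ ≠ 0
  · obtain ⟨ξ, hξ⟩ := hcase
    obtain ⟨ℓ, hℓ⟩ := exists_pos_functional hξ
    have hg : ∀ Y ∈ Metric.ball (0 : Amb m N) R, ContDiffAt ℝ ∞ (fun Y => ℓ (Θ Y)) Y :=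
      fun Y hY => ℓ.contDiff.contDiffAt.comp Y (hΘ Y hY)
    have hder : 0 < fderiv ℝ (fun Y => ℓ (Θ Y)) 0 ξ := by
      have h1 : HasFDerivAt (fun Y => ℓ (Θ Y)) (ℓ.comp (fderiv ℝ Θ 0)) 0 :=
        ℓ.hasFDerivAt.comp 0 hΘ0
      rw [h1.fderiv]
      exact hℓ
    obtain ⟨r, hr, hrR, Z, hZ, r₁, hr₁, hr₁r, hseg⟩ := exists_increasing_segments hR hg hder
    have hstep : ∀ Y ∈ Metric.ball (0 : Amb m N) r₁,
        HamiltonianStep W (proj (gauge (chart Y) L₀)) (proj (gauge (chart Z) L₀)) := fun Y hY => by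
      have hYr : Y ∈ Metric.ball (0 : Amb m N) r := Metric.ball_subset_ball hr₁r hY
      let line : ℝ → Amb m N := fun t => Y + t • (Z - Y)
      have hline : ContDiff ℝ ∞ line :=
        contDiff_const.add (contDiff_id.smul contDiff_const)
      let J : Set ℝ := line ⁻¹' Metric.ball 0 r
      have hJR : ∀ t ∈ J, line t ∈ Metric.ball (0 : Amb m N) R := fun t ht =>
        Metric.ball_subset_ball hrR ht
      have h01 : Set.Icc 0 1 ⊆ J := fun t ht => by
        have h1 := (convex_ball (0 : Amb m N) r).add_smul_sub_mem hYr hZ ht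
        exact h1
      have hJc : Convex ℝ J := by
        have h1 : line = AffineMap.lineMap Y Z := by
          funext t
          rw [AffineMap.lineMap_apply_module', add_comm]
        change Convex ℝ (line ⁻¹' _)
        rw [h1]
        exact (convex_ball (0 : Amb m N) r).affine_preimage _
      have h2 := S.hamiltonianStep_of_curve hm hmN hW hWn (L₁ := L₀) (K := fun t => chart (line t))
        (J := J) (Metric.isOpen_ball.preimage hline.continuous) hJc h01
        (fun t ht => (hK _ (hJR t ht)).comp t hline.contDiffAt)
        (fun t ht => (hball _ (hJR t ht)).2.1) (fun t ht => (hball _ (hJR t (h01 ht))).2.2) ℓ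
        (fun t ht => hseg Y hY t ht)
      have e0 : line 0 = Y := by simp [line]
      have e1 : line 1 = Z := by simp [line]
      rw [e0, e1] at h2
      exact h2
    refine ⟨r₁, hr₁, fun Y hY => ?_⟩
    have h1 := hstep 0 (Metric.mem_ball_self hr₁)
    rw [chart_zero, hg1] at h1
    -- A direct segment from `L₀` to `Y` need not increase `ℓ`; the detour goes up to `Z` and then
    -- backwards to `Y`.
    exact (Relation.ReflTransGen.single h1).tail (hstep Y hY).symm
  -- If the section is stationary at `L₀`, all gauge directions of `G^N` there are directions of
  -- `H^N`. The dimension count carries this to the whole nearby orbit, so its projection is a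
  -- single point.
  · push Not at hcase
    have hbase : ∀ ξ : ZMod N → 𝔤 m, HasDerivAt (fun ε : ℝ =>
        S.sec (amb (gauge (fun n => expG (ε • ξ n)) L₀))) 0 0 := fun ξ => by
      let Y : ℝ → Amb m N := fun ε n => (expG (ε • ξ n) : Mat m) - 1
      have hY0 : Y 0 = 0 := funext fun n => by
        simp only [Y]
        rw [zero_smul, expG_zero]
        exact sub_self (1 : Mat m)
      have hYd : HasDerivAt Y (fun n => (ξ n : Mat m)) 0 :=
        hasDerivAt_pi.2 fun n => (hasDerivAt_expG (ξ n)).sub_const 1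
      have h1 : HasFDerivAt Θ (fderiv ℝ Θ 0) (Y 0) := by
        rw [hY0]
        exact hΘ0
      have h2 := (h1.comp_hasDerivAt (f := Y) 0 hYd).congr_deriv (hcase _)
      refine h2.congr_of_eventuallyEq (Filter.Eventually.of_forall fun ε => ?_)
      change _ = S.sec (amb (gauge (chart (Y ε)) L₀))
      rw [chart_sub_one fun n => expG (ε • ξ n)]
    refine ⟨R, hR, fun Y hY => ?_⟩
    have hseg : ∀ t ∈ Set.Icc (0 : ℝ) 1, t • Y ∈ Metric.ball (0 : Amb m N) R := fun t ht => by
      rw [mem_ball_zero_iff] at hY ⊢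
      rw [norm_smul, Real.norm_of_nonneg ht.1]
      exact (mul_le_of_le_one_left (norm_nonneg Y) ht.2).trans_lt hY
    have hder : ∀ t ∈ Set.Icc (0 : ℝ) 1, HasDerivAt (fun t : ℝ => Θ (t • Y)) 0 t := fun t ht => by
      have hl : HasDerivAt (fun t : ℝ => t • Y) Y t := hasDerivAt_smul_right Y t
      have h1 := ((hK _ (hseg t ht)).differentiableAt (by simp)).hasFDerivAt.comp_hasDerivAt
        (f := fun t : ℝ => t • Y) t hl
      obtain ⟨ξ, hξ⟩ := exists_eq_tangent (δ := fun t : ℝ => chart (t • Y)) h1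
      rw [hξ] at h1
      have h2 := (hasDerivWithinAt_gauge (K := fun t : ℝ => chart (t • Y))
        h1.hasDerivWithinAt (s := Set.univ) L₀).hasDerivAt Filter.univ_mem
      have hnd := S.nondeg _ (hball _ (hseg t ht)).2.1
      have h3 := ((S.contDiffAt_sec _ hnd).differentiableAt (by simp)).hasFDerivAt.comp_hasDerivAt
        (f := fun t : ℝ => amb (gauge (chart (t • Y)) L₀)) t h2
      exact h3.congr_deriv (S.fderiv_sec_gaugeField hm hmN hbase hnd ξ)
    have hconst := constant_of_has_deriv_right_zero (f := fun t : ℝ => Θ (t • Y)) (a := 0) (b := 1)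
      (fun t ht => (hder t ht).continuousAt.continuousWithinAt)
      (fun t ht => (hder t ⟨ht.1, ht.2.le⟩).hasDerivWithinAt) 1 ⟨zero_le_one, le_rfl⟩
    have h1 : Θ Y = amb L₀ := by
      simp only [one_smul, zero_smul] at hconst
      rw [hconst]
      simp only [Θ]
      rw [chart_zero, hg1, S.sec_base]
    rw [S.proj_eq_of_sec_eq (hball Y hY).2.1 h1]
    exact Relation.ReflTransGen.refl

end TwistedGon

namespace TwistedGon

open Matrix Topology
open scoped ContDiff Matrix.Norms.Elementwise

variable {m N : ℕ}

/-! ### Conjugating by elements near the identity -/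

/-- The linear operator `X ↦ T X - X T₀`. -/
def intertwiner (T T₀ : Mat m) : Mat m →ₗ[ℝ] Mat m where
  toFun X := T * X - X * T₀
  map_add' X Y := by rw [Matrix.mul_add, Matrix.add_mul]; abel
  map_smul' c X := by
    rw [Matrix.mul_smul, Matrix.smul_mul, RingHom.id_apply, smul_sub]

theorem exists_generalized_inverse {E : Type*} [AddCommGroup E] [Module ℝ E] (A : E →ₗ[ℝ] E) :
    ∃ S : E →ₗ[ℝ] E, ∀ x, A (S (A x)) = A x := by
  obtain ⟨s, hs⟩ := A.rangeRestrict.exists_rightInverse_of_surjective A.range_rangeRestrict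
  obtain ⟨S, hS⟩ := s.exists_extend
  refine ⟨S, fun x => ?_⟩
  have h1 : S (A x) = s (A.rangeRestrict x) := DFunLike.congr_fun hS (A.rangeRestrict x)
  rw [h1]
  exact congrArg Subtype.val (DFunLike.congr_fun hs (A.rangeRestrict x))

variable [NeZero m]

omit [NeZero m] in
theorem det_one_pos : 0 < (1 : Mat m).det := by simp

/-- Normalization to determinant one is continuous at the identity. -/
theorem continuousAt_toSL_one : ContinuousAt (toSL : Mat m → G m) 1 := by
  have h1 : IsInducing ((↑) : G m → Mat m) := IsInducing.subtypeVal
  refine h1.continuousAt_iff.2 ?_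
  have h2 : ContDiffAt ℝ ∞ (fun X : Mat m => X.det) 1 := contDiffAt_matrix_det contDiffAt_id
  have h3 : ContDiffAt ℝ ∞ (fun X : Mat m => X.det ^ (-(1 / (m : ℝ))) • X) 1 :=
    (h2.rpow_const_of_ne det_one_pos.ne').smul contDiffAt_id
  refine h3.continuousAt.congr ?_
  filter_upwards [h2.continuousAt.eventually (lt_mem_nhds det_one_pos)] with X hX
  exact (coe_toSL (NeZero.ne m) hX).symm

/-- A matrix near `T₀` in the conjugacy class of `T₀` is conjugate to `T₀` by an element near the
identity. -/
theorem eventually_exists_conj (T₀ : G m) {O : Set (G m)} (hO : O ∈ 𝓝 1) :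
    ∀ᶠ T in 𝓝 T₀, IsConj T₀ T → ∃ g ∈ O, T = g * T₀ * g⁻¹ := by
  obtain ⟨S, hS⟩ := exists_generalized_inverse (intertwiner (T₀ : Mat m) T₀)
  let A₀ := intertwiner (T₀ : Mat m) (T₀ : Mat m)
  have hA1 : A₀ 1 = 0 := by
    change (T₀ : Mat m) * 1 - 1 * (T₀ : Mat m) = 0
    rw [Matrix.mul_one, Matrix.one_mul, sub_self]
  -- With `A₀ S A₀ = A₀`, the map `id - S A₀` projects onto the centralizer of `T₀`. At `T₀` the
  -- operator `Φ` is the identity, so near `T₀` it is invertible and `w = Φ_T⁻¹ 1` is close to `1`.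
  let Φ : Mat m → Mat m →ₗ[ℝ] Mat m := fun T =>
    LinearMap.id - S ∘ₗ A₀ + S ∘ₗ intertwiner T (T₀ : Mat m)
  have hΦ₀ : Φ (T₀ : Mat m) = LinearMap.id := sub_add_cancel _ _
  have hΦs : ∀ Y, ContDiffAt ℝ ∞ (fun T => Φ T Y) (T₀ : Mat m) := fun Y => by
    refine contDiffAt_const.add ?_
    have h1 : ContDiffAt ℝ ∞ (fun T => intertwiner T (T₀ : Mat m) Y) (T₀ : Mat m) :=
      (contDiffAt_matrix_mul contDiffAt_id contDiffAt_const).sub contDiffAt_const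
    exact (LinearMap.toContinuousLinearMap S).contDiff.contDiffAt.comp _ h1
  have hinj : Function.Injective (Φ (T₀ : Mat m)) := by
    rw [hΦ₀]
    exact Function.injective_id
  have hw := (contDiffAt_invFun hΦs hinj (contDiffAt_const (c := (1 : Mat m)))).continuousAt
  have hw0 : Function.invFun (Φ (T₀ : Mat m)) 1 = 1 := by
    have h1 := Function.leftInverse_invFun hinj (1 : Mat m)
    rw [hΦ₀] at h1 ⊢
    exact h1
  have hdet : ∀ᶠ X in 𝓝 (1 : Mat m), 0 < X.det ∧ toSL X ∈ O := by
    refine Filter.Eventually.and ?_ ?_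
    · exact (contDiffAt_matrix_det (k := 0) contDiffAt_id).continuousAt.eventually
        (lt_mem_nhds det_one_pos)
    · refine continuousAt_toSL_one.eventually ?_
      have h1 : toSL (1 : Mat m) = 1 := by
        apply Subtype.ext
        rw [coe_toSL (NeZero.ne m) det_one_pos, Matrix.det_one, Real.one_rpow, one_smul]
        rfl
      rw [h1]
      exact hO
  have hev : ∀ᶠ T in 𝓝 (T₀ : Mat m), (0 < (Function.invFun (Φ T) 1).det ∧
      toSL (Function.invFun (Φ T) 1) ∈ O) ∧ Function.Injective (Φ T) := by
    refine Filter.Eventually.and (hw.eventually (by beta_reduce; rw [hw0]; exact hdet)) ?_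
    filter_upwards [eventually_exists_equiv hΦs hinj] with T ⟨A, hA⟩
    have hA' : ⇑(Φ T) = A := funext fun y => (DFunLike.congr_fun hA y).symm
    rw [hA']
    exact A.injective
  filter_upwards [continuous_subtype_val.continuousAt.eventually hev] with T ⟨⟨h1, h2⟩, h3⟩ hconj
  obtain ⟨h, hh⟩ := isConj_iff.1 hconj
  have hT : (T : Mat m) * (h : Mat m) = (h : Mat m) * (T₀ : Mat m) := by
    rw [← coe_mul_eq, ← coe_mul_eq, ← hh, inv_mul_cancel_right]
  have hker : ∀ X, A₀ X = 0 → intertwiner (T : Mat m) (T₀ : Mat m) ((h : Mat m) * X) = 0 := by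
    intro X hX
    have hX' : (T₀ : Mat m) * X = X * (T₀ : Mat m) := sub_eq_zero.1 hX
    change (T : Mat m) * ((h : Mat m) * X) - (h : Mat m) * X * (T₀ : Mat m) = 0
    rw [← Matrix.mul_assoc, hT, Matrix.mul_assoc, hX', ← Matrix.mul_assoc, sub_self]
  have hP : ∀ X, A₀ (X - S (A₀ X)) = 0 := fun X => by
    rw [map_sub, hS, sub_self]
  -- The solutions of `T X = X T₀` are `h` times the centralizer of `T₀`, and on them `Φ_T`
  -- coincides with the projection. Being injective between spaces of equal dimension, `ψ` hits `1`;
  -- hence `w` itself is an intertwiner.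
  let ψ : LinearMap.ker A₀ →ₗ[ℝ] LinearMap.ker A₀ :=
    LinearMap.codRestrict _ ((LinearMap.id - S ∘ₗ A₀) ∘ₗ LinearMap.mulLeft ℝ (h : Mat m) ∘ₗ
      (LinearMap.ker A₀).subtype) fun X =>
        LinearMap.mem_ker.2 (hP ((h : Mat m) * (X : Mat m)))
  have hψΦ : ∀ X : LinearMap.ker A₀, (ψ X : Mat m) = Φ T ((h : Mat m) * (X : Mat m)) := fun X => by
    have h4 := hker X X.2
    change (h : Mat m) * (X : Mat m) - S (A₀ ((h : Mat m) * (X : Mat m))) =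
      (h : Mat m) * (X : Mat m) - S (A₀ ((h : Mat m) * (X : Mat m))) +
        S (intertwiner (T : Mat m) (T₀ : Mat m) ((h : Mat m) * (X : Mat m)))
    rw [h4, map_zero, add_zero]
  have hψ : Function.Injective ψ := fun X Y hXY => by
    have h4 := h3 (((hψΦ X).symm.trans (congrArg Subtype.val hXY)).trans (hψΦ Y))
    have h5 := congrArg (fun Z => (h : Mat m)⁻¹ * Z) h4
    simp only [← Matrix.mul_assoc, coe_inv_mul, Matrix.one_mul] at h5
    exact Subtype.ext h5
  obtain ⟨X, hX⟩ := LinearMap.surjective_of_injective hψ ⟨1, hA1⟩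
  have hΦX : Φ T ((h : Mat m) * (X : Mat m)) = 1 := (hψΦ X).symm.trans (congrArg Subtype.val hX)
  have hinv : Function.invFun (Φ T) 1 = (h : Mat m) * (X : Mat m) := by
    rw [← hΦX]
    exact Function.leftInverse_invFun h3 _
  have hw' : (T : Mat m) * Function.invFun (Φ T) 1 = Function.invFun (Φ T) 1 * (T₀ : Mat m) := by
    rw [hinv]
    exact sub_eq_zero.1 (hker X X.2)
  refine ⟨_, h2, eq_mul_inv_of_mul_eq (Subtype.ext ?_)⟩
  change (T : Mat m) * (toSL (Function.invFun (Φ T) 1) : G m) =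
    (toSL (Function.invFun (Φ T) 1) : G m) * (T₀ : Mat m)
  rw [coe_toSL (NeZero.ne m) h1, Matrix.mul_smul, hw', Matrix.smul_mul]

/-! ### Polygons with conjugate monodromies -/

omit [NeZero m] in
theorem continuous_frame (n : ℕ) : Continuous fun L : GN m N => frame L n := by
  induction n with
  | zero => exact continuous_const
  | succ n ih => exact ih.mul (continuous_apply (n : ZMod N)).inv

variable [NeZero N]

/-- The gauge transformation that intertwines two frames. -/
def frameGauge (g : G m) (L₀ L : GN m N) : GN m N := fun s =>
  (frame L s.val)⁻¹ * g * frame L₀ s.val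

omit [NeZero m] in
-- The sequence `gₙ(L)⁻¹ g gₙ(L₀)` carries one frame to the other. It is periodic exactly because
-- `g` conjugates the monodromies, so it descends to indices modulo `N`.
theorem gauge_frameGauge {g : G m} {L₀ L : GN m N} (h : monodromy L = g * monodromy L₀ * g⁻¹) :
    gauge (frameGauge g L₀ L) L₀ = L := by
  have hper : Function.Periodic (fun n : ℕ => (frame L n)⁻¹ * g * frame L₀ n) N := fun n => by
    simp only [frame_add, h]
    group
  have hcast : ∀ n : ℕ, frameGauge g L₀ L n = (frame L n)⁻¹ * g * frame L₀ n := fun n => by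
    rw [frameGauge, ZMod.val_natCast]
    exact hper.map_mod_nat n
  funext s
  obtain ⟨n, rfl⟩ := ZMod.natCast_zmod_surjective s
  have h1 := hcast (n + 1)
  rw [Nat.cast_succ] at h1
  rw [gauge, h1, hcast]
  simp only [frame]
  group

theorem eventually_exists_gauge (L₀ : GN m N) {O : Set (GN m N)} (hO : O ∈ 𝓝 1) :
    ∀ᶠ L in 𝓝 L₀, IsConj (monodromy L₀) (monodromy L) → ∃ K ∈ O, L = gauge K L₀ := by
  have h1 : Continuous fun p : G m × GN m N => frameGauge p.1 L₀ p.2 :=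
    continuous_pi fun s => (((continuous_frame _).comp continuous_snd).inv.mul
      continuous_fst).mul continuous_const
  have h2 : frameGauge 1 L₀ L₀ = 1 := by
    funext s
    simp [frameGauge]
  have h3 : ∀ᶠ p in 𝓝 ((1 : G m), L₀), frameGauge p.1 L₀ p.2 ∈ O :=
    h1.continuousAt.eventually (by beta_reduce; rw [h2]; exact hO)
  rw [nhds_prod_eq, Filter.eventually_prod_iff] at h3
  obtain ⟨pa, hpa, pb, hpb, hab⟩ := h3
  filter_upwards [hpb, (continuous_frame N).continuousAt.eventually
    (eventually_exists_conj (monodromy L₀) hpa)] with L hL hL' hconj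
  obtain ⟨g, hg, h4⟩ := hL' hconj
  exact ⟨_, hab hg hL, (gauge_frameGauge h4).symm⟩

end TwistedGon

namespace TwistedGon

open Matrix Topology
open scoped ContDiff Matrix.Norms.Elementwise

variable {m N : ℕ} [NeZero m] [NeZero N]

/-! ### The symplectic leaves -/

theorem mem_leaf_symm {W : Set (Moduli m N)} {p q : Moduli m N} (h : q ∈ symplecticLeaf W p) :
    p ∈ symplecticLeaf W q := by
  induction h with
  | refl => exact Relation.ReflTransGen.refl
  | tail _ h2 ih => exact Relation.ReflTransGen.head h2.symm ih

omit [NeZero N] in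
theorem monodromyClass_proj (L : GN m N) :
    monodromyClass (proj L) = ConjClasses.mk (monodromy L) := rfl

/-- Near `p`, the symplectic leaf contains all points with the monodromy class of `p`. -/
theorem eventually_mem_leaf (hm : 2 ≤ m) (hmN : Nat.Coprime m N) {W : Set (Moduli m N)}
    (hW : IsOpen W) (hWn : W ⊆ nondegenerate m N) {p : Moduli m N} (hp : p ∈ W) :
    ∀ᶠ q in 𝓝 p, monodromyClass q = monodromyClass p → q ∈ symplecticLeaf W p := by
  obtain ⟨L₀, rfl⟩ := proj_surjective p
  have h1 := eventually_exists_gauge L₀ (eventually_gauge_mem_leaf hm hmN hW hWn hp)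
  filter_upwards [isOpenMap_proj.image_mem_nhds h1]
  rintro _ ⟨L, hL, rfl⟩ hclass
  rw [monodromyClass_proj, monodromyClass_proj, ConjClasses.mk_eq_mk_iff_isConj] at hclass
  obtain ⟨K, hK, rfl⟩ := hL hclass.symm
  exact hK

theorem joinedIn_of_mem_leaf (hm : 2 ≤ m) (hmN : Nat.Coprime m N) {W : Set (Moduli m N)}
    (hWn : W ⊆ nondegenerate m N) {p q : Moduli m N} (hp : p ∈ W)
    (h : q ∈ symplecticLeaf W p) :
    JoinedIn {x | x ∈ W ∧ monodromyClass x = monodromyClass p} p q := by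
  induction h with
  | refl => exact JoinedIn.refl ⟨hp, rfl⟩
  | tail _ h2 ih =>
    obtain ⟨U, h, c, -, hUW, hh, hc, h0, h1⟩ := h2
    refine ih.trans (JoinedIn.ofLine hc.continuousOn h0 h1 ?_)
    rintro _ ⟨t, ht, rfl⟩
    refine ⟨hUW (hc.mapsTo t ht), ?_⟩
    rw [monodromyClass_trajectory hm hmN (hUW.trans hWn) hh hc ht, h0]
    exact ih.target_mem.2

theorem mem_leaf_of_joinedIn (hm : 2 ≤ m) (hmN : Nat.Coprime m N) {W : Set (Moduli m N)}
    (hW : IsOpen W) (hWn : W ⊆ nondegenerate m N) {p q : Moduli m N}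
    (h : JoinedIn {x | x ∈ W ∧ monodromyClass x = monodromyClass p} p q) :
    q ∈ symplecticLeaf W p := by
  obtain ⟨γ, hγ⟩ := h
  -- Every point of the path has a neighbourhood whose points of the same monodromy class lie on its
  -- own leaf. As leaves are equivalence classes, membership in the leaf of `p` can change nowhere
  -- along the path.
  have h1 : IsLocallyConstant fun t => γ t ∈ symplecticLeaf W p := by
    rw [IsLocallyConstant.iff_eventually_eq]
    intro t
    filter_upwards [γ.continuous.continuousAt.eventually
      (eventually_mem_leaf hm hmN hW hWn (hγ t).1)] with s hs
    have h2 : γ s ∈ symplecticLeaf W (γ t) := hs ((hγ s).2.trans (hγ t).2.symm)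
    exact propext ⟨fun h => Relation.ReflTransGen.trans h (mem_leaf_symm h2),
      fun h => Relation.ReflTransGen.trans h h2⟩
  have h2 := h1.apply_eq_of_preconnectedSpace 1 0
  rw [γ.source, γ.target] at h2
  exact h2.mpr Relation.ReflTransGen.refl

end TwistedGon

theorem mainTheorem9 (m N : ℕ) [NeZero m] [NeZero N] (hm : 2 ≤ m) (hmN : Nat.Coprime m N) :
    (∀ (U : Set (TwistedGon.Moduli m N)) (f h : TwistedGon.Moduli m N → ℝ), IsOpen U →
      U ⊆ TwistedGon.nondegenerate m N → TwistedGon.SmoothOn f U → TwistedGon.SmoothOn h U →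
      ∀ L : TwistedGon.GN m N, TwistedGon.proj L ∈ U →
        TwistedGon.reducedBracket f h (TwistedGon.proj L) =
          TwistedGon.twistedBracket (fun L' => f (TwistedGon.proj L'))
            (fun L' => h (TwistedGon.proj L')) L) ∧
    ∀ W : Set (TwistedGon.Moduli m N), IsOpen W → W ⊆ TwistedGon.nondegenerate m N → ∀ p ∈ W,
      (∀ q : TwistedGon.Moduli m N, q ∈ TwistedGon.symplecticLeaf W p ↔
        JoinedIn {x | x ∈ W ∧ TwistedGon.monodromyClass x = TwistedGon.monodromyClass p} p q) ∧
      ∃ U : Set (TwistedGon.Moduli m N), IsOpen U ∧ p ∈ U ∧ U ⊆ W ∧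
        ∀ q ∈ U, q ∈ TwistedGon.symplecticLeaf W p ↔
          TwistedGon.monodromyClass q = TwistedGon.monodromyClass p := by
  refine ⟨fun U f h _ _ hf hh L hL => TwistedGon.reducedBracket_proj hf hh hL,
    fun W hW hWn p hp => ⟨fun q => ⟨TwistedGon.joinedIn_of_mem_leaf hm hmN hWn hp,
      TwistedGon.mem_leaf_of_joinedIn hm hmN hW hWn⟩, ?_⟩⟩
  obtain ⟨U, hU, hUo, hpU⟩ :=
    mem_nhds_iff.1 (TwistedGon.eventually_mem_leaf hm hmN hW hWn hp)
  exact ⟨U ∩ W, hUo.inter hW, ⟨hpU, hp⟩, Set.inter_subset_right, fun q hq =>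
    ⟨fun h => (TwistedGon.joinedIn_of_mem_leaf hm hmN hWn hp h).target_mem.2, hU hq.1⟩⟩
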